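/- Let $n\ge 0$, let $s_1,\dots,s_n$ be the simple transpositions $s_i=(i\ i{+}1)$ in $S_{n+1}$, the Weyl group of $SL_{n+1}$ over $\mathbb C$, and let $\omega_0\in S_{n+1}$ be the longest element, $i\mapsto n+2-i$. Let $\overline{\omega_0}=s_{i_1}\cdots s_{i_N}$ be a reduced decomposition of $\omega_0$ (a shortest expression as a product of simple transpositions; $N=n(n+1)/2$). *String diagram.* Start with strings $U_1,\dots,U_{n+1}$ at the top, numbered from left to right, and going down let them cross successively at vertices $t_1,\dots,t_N$, where $t_r$ exchanges the strings in positions $i_r$ and $i_r+1$; we say that $t_r$ lies in column $i_r$. Let $b_k$ be the lower end of $U_k$. *String inequalities.* For $1\le k\le n$ orient $U_1,\dots,U_k$ upward and $U_{k+1},\dots,U_{n+1}$ downward. A rigorous path is an oriented path in the diagram from $b_k$ to $b_{k+1}$ that meets no vertex more than once and never goes straight through a crossing of two strings of the same orientation, along the one that runs upward to the left (if both are oriented upward) or along the one that runs downward to the left (if both are oriented downward). It has an exponent vector $M\in\mathbb Z^N$ whose $r$-th entry is $-1$ if the path switches at $t_r$ from $U_i$ to $U_j$ with $i<j$, is $+1$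 if it switches at $t_r$ from $U_i$ to $U_j$ with $i>j$, and is $0$ otherwise. The string inequalities are the inequalities $\sum_r M_r x_r\le 0$, one for each vector $M$ so obtained. *$\lambda$-inequalities.* For $1\le i\le N$ let $\lambda_i$ be the inequality $x_i-\sum_{j>i}c_jx_j\le 2$, where $c_j=-2$ if $t_j$ is in the same column as $t_i$, $c_j=1$ if $t_j$ is one column to the left or right of $t_i$, and $c_j=0$ otherwise. Let $d$ run over all string inequalities and all $\lambda$-inequalities, let $M_d\in\mathbb Z^N$ be the coefficient vector of the left-hand side of the inequality $d$, and write $T^{M_d}=t_1^{M_{d,1}}\cdots t_N^{M_{d,N}}$. *Box equations.* A box is a bounded region of the string diagram; it is bounded above by a vertex $t_{\rm top}$ and below by a vertex $t_{\rm bot}$, two successive vertices of one column. For every box and every two string inequalities $p_1,p_2$ such that $T^{p_1}T^{\lambda_{\rm top}}=T^{p_2}T^{\lambda_{\rm bot}}$, the exponent of $t_{\rm top}$ in $T^{p_1}$ is $-1$, and the exponent of $t_{\rm bot}$ in $T^{p_2}$ is $1$, there is the combinatorial box equation $a_{p_1}a_{\lambda_{\rm top}}=a_{p_2}a_{\lambda_{\rm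 bot}}$. *Families.* Let $P_{\overline{\omega_0}}$ be the closed subscheme of the torus $\operatorname{Spec}\mathbb C[a_d^{\pm1}]_d$ defined by all combinatorial box equations, and let $F_{\overline{\omega_0}}\to P_{\overline{\omega_0}}$ be the family of hypersurfaces $$Z_{\overline{\omega_0},a}:\quad 1-\sum_d a_d\,T^{M_d}=0\quad\text{in the torus }\operatorname{Spec}\mathbb C[t_1^{\pm1},\dots,t_N^{\pm1}],\qquad a\in P_{\overline{\omega_0}}.$$ **Corollary.** For any two reduced decompositions $\overline{\omega_0}$ and $\overline{\omega_0}'$ of $\omega_0$, the families $F_{\overline{\omega_0}}$ and $F_{\overline{\omega_0}'}$ are birational. That is, there are an isomorphism $g:P_{\overline{\omega_0}}\to P_{\overline{\omega_0}'}$ of schemes over $\mathbb C$ and an isomorphism $H:U\to U'$, lying over $g$, between dense open subschemes $U\subseteq F_{\overline{\omega_0}}$ and $U'\subseteq F_{\overline{\omega_0}'}$ whose intersections with every fibre of the respective family are dense in that fibre. In particular $H$ induces a birational map $Z_{\overline{\omega_0},a}\dashrightarrow Z_{\overline{\omega_0}',g(a)}$ for every $a\in P_{\overline{\omega_0}}$.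 -/

import Mathlib

open CategoryTheory AlgebraicGeometry

/-! Reduced decompositions in the Weyl group `S_{n+1}` of `SL_{n+1}`. -/

/-- The simple reflection exchanging the adjacent positions `i` and `i + 1`. -/
def simpleRefl {n : ℕ} (i : Fin n) : Equiv.Perm (Fin (n + 1)) :=
  Equiv.swap i.castSucc i.succ

/-- The product of the simple reflections of a word. -/
def wordProd {n : ℕ} (w : List (Fin n)) : Equiv.Perm (Fin (n + 1)) :=
  (w.map simpleRefl).prod

/-- `w` is a reduced decomposition of `x`: a shortest word with product `x`. -/
def IsReducedDecomposition {n : ℕ} (w : List (Fin n)) (x : Equiv.Perm (Fin (n + 1))) : Prop :=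
  wordProd w = x ∧ ∀ v : List (Fin n), wordProd v = x → w.length ≤ v.length

/-- The longest element of `S_{n+1}`, the permutation that reverses the order. -/
def longestElement (n : ℕ) : Equiv.Perm (Fin (n + 1)) := Fin.revPerm

/-! The string diagram. The crossing `r : Fin w.length` lies between level `r` (above it) and
level `r + 1` (below it); level `0` is the top and level `w.length` the bottom of the diagram.
Strings are numbered by their position at the top. -/

/-- The string that stands at position `p` on level `m`. -/
def stringAt {n : ℕ} (w : List (Fin n)) (m : ℕ) (p : Fin (n + 1)) : Fin (n + 1) :=
  wordProd (w.take m) p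

/-- The column of the crossing `r`: it exchanges positions `column w r` and `column w r + 1`. -/
def column {n : ℕ} (w : List (Fin n)) (r : Fin w.length) : Fin n := w.get r

/-- The string that enters the crossing `r` from the upper left. -/
def leftString {n : ℕ} (w : List (Fin n)) (r : Fin w.length) : Fin (n + 1) :=
  stringAt w r (column w r).castSucc

/-- The string that enters the crossing `r` from the upper right. -/
def rightString {n : ℕ} (w : List (Fin n)) (r : Fin w.length) : Fin (n + 1) :=
  stringAt w r (column w r).succ

/-- The string `u` passes through the crossing `r`. -/
def Meets {n : ℕ} (w : List (Fin n)) (r : Fin w.length) (u : Fin (n + 1)) : Prop :=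
  u = leftString w r ∨ u = rightString w r

/-- With the parameter `k : Fin n`, the strings up to and including the string `k.castSucc` are
oriented upward and all other strings, from `k.succ` on, downward. -/
def IsUp {n : ℕ} (k : Fin n) (u : Fin (n + 1)) : Prop := u ≤ k.castSucc

instance {n : ℕ} (k : Fin n) (u : Fin (n + 1)) : Decidable (IsUp k u) :=
  inferInstanceAs (Decidable (u ≤ k.castSucc))

/-- One step of a path: it comes into the row of the crossing `row` on the string `inStr` and
leaves this row on the string `outStr`. -/
structure PathStep (n N : ℕ) where
  row : Fin N
  inStr : Fin (n + 1)
  outStr : Fin (n + 1)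

/-- The level from which an oriented step comes into its row. -/
def PathStep.entry {n N : ℕ} (k : Fin n) (s : PathStep n N) : ℕ :=
  if IsUp k s.inStr then s.row + 1 else s.row

/-- The level on which an oriented step leaves its row. -/
def PathStep.exit {n N : ℕ} (k : Fin n) (s : PathStep n N) : ℕ :=
  if IsUp k s.outStr then s.row else s.row + 1

/-- A step stays on its string (passing by the crossing of the row or going straight through it),
or it switches at the crossing from one of the two strings to the other. -/
def PathStep.IsValid {n : ℕ} (w : List (Fin n)) (s : PathStep n w.length) : Prop :=
  s.outStr = s.inStr ∨ (Meets w s.row s.inStr ∧ Meets w s.row s.outStr)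

/-- A bad fragment: the step goes straight along a string `u` through its crossing with a string
`v` of the same orientation, either upward to the left (`u` is then the string from the upper left to
the lower right) or downward to the left (`u` is then the string from the upper right to the lower
left). -/
def PathStep.IsBad {n : ℕ} (w : List (Fin n)) (k : Fin n) (s : PathStep n w.length) : Prop :=
  s.outStr = s.inStr ∧
    ((s.inStr = leftString w s.row ∧ IsUp k s.inStr ∧ IsUp k (rightString w s.row)) ∨
      (s.inStr = rightString w s.row ∧ ¬ IsUp k s.inStr ∧ ¬ IsUp k (leftString w s.row)))

/-- A rigorous path: an oriented path from the lower end of the string `k.castSucc` to the lower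
end of the string `k.succ` that visits no vertex twice and contains no bad fragment. -/
structure IsRigorousPath {n : ℕ} (w : List (Fin n)) (k : Fin n)
    (p : List (PathStep n w.length)) : Prop where
  valid : ∀ s ∈ p, s.IsValid w
  start : ∃ s ∈ p.head?, s.inStr = k.castSucc ∧ s.entry k = w.length
  finish : ∃ s ∈ p.getLast?, s.outStr = k.succ ∧ s.exit k = w.length
  chain : p.IsChain fun s s' => s.outStr = s'.inStr ∧ s.exit k = s'.entry k
  simple : p.Pairwise fun s s' =>
    Meets w s.row s.inStr → Meets w s'.row s'.inStr → s.row ≠ s'.row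
  not_bad : ∀ s ∈ p, ¬ s.IsBad w k

open Classical in
/-- The exponent vector of the string inequality `-∑ aᵣ xᵣ ≤ 0` of a path: `aᵣ` is `1` if the path
switches at `r` to a string with a larger number, `-1` if it switches at `r` to a string with a
smaller number, and `0` if it does not switch at `r`. -/
noncomputable def pathExponent {n N : ℕ} (p : List (PathStep n N)) : Fin N → ℤ := fun r =>
  if ∃ s ∈ p, s.row = r ∧ s.inStr < s.outStr then -1
  else if ∃ s ∈ p, s.row = r ∧ s.outStr < s.inStr then 1
  else 0

/-- The exponent vectors of the string inequalities. -/
def stringExponents {n : ℕ} (w : List (Fin n)) : Set (Fin w.length → ℤ) :=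
  {M | ∃ (k : Fin n) (p : List (PathStep n w.length)), IsRigorousPath w k p ∧ pathExponent p = M}

theorem stringExponents_finite {n : ℕ} (w : List (Fin n)) : (stringExponents w).Finite := by
  refine Set.Finite.subset
    (Set.Finite.pi' (t := fun _ : Fin w.length => ({-1, 0, 1} : Set ℤ)) fun _ => by simp) ?_
  rintro M ⟨k, p, -, rfl⟩ r
  simp only [pathExponent]
  split_ifs <;> simp

/-- The exponent vector of the inequality `x_i ≤ 2 + ∑_{j > i} c_j x_j`, in which `c_j` is `-2` if
`j` is in the column of `i`, `1` if it is one column to the left or right, and `0` otherwise. -/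
def lambdaExponent {n : ℕ} (w : List (Fin n)) (i : Fin w.length) : Fin w.length → ℤ := fun j =>
  if j = i then 1
  else if i < j then
    if column w j = column w i then 2
    else if (column w j : ℕ) + 1 = column w i ∨ (column w i : ℕ) + 1 = column w j then -1
    else 0
  else 0

/-- The index set of the defining inequalities: the `λ`-inequalities, one for each crossing, and
the string inequalities. -/
abbrev InequalityIndex {n : ℕ} (w : List (Fin n)) : Type :=
  Fin w.length ⊕ stringExponents w

noncomputable instance {n : ℕ} (w : List (Fin n)) : Fintype (InequalityIndex w) :=
  haveI : Finite (stringExponents w) := stringExponents_finite w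
  Fintype.ofFinite _

/-- The exponent vector `M_d` of the monomial of a defining inequality. -/
def exponent {n : ℕ} (w : List (Fin n)) : InequalityIndex w → Fin w.length → ℤ
  | Sum.inl i => lambdaExponent w i
  | Sum.inr M => M.1

/-- `top` and `bot` are the upper and lower vertex of a box, that is, of a bounded region of the
string diagram: two successive crossings in the same column. -/
def IsBox {n : ℕ} (w : List (Fin n)) (top bot : Fin w.length) : Prop :=
  top < bot ∧ column w top = column w bot ∧
    ∀ r, top < r → r < bot → column w r ≠ column w top

/-- The box conditions for two string inequalities `p₁`, `p₂` and the box with vertices `top` and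
`bot`. -/
def BoxCondition {n : ℕ} (w : List (Fin n)) (top bot : Fin w.length)
    (p₁ p₂ : stringExponents w) : Prop :=
  IsBox w top bot ∧ p₁.1 + lambdaExponent w top = p₂.1 + lambdaExponent w bot ∧
    p₁.1 top = -1 ∧ p₂.1 bot = 1

/-! The families. The ring of Laurent polynomials over `R` in variables indexed by `ι` is the
monoid algebra of the group of exponent vectors `ι → ℤ`. -/

/-- Laurent polynomials over `R` in variables indexed by `ι`. -/
abbrev LaurentRing (R ι : Type) [CommRing R] : Type := AddMonoidAlgebra R (ι → ℤ)

open Classical in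
/-- The coordinate `a_d` of the torus of all coefficient vectors with non-zero entries. -/
noncomputable def torusCoord {n : ℕ} (w : List (Fin n)) (d : InequalityIndex w) :
    LaurentRing ℂ (InequalityIndex w) :=
  AddMonoidAlgebra.single (Pi.single d 1) 1

/-- The ideal generated by the combinatorial box equations
`a_{p₁} a_{λ_top} = a_{p₂} a_{λ_bot}`. -/
noncomputable def boxIdeal {n : ℕ} (w : List (Fin n)) : Ideal (LaurentRing ℂ (InequalityIndex w)) :=
  Ideal.span {e | ∃ (top bot : Fin w.length) (p₁ p₂ : stringExponents w),
    BoxCondition w top bot p₁ p₂ ∧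
      e = torusCoord w (Sum.inr p₁) * torusCoord w (Sum.inl top) -
        torusCoord w (Sum.inr p₂) * torusCoord w (Sum.inl bot)}

/-- The coordinate ring of the parameter space. -/
abbrev ParamRing {n : ℕ} (w : List (Fin n)) : Type :=
  LaurentRing ℂ (InequalityIndex w) ⧸ boxIdeal w

/-- The coefficient `a_d`, as a function on the parameter space. -/
noncomputable def coefficient {n : ℕ} (w : List (Fin n)) (d : InequalityIndex w) : ParamRing w :=
  Ideal.Quotient.mk (boxIdeal w) (torusCoord w d)

/-- The universal Laurent polynomial `1 - ∑ a_d T^{M_d}` over the parameter space. -/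
noncomputable def universalPolynomial {n : ℕ} (w : List (Fin n)) :
    LaurentRing (ParamRing w) (Fin w.length) :=
  1 - ∑ d, AddMonoidAlgebra.single (exponent w d) (coefficient w d)

/-- The coordinate ring of the total space of the family. -/
abbrev FamilyRing {n : ℕ} (w : List (Fin n)) : Type :=
  LaurentRing (ParamRing w) (Fin w.length) ⧸ Ideal.span {universalPolynomial w}

/-- The parameter space `P`, the closed subscheme of the torus of coefficient vectors that is
defined by the combinatorial box equations. -/
noncomputable def paramSpace {n : ℕ} (w : List (Fin n)) : Scheme.{0} :=
  Spec (CommRingCat.of (ParamRing w))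

/-- The structure morphism of the parameter space over `Spec ℂ`. -/
noncomputable def paramSpaceToSpec {n : ℕ} (w : List (Fin n)) :
    paramSpace w ⟶ Spec (CommRingCat.of ℂ) :=
  Spec.map (CommRingCat.ofHom (algebraMap ℂ (ParamRing w)))

/-- The total space of the family `F`, the closed subscheme `∑ a_d T^{M_d} = 1` of the product of
the parameter space with the torus `Spec ℂ[t₁^±, …, t_N^±]`. -/
noncomputable def familySpace {n : ℕ} (w : List (Fin n)) : Scheme.{0} :=
  Spec (CommRingCat.of (FamilyRing w))

/-- The family `F` as a morphism to its base. Its fibre over a coefficient vector `a` is the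
hypersurface `Z_a`. -/
noncomputable def family {n : ℕ} (w : List (Fin n)) : familySpace w ⟶ paramSpace w :=
  Spec.map (CommRingCat.ofHom (algebraMap (ParamRing w) (FamilyRing w)))

/-- Two families `π : X ⟶ S` and `π' : X' ⟶ S'` over a base scheme `B` are birational: there are
an isomorphism `g` of the parameter spaces over `B` and an isomorphism between dense open
subschemes of `X` and `X'` lying over `g`, where these open subschemes are dense in every fibre, so
that a birational correspondence between the fibres over `s` and `g s` is induced for every `s`. -/
def BirationalFamilies {B S S' X X' : Scheme.{0}} (b : S ⟶ B) (b' : S' ⟶ B)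
    (π : X ⟶ S) (π' : X' ⟶ S') : Prop :=
  ∃ (g : S ≅ S') (H : X.PartialIso X'),
    g.hom ≫ b' = b ∧ H.IsOver (π ≫ g.hom) π' ∧
      (∀ s : S, Dense ((π.fiberι s ⁻¹ᵁ H.source : (π.fiber s).Opens) : Set (π.fiber s))) ∧
      ∀ s : S', Dense ((π'.fiberι s ⁻¹ᵁ H.target : (π'.fiber s).Opens) : Set (π'.fiber s))

/-!
Any two reduced words for the same permutation are connected by moves that exchange two commuting
letters or replace `i, j, i` by `j, i, j` for adjacent letters (`connected_by_moves`). So it suffices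
to relate the families of two words that differ by one move (`related_pairWord`,
`related_braidWord`), and to compose such relations (`HasRoof.trans`).

*Paths.* A move changes the string diagram only inside a small region with two or three crossings. A
rigorous path consists of steps outside this region and of runs through it, and the runs can be
replaced by runs with the same ends through the other small diagram (`IsRegion.decompose`). The
possible collections of runs are restricted by planarity: a simple path cannot cross a level in the
same direction on two neighbouring strings, because the winding number to the left of the path is
constant along it (`leftFace_eq`, `not_crosses_adjacent`). After this restriction the collections are
few enough to be enumerated (`runsMatch_pairs`, `runsMatch_triple`). A commutation move merely
exchanges two entries of each exponent vector. For a braid move, let `(x, y, z)` be the entries at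
its three crossings; then `(x, y, x)` is replaced by `(y, x, y)`, and the two vectors `(-1, x, 0)` and
`(0, x - 1, 1)`, which always occur together, are replaced by the one vector `(x, 0, x - 1)`, or
conversely (`localLaw`).

*Parameters.* Let `v = (1, -1, 1)` at the three crossings of a braid move, and choose units `α` and
`β` whose ratio is that of the coefficients of the two `λ`-inequalities of the outer crossings. The
coefficients for the new word are those for the old word up to factors `α` and `β`
(`mutateString`, `mutateLambda`). The box equation of the small box says precisely that the two
expressions for the coefficient of `(x, 0, x - 1)` agree (`mutateString_sing'`), and the other box
equations are preserved (`SolvesBoxes.mutate`). The one combination of vectors for which this could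
fail, with a box that surrounds the three crossings, is excluded since two paths related by a box
differ by a circulation around this box (`BoxPair.flux_sub`, `BoxPair.not_straddling`). Mutation
with the roles of `α` and `β` interchanged is the inverse, so the parameter spaces are isomorphic.

*Hypersurfaces.* With `H = α + β T^{-v}` the substitution that sends the new monomial `T^M` to
`H ^ (M₀ - M₂) * T^{τ M}`, for a linear map `τ`, transforms the defining equation of one family into
that of the other (`inequalitySum_mutate`). It gives an isomorphism of the loci where the binomials of
the two families are invertible (`IsTransition.exists_equiv`). These loci are dense in every fibre: on
the zero locus of `H` in the torus the monomial `T^v` is constant, and as no exponent vector of an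
inequality is a multiple of `v`, the defining equation does not vanish identically there. So `H` is a
non-zero-divisor on the fibre (`dvd_of_dvd_binomial_mul`, `exists_prime_notMem_binomial`).
-/

/-! ### Reduced words and braid moves -/

/-- The number of inversions of a permutation. -/
def inversionCount {n : ℕ} (x : Equiv.Perm (Fin (n + 1))) : ℕ :=
  (Finset.univ.filter fun p : Fin (n + 1) × Fin (n + 1) => p.1 < p.2 ∧ x p.2 < x p.1).card

theorem simpleRefl_apply_val {n : ℕ} (i : Fin n) (a : Fin (n + 1)) :
    (simpleRefl i a : ℕ) =
      if (a : ℕ) = i then (i : ℕ) + 1 else if (a : ℕ) = i + 1 then (i : ℕ) else a := by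
  unfold simpleRefl
  rw [Equiv.swap_apply_def]
  simp only [Fin.ext_iff, Fin.val_castSucc, Fin.val_succ]
  split_ifs <;> simp_all

theorem simpleRefl_mul_self {n : ℕ} (i : Fin n) : simpleRefl i * simpleRefl i = 1 :=
  Equiv.swap_mul_self _ _

theorem simpleRefl_simpleRefl {n : ℕ} (i : Fin n) (a : Fin (n + 1)) :
    simpleRefl i (simpleRefl i a) = a :=
  Equiv.swap_apply_self _ _ _

theorem simpleRefl_castSucc {n : ℕ} (i : Fin n) : simpleRefl i i.castSucc = i.succ :=
  Equiv.swap_apply_left _ _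

theorem simpleRefl_succ {n : ℕ} (i : Fin n) : simpleRefl i i.succ = i.castSucc :=
  Equiv.swap_apply_right _ _

theorem simpleRefl_lt {n : ℕ} (i : Fin n) {a b : Fin (n + 1)} (h : a < b)
    (hne : ¬ (a = i.castSucc ∧ b = i.succ)) : simpleRefl i a < simpleRefl i b := by
  rw [Fin.lt_def, simpleRefl_apply_val, simpleRefl_apply_val]
  simp only [Fin.ext_iff, Fin.lt_def, Fin.val_castSucc, Fin.val_succ] at h hne
  split_ifs <;> omega

theorem inversionCount_mul_of_lt {n : ℕ} (x : Equiv.Perm (Fin (n + 1))) (i : Fin n)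
    (h : x i.castSucc < x i.succ) :
    inversionCount (x * simpleRefl i) = inversionCount x + 1 := by
  unfold inversionCount
  set S := Finset.univ.filter fun p : Fin (n + 1) × Fin (n + 1) => p.1 < p.2 ∧ x p.2 < x p.1
  have hmem : (i.castSucc, i.succ) ∈ Finset.univ.filter fun p : Fin (n + 1) × Fin (n + 1) =>
      p.1 < p.2 ∧ (x * simpleRefl i) p.2 < (x * simpleRefl i) p.1 := by
    rw [Finset.mem_filter]
    simp [simpleRefl_castSucc, simpleRefl_succ, h, Fin.castSucc_lt_succ]
  rw [← Finset.card_erase_add_one hmem]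
  congr 1
  refine Finset.card_nbij' (fun p => (simpleRefl i p.1, simpleRefl i p.2))
    (fun p => (simpleRefl i p.1, simpleRefl i p.2)) ?_ ?_ ?_ ?_
  · rintro ⟨a, b⟩ hp
    rw [Finset.mem_coe, Finset.mem_erase, Finset.mem_filter] at hp
    rw [Finset.mem_coe, Finset.mem_filter]
    simp only [Finset.mem_univ, true_and, ne_eq, Prod.mk.injEq, Equiv.Perm.mul_apply] at hp ⊢
    exact ⟨simpleRefl_lt i hp.2.1 hp.1, hp.2.2⟩
  · rintro ⟨a, b⟩ hp
    rw [Finset.mem_coe, Finset.mem_filter] at hp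
    rw [Finset.mem_coe, Finset.mem_erase, Finset.mem_filter]
    simp only [Finset.mem_univ, true_and, ne_eq, Prod.mk.injEq, Equiv.Perm.mul_apply,
      simpleRefl_simpleRefl] at hp ⊢
    have hne : ¬ (a = i.castSucc ∧ b = i.succ) := by
      rintro ⟨rfl, rfl⟩
      exact absurd hp.2 (not_lt.2 h.le)
    refine ⟨?_, simpleRefl_lt i hp.1 hne, hp.2⟩
    rintro ⟨h1, h2⟩
    have h1' : a = i.succ := by rw [← simpleRefl_simpleRefl i a, h1, simpleRefl_castSucc]
    have h2' : b = i.castSucc := by rw [← simpleRefl_simpleRefl i b, h2, simpleRefl_succ]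
    have := hp.1
    rw [h1', h2', Fin.lt_def] at this
    simp at this
  · rintro ⟨a, b⟩ -
    simp [simpleRefl_simpleRefl]
  · rintro ⟨a, b⟩ -
    simp [simpleRefl_simpleRefl]

theorem inversionCount_mul_of_gt {n : ℕ} (x : Equiv.Perm (Fin (n + 1))) (i : Fin n)
    (h : x i.succ < x i.castSucc) :
    inversionCount x = inversionCount (x * simpleRefl i) + 1 := by
  rw [← inversionCount_mul_of_lt (x * simpleRefl i) i
    (by simpa [simpleRefl_castSucc, simpleRefl_succ] using h), mul_assoc, simpleRefl_mul_self,
    mul_one]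

theorem wordProd_append {n : ℕ} (v w : List (Fin n)) :
    wordProd (v ++ w) = wordProd v * wordProd w := by
  simp [wordProd]

theorem wordProd_singleton {n : ℕ} (i : Fin n) : wordProd [i] = simpleRefl i := by
  simp [wordProd]

theorem wordProd_concat {n : ℕ} (v : List (Fin n)) (i : Fin n) :
    wordProd (v ++ [i]) = wordProd v * simpleRefl i := by
  rw [wordProd_append, wordProd_singleton]

theorem inversionCount_one {n : ℕ} : inversionCount (1 : Equiv.Perm (Fin (n + 1))) = 0 := by
  unfold inversionCount
  rw [Finset.card_eq_zero, Finset.filter_eq_empty_iff]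
  rintro ⟨a, b⟩ - ⟨h1, h2⟩
  exact absurd h1 (not_lt.2 (le_of_lt h2))

theorem apply_ne {n : ℕ} (x : Equiv.Perm (Fin (n + 1))) (i : Fin n) :
    x i.castSucc ≠ x i.succ := fun h => by
  have := x.injective h
  simp [Fin.ext_iff] at this

theorem inversionCount_wordProd_le {n : ℕ} (w : List (Fin n)) :
    inversionCount (wordProd w) ≤ w.length := by
  induction w using List.reverseRecOn with
  | nil => simp [wordProd, inversionCount_one]
  | append_singleton w i ih =>
    rw [wordProd_concat, List.length_append, List.length_singleton]
    rcases lt_or_gt_of_ne (apply_ne (wordProd w) i) with h | h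
    · rw [inversionCount_mul_of_lt _ _ h]; omega
    · have := inversionCount_mul_of_gt _ _ h; omega

/-- A permutation without descents is the identity. -/
theorem exists_descent {n : ℕ} {x : Equiv.Perm (Fin (n + 1))} (hx : x ≠ 1) :
    ∃ i : Fin n, x i.succ < x i.castSucc := by
  by_contra! h
  have hm : StrictMono x := Fin.strictMono_iff_lt_succ.2 fun i =>
    lt_of_le_of_ne (h i) (apply_ne x i)
  apply hx
  have := Subsingleton.elim (hm.orderIsoOfSurjective x x.surjective) (OrderIso.refl _)
  ext a
  have h2 := congrArg (fun e : Fin (n + 1) ≃o Fin (n + 1) => (e a : ℕ)) this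
  simpa using h2

theorem exists_word {n : ℕ} (x : Equiv.Perm (Fin (n + 1))) :
    ∃ w : List (Fin n), wordProd w = x ∧ w.length = inversionCount x := by
  induction hm : inversionCount x using Nat.strong_induction_on generalizing x with
  | _ m ih =>
    by_cases hx : x = 1
    · subst hx
      exact ⟨[], by simp [wordProd], by rw [← hm, inversionCount_one]; rfl⟩
    · obtain ⟨i, hi⟩ := exists_descent hx
      have h1 := inversionCount_mul_of_gt x i hi
      obtain ⟨w, hw, hl⟩ := ih _ (by omega) (x * simpleRefl i) rfl
      refine ⟨w ++ [i], ?_, ?_⟩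
      · rw [wordProd_concat, hw, mul_assoc, simpleRefl_mul_self, mul_one]
      · simp [hl]; omega

theorem IsReducedDecomposition.length_eq {n : ℕ} {w : List (Fin n)}
    {x : Equiv.Perm (Fin (n + 1))} (h : IsReducedDecomposition w x) :
    w.length = inversionCount x := by
  obtain ⟨v, hv, hl⟩ := exists_word x
  have h1 := h.2 v hv
  have h2 := inversionCount_wordProd_le w
  rw [h.1] at h2
  omega

/-- In a word whose length is the number of inversions, each letter creates an inversion: at every
crossing the string from the upper left has the smaller number. -/
theorem leftString_lt_rightString {n : ℕ} {w : List (Fin n)}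
    (h : w.length = inversionCount (wordProd w)) (r : Fin w.length) :
    leftString w r < rightString w r := by
  induction w using List.reverseRecOn with
  | nil => exact r.elim0
  | append_singleton w i ih =>
    have hle := inversionCount_wordProd_le w
    rw [wordProd_concat, List.length_append, List.length_singleton] at h
    rcases lt_or_gt_of_ne (apply_ne (wordProd w) i) with hlt | hgt
    · rw [inversionCount_mul_of_lt _ _ hlt] at h
      rcases lt_or_ge (r : ℕ) w.length with hr | hr
      · have := ih (by omega) ⟨r, hr⟩
        have ht : (w ++ [i]).take r = w.take r := List.take_append_of_le_length hr.le
        simpa [leftString, rightString, stringAt, column, ht, List.getElem_append_left hr]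
          using this
      · have hr' : (r : ℕ) = w.length := by
          have := r.2
          simp only [List.length_append, List.length_singleton] at this
          omega
        simpa [leftString, rightString, stringAt, column, hr'] using hlt
    · have := inversionCount_mul_of_gt _ _ hgt
      omega

/-- A move on words: a commutation of two letters of distant columns or a braid move. -/
inductive WordMove {n : ℕ} : List (Fin n) → List (Fin n) → Prop
  | commute (A B : List (Fin n)) (i j : Fin n) (h : (i : ℕ) + 1 < j ∨ (j : ℕ) + 1 < i) :
      WordMove (A ++ [i, j] ++ B) (A ++ [j, i] ++ B)
  | braid (A B : List (Fin n)) (i j : Fin n) (h : (i : ℕ) + 1 = j ∨ (j : ℕ) + 1 = i) :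
      WordMove (A ++ [i, j, i] ++ B) (A ++ [j, i, j] ++ B)

theorem simpleRefl_commute {n : ℕ} {i j : Fin n} (h : (i : ℕ) + 1 < j ∨ (j : ℕ) + 1 < i) :
    simpleRefl i * simpleRefl j = simpleRefl j * simpleRefl i := by
  ext a
  simp only [Equiv.Perm.mul_apply, simpleRefl_apply_val]
  split_ifs <;> omega

theorem simpleRefl_braid {n : ℕ} {i j : Fin n} (h : (i : ℕ) + 1 = j ∨ (j : ℕ) + 1 = i) :
    simpleRefl i * simpleRefl j * simpleRefl i = simpleRefl j * simpleRefl i * simpleRefl j := by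
  have key : ∀ {i j : Fin n}, (i : ℕ) + 1 = j →
      simpleRefl i * simpleRefl j * simpleRefl i = simpleRefl j * simpleRefl i * simpleRefl j := by
    intro i j h
    have e : j.castSucc = i.succ := by ext; simp [h]
    have h1 : i.castSucc ≠ i.succ := Fin.castSucc_lt_succ.ne
    have h2 : i.succ ≠ j.succ := e ▸ Fin.castSucc_lt_succ.ne
    have h3 : i.castSucc ≠ j.succ := (Fin.castSucc_lt_succ.trans (e ▸ Fin.castSucc_lt_succ)).ne
    unfold simpleRefl
    rw [e, Equiv.swap_mul_swap_mul_swap h1 h3, Equiv.swap_comm i.castSucc i.succ,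
      Equiv.swap_comm i.succ j.succ, Equiv.swap_mul_swap_mul_swap h2.symm h3.symm,
      Equiv.swap_comm]
  exact h.elim key fun h => (key h).symm

theorem WordMove.wordProd_eq {n : ℕ} {v w : List (Fin n)} (h : WordMove v w) :
    wordProd v = wordProd w := by
  cases h with
  | commute A B i j h =>
    have := simpleRefl_commute h
    simp only [wordProd, List.map_append, List.prod_append, List.map_cons, List.prod_cons,
      List.map_nil, List.prod_nil, mul_one, this]
  | braid A B i j h =>
    have := simpleRefl_braid h
    simp only [wordProd, List.map_append, List.prod_append, List.map_cons, List.prod_cons,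
      List.map_nil, List.prod_nil, mul_one, ← mul_assoc (simpleRefl _), this]

theorem WordMove.length_eq {n : ℕ} {v w : List (Fin n)} (h : WordMove v w) :
    v.length = w.length := by
  cases h <;> simp

theorem WordMove.concat {n : ℕ} {v w : List (Fin n)} (h : WordMove v w) (k : Fin n) :
    WordMove (v ++ [k]) (w ++ [k]) := by
  cases h with
  | commute A B i j h => simpa using WordMove.commute A (B ++ [k]) i j h
  | braid A B i j h => simpa using WordMove.braid A (B ++ [k]) i j h

/-- Two words of minimal length for the same permutation are connected by moves: if the last
letters `i` and `j` differ, both are descents, and a shortest word ending in the longest element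
of the parabolic subgroup of `i` and `j` links the two. -/
theorem connected_by_moves {n : ℕ} (m : ℕ) (v w : List (Fin n)) (hvw : wordProd v = wordProd w)
    (hv : v.length = m) (hw : w.length = m) (hm : inversionCount (wordProd w) = m) :
    Relation.ReflTransGen WordMove v w := by
  induction m using Nat.strong_induction_on generalizing v w with
  | _ m ih =>
    rcases List.eq_nil_or_concat v with rfl | ⟨v', i, rfl⟩
    · rw [List.length_nil] at hv
      rw [List.eq_nil_of_length_eq_zero (hw.trans hv.symm)]
    rcases List.eq_nil_or_concat w with rfl | ⟨w', j, rfl⟩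
    · simp at hv hw
      omega
    have lift : ∀ {a b : List (Fin n)} (k : Fin n), Relation.ReflTransGen WordMove a b →
        Relation.ReflTransGen WordMove (a ++ [k]) (b ++ [k]) := fun k h =>
      h.lift (· ++ [k]) fun a b hab => hab.concat k
    simp only [List.concat_eq_append, List.length_append, List.length_singleton] at hv hw hvw hm ⊢
    have hx := hvw
    rw [wordProd_concat, wordProd_concat] at hx
    set x := wordProd (w' ++ [j]) with hxdef
    have hxi : x * simpleRefl i = wordProd v' := by
      rw [← hvw, wordProd_concat, mul_assoc, simpleRefl_mul_self, mul_one]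
    have hxj : x * simpleRefl j = wordProd w' := by
      rw [hxdef, wordProd_concat, mul_assoc, simpleRefl_mul_self, mul_one]
    have hdi : x i.succ < x i.castSucc := by
      rcases lt_or_gt_of_ne (apply_ne x i) with h | h
      · have h1 := inversionCount_mul_of_lt _ _ h
        have h2 := inversionCount_wordProd_le v'
        rw [hxi] at h1
        omega
      · exact h
    have hdj : x j.succ < x j.castSucc := by
      rcases lt_or_gt_of_ne (apply_ne x j) with h | h
      · have h1 := inversionCount_mul_of_lt _ _ h
        have h2 := inversionCount_wordProd_le w'
        rw [hxj] at h1
        omega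
      · exact h
    have hci := inversionCount_mul_of_gt _ _ hdi
    have hcj := inversionCount_mul_of_gt _ _ hdj
    by_cases hij : i = j
    · subst hij
      refine lift i (ih (m - 1) (by omega) v' w' ?_ (by omega) (by omega) ?_)
      · rw [← hxi, hxj]
      · rw [← hxj]; omega
    by_cases hfar : (i : ℕ) + 1 < j ∨ (j : ℕ) + 1 < i
    · have hd : (x * simpleRefl i) j.succ < (x * simpleRefl i) j.castSucc := by
        have e1 : simpleRefl i j.succ = j.succ := by
          ext; rw [simpleRefl_apply_val]; simp only [Fin.val_succ]; split_ifs <;> omega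
        have e2 : simpleRefl i j.castSucc = j.castSucc := by
          ext; rw [simpleRefl_apply_val]; simp only [Fin.val_castSucc]; split_ifs <;> omega
        rw [Equiv.Perm.mul_apply, Equiv.Perm.mul_apply, e1, e2]
        exact hdj
      have hcij := inversionCount_mul_of_gt _ _ hd
      obtain ⟨z, hz, hzl⟩ := exists_word (x * simpleRefl i * simpleRefl j)
      have hzj : wordProd (z ++ [j]) = wordProd v' := by
        rw [wordProd_concat, hz, mul_assoc, simpleRefl_mul_self, mul_one, hxi]
      have hzi : wordProd (z ++ [i]) = wordProd w' := by
        rw [wordProd_concat, hz, mul_assoc x, simpleRefl_commute hfar, ← mul_assoc, mul_assoc,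
          simpleRefl_mul_self, mul_one, hxj]
      have s1 := lift i (ih (m - 1) (by omega) v' (z ++ [j]) hzj.symm (by omega)
        (by simp; omega) (by rw [hzj, ← hxi]; omega))
      have s2 := lift j (ih (m - 1) (by omega) (z ++ [i]) w' hzi (by simp; omega) (by omega)
        (by rw [← hxj]; omega))
      refine s1.trans (Relation.ReflTransGen.head ?_ s2)
      simpa using WordMove.commute z [] j i hfar.symm
    · have hadj : (i : ℕ) + 1 = j ∨ (j : ℕ) + 1 = i := by
        have : (i : ℕ) ≠ j := fun h => hij (Fin.ext h)
        omega
      have key : (x * simpleRefl i) j.succ < (x * simpleRefl i) j.castSucc ∧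
          (x * simpleRefl i * simpleRefl j) i.succ <
            (x * simpleRefl i * simpleRefl j) i.castSucc := by
        simp only [Equiv.Perm.mul_apply]
        rcases hadj with h | h
        · have e0 : j.castSucc = i.succ := by ext; simp [h]
          have e1 : simpleRefl i j.succ = j.succ := by
            ext; rw [simpleRefl_apply_val]; simp only [Fin.val_succ]; split_ifs <;> omega
          have e2 : simpleRefl i j.castSucc = i.castSucc := by rw [e0, simpleRefl_succ]
          have e3 : simpleRefl j i.castSucc = i.castSucc := by
            ext; rw [simpleRefl_apply_val]; simp only [Fin.val_castSucc]; split_ifs <;> omega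
          have e4 : simpleRefl j i.succ = j.succ := by rw [← e0, simpleRefl_castSucc]
          rw [e1, e2, e3, e4, e1, simpleRefl_castSucc]
          rw [e0] at hdj
          exact ⟨hdj.trans hdi, hdj⟩
        · have e0 : i.castSucc = j.succ := by ext; simp [h]
          have e1 : simpleRefl i j.castSucc = j.castSucc := by
            ext; rw [simpleRefl_apply_val]; simp only [Fin.val_castSucc]; split_ifs <;> omega
          have e2 : simpleRefl i j.succ = i.succ := by rw [← e0, simpleRefl_castSucc]
          have e3 : simpleRefl j i.succ = i.succ := by
            ext; rw [simpleRefl_apply_val]; simp only [Fin.val_succ]; split_ifs <;> omega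
          have e4 : simpleRefl j i.castSucc = j.castSucc := by rw [e0, simpleRefl_succ]
          rw [e1, e2, e3, e4, e1, simpleRefl_succ]
          rw [e0] at hdi ⊢
          exact ⟨hdi.trans hdj, hdj⟩
      have hc1 := inversionCount_mul_of_gt _ _ key.1
      have hc2 := inversionCount_mul_of_gt _ _ key.2
      obtain ⟨z, hz, hzl⟩ := exists_word (x * simpleRefl i * simpleRefl j * simpleRefl i)
      have hz' : wordProd z = x * simpleRefl j * simpleRefl i * simpleRefl j := by
        rw [hz, mul_assoc, mul_assoc, ← mul_assoc (simpleRefl i), simpleRefl_braid hadj]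
        simp only [mul_assoc]
      have hzi : wordProd (z ++ [i] ++ [j]) = wordProd v' := by
        rw [wordProd_concat, wordProd_concat, hz, mul_assoc _ (simpleRefl i) (simpleRefl i),
          simpleRefl_mul_self, mul_one, mul_assoc _ (simpleRefl j), simpleRefl_mul_self, mul_one,
          hxi]
      have hzj : wordProd (z ++ [j] ++ [i]) = wordProd w' := by
        rw [wordProd_concat, wordProd_concat, hz', mul_assoc _ (simpleRefl j) (simpleRefl j),
          simpleRefl_mul_self, mul_one, mul_assoc _ (simpleRefl i), simpleRefl_mul_self, mul_one,
          hxj]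
      have s1 := lift i (ih (m - 1) (by omega) v' (z ++ [i] ++ [j]) hzi.symm (by omega)
        (by simp; omega) (by rw [hzi, ← hxi]; omega))
      have s2 := lift j (ih (m - 1) (by omega) (z ++ [j] ++ [i]) w' hzj (by simp; omega)
        (by omega) (by rw [← hxj]; omega))
      refine s1.trans (Relation.ReflTransGen.head ?_ s2)
      simpa using WordMove.braid z [] i j hadj

/-! ### Oriented paths in string diagrams -/

/-- One step of a path in a string diagram: it comes into the row `row` on the string `src` and
leaves this row on the string `dst`. -/
structure Step (σ : Type) where
  row : ℕ
  src : σ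
  dst : σ

/-- An oriented string diagram with strings numbered by `σ`. The crossing in the row `r < depth`
lies between the levels `r` and `r + 1`; `left r` and `right r` are the strings which enter it from
the upper left and the upper right, and `up u` says that the string `u` is oriented upward. -/
structure OrientedDiagram (σ : Type) where
  left : ℕ → σ
  right : ℕ → σ
  depth : ℕ
  up : σ → Bool

/-- The contribution of a step to the exponent of the crossing of its row. -/
def Step.sign {σ : Type} [LinearOrder σ] (s : Step σ) : ℤ :=
  if s.src < s.dst then -1 else if s.dst < s.src then 1 else 0

/-- The exponent of the crossing `r` in the vector of the list of steps `p`. -/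
def exponentAt {σ : Type} [LinearOrder σ] (p : List (Step σ)) (r : ℕ) : ℤ :=
  (p.map fun s => if s.row = r then s.sign else 0).sum

namespace OrientedDiagram

variable {σ : Type} (D : OrientedDiagram σ)

/-- The string `u` passes through the crossing `r`. -/
def Meets (r : ℕ) (u : σ) : Prop := u = D.left r ∨ u = D.right r

/-- The level from which a step comes into its row. -/
def entry (s : Step σ) : ℕ := if D.up s.src then s.row + 1 else s.row

/-- The level on which a step leaves its row. -/
def exit (s : Step σ) : ℕ := if D.up s.dst then s.row else s.row + 1

/-- A step goes straight along a string through a crossing of two strings of the same orientation,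
upward to the left or downward to the left. -/
def IsForbidden (s : Step σ) : Prop :=
  s.dst = s.src ∧
    ((s.src = D.left s.row ∧ D.up s.src ∧ D.up (D.right s.row)) ∨
      (s.src = D.right s.row ∧ ¬ D.up s.src ∧ ¬ D.up (D.left s.row)))

/-- The steps that a rigorous path may contain. -/
def IsAllowed (s : Step σ) : Prop :=
  s.row < D.depth ∧ (s.dst = s.src ∨ (D.Meets s.row s.src ∧ D.Meets s.row s.dst)) ∧
    ¬ D.IsForbidden s

/-- `D.IsPath x y p`: the list `p` of allowed steps leads from `x` to `y`, where `(u, m)` is the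
point on the string `u` on level `m`. -/
def IsPath : σ × ℕ → σ × ℕ → List (Step σ) → Prop
  | x, y, [] => x = y
  | x, y, s :: p => x = (s.src, D.entry s) ∧ D.IsAllowed s ∧ IsPath (s.dst, D.exit s) y p

/-- Two steps do not pass through the same crossing. -/
def Apart (s s' : Step σ) : Prop :=
  D.Meets s.row s.src → D.Meets s'.row s'.src → s.row ≠ s'.row

theorem Apart.symm {D : OrientedDiagram σ} {s s' : Step σ} (h : D.Apart s s') : D.Apart s' s :=
  fun h1 h2 h3 => h h2 h1 h3.symm

/-- A list of steps that visits no crossing twice. -/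
def IsSimple (p : List (Step σ)) : Prop := p.Pairwise D.Apart

variable {D}

theorem IsSimple.perm {p q : List (Step σ)} (h : D.IsSimple p) (hpq : p.Perm q) : D.IsSimple q :=
  List.Pairwise.perm h hpq fun h => h.symm

theorem IsPath.isAllowed {x y : σ × ℕ} {p : List (Step σ)} (h : D.IsPath x y p) :
    ∀ s ∈ p, D.IsAllowed s := by
  induction p generalizing x with
  | nil => simp
  | cons s p ih =>
    intro t ht
    rcases List.mem_cons.1 ht with rfl | ht
    · exact h.2.1
    · exact ih h.2.2 t ht

theorem IsPath.append {x y z : σ × ℕ} {p q : List (Step σ)} (hp : D.IsPath x y p)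
    (hq : D.IsPath y z q) : D.IsPath x z (p ++ q) := by
  induction p generalizing x with
  | nil => cases hp; exact hq
  | cons s p ih => exact ⟨hp.1, hp.2.1, ih hp.2.2⟩

theorem IsAllowed.dst_eq {s : Step σ} (h : D.IsAllowed s) (hm : ¬ D.Meets s.row s.src) :
    s.dst = s.src := by
  rcases h.2.1 with h | h
  · exact h
  · exact absurd h.1 hm

end OrientedDiagram

theorem exponentAt_append {σ : Type} [LinearOrder σ] (p q : List (Step σ)) (r : ℕ) :
    exponentAt (p ++ q) r = exponentAt p r + exponentAt q r := by
  simp [exponentAt]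

theorem exponentAt_perm {σ : Type} [LinearOrder σ] {p q : List (Step σ)} (h : p.Perm q) (r : ℕ) :
    exponentAt p r = exponentAt q r :=
  (h.map _).sum_eq

theorem exponentAt_cons {σ : Type} [LinearOrder σ] (s : Step σ) (p : List (Step σ)) (r : ℕ) :
    exponentAt (s :: p) r = (if s.row = r then s.sign else 0) + exponentAt p r := by
  simp [exponentAt]

theorem exponentAt_eq_zero {σ : Type} [LinearOrder σ] {p : List (Step σ)} {r : ℕ}
    (h : ∀ s ∈ p, s.row = r → s.sign = 0) : exponentAt p r = 0 := by
  unfold exponentAt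
  apply List.sum_eq_zero
  intro x hx
  obtain ⟨s, hs, rfl⟩ := List.mem_map.1 hx
  split_ifs with hr
  · exact h s hs hr
  · rfl

theorem Step.sign_of_eq {σ : Type} [LinearOrder σ] {s : Step σ} (h : s.dst = s.src) :
    s.sign = 0 := by
  simp [Step.sign, h]

/-- A simple path passes a crossing at most once: a sum over its steps to which only steps through
the crossing of the step `s` contribute has only one term. -/
theorem OrientedDiagram.IsSimple.sum_eq {σ : Type} {D : OrientedDiagram σ} {p : List (Step σ)}
    (hp : ∀ s ∈ p, D.IsAllowed s) (hs : D.IsSimple p) {s : Step σ} (h : s ∈ p)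
    (hm : D.Meets s.row s.src) (f : Step σ → ℤ)
    (hf : ∀ t ∈ p, (t.row = s.row → ¬ D.Meets t.row t.src ∧ t.dst = t.src) → f t = 0) :
    (p.map f).sum = f s := by
  obtain ⟨l₁, l₂, rfl⟩ := List.append_of_mem h
  have hz : ∀ t ∈ l₁ ++ l₂, f t = 0 := by
    intro t ht
    have ha : D.Apart s t := by
      have h1 := List.pairwise_append.1 hs
      rcases List.mem_append.1 ht with h2 | h2
      · exact (h1.2.2 t h2 s (by simp)).symm
      · exact (List.pairwise_cons.1 h1.2.1).1 t h2
    have ht' : t ∈ l₁ ++ s :: l₂ := by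
      rcases List.mem_append.1 ht with h2 | h2 <;> simp [h2]
    refine hf t ht' fun hr => ?_
    have hmt : ¬ D.Meets t.row t.src := fun hmt => ha hm hmt hr.symm
    exact ⟨hmt, (hp t ht').dst_eq hmt⟩
  have e : (l₁ ++ s :: l₂).Perm (s :: (l₁ ++ l₂)) := List.perm_middle
  rw [(e.map f).sum_eq, List.map_cons, List.sum_cons, List.sum_eq_zero, add_zero]
  intro x hx
  obtain ⟨t, ht, rfl⟩ := List.mem_map.1 hx
  exact hz t ht

theorem exponentAt_eq_sign {σ : Type} [LinearOrder σ] {D : OrientedDiagram σ} {p : List (Step σ)}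
    (hp : ∀ s ∈ p, D.IsAllowed s) (hs : D.IsSimple p) {s : Step σ} (h : s ∈ p)
    (hm : D.Meets s.row s.src) : exponentAt p s.row = s.sign := by
  unfold exponentAt
  rw [hs.sum_eq hp h hm, if_pos rfl]
  intro t _ h
  by_cases hr : t.row = s.row
  · rw [if_pos hr, Step.sign_of_eq (h hr).2]
  · rw [if_neg hr]

/-! ### The exponent vectors as functions on the natural numbers -/

/-- The string diagram of a word, with the strings up to `k.castSucc` oriented upward. -/
def diagram {n : ℕ} (w : List (Fin n)) (k : Fin n) : OrientedDiagram (Fin (n + 1)) where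
  left r := if h : r < w.length then leftString w ⟨r, h⟩ else 0
  right r := if h : r < w.length then rightString w ⟨r, h⟩ else 0
  depth := w.length
  up u := decide (IsUp k u)

/-- The exponent vectors of the string inequalities, extended by zero. -/
def pathVectors {n : ℕ} (w : List (Fin n)) : Set (ℕ → ℤ) :=
  {M | ∃ (k : Fin n) (p : List (Step (Fin (n + 1)))),
    (diagram w k).IsPath (k.castSucc, w.length) (k.succ, w.length) p ∧
      (diagram w k).IsSimple p ∧ M = exponentAt p}

/-- Extension by zero of an exponent vector. -/
def extendZero {N : ℕ} (M : Fin N → ℤ) : ℕ → ℤ := fun r => if h : r < N then M ⟨r, h⟩ else 0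

theorem extendZero_val {N : ℕ} (M : Fin N → ℤ) (r : Fin N) : extendZero M r = M r := by
  simp [extendZero]

theorem extendZero_restrict {N : ℕ} {M : ℕ → ℤ} (h : ∀ r, N ≤ r → M r = 0) :
    extendZero (fun r : Fin N => M r) = M := by
  funext r
  unfold extendZero
  split_ifs with hr
  · rfl
  · exact (h r (by omega)).symm

theorem extendZero_injective {N : ℕ} : Function.Injective (extendZero (N := N)) := by
  intro M M' h
  funext r
  rw [← extendZero_val M, ← extendZero_val M', h]

/-- A path step of the diagram of a word as a step with a natural number as row. -/
def PathStep.toStep {n N : ℕ} (s : PathStep n N) : Step (Fin (n + 1)) :=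
  ⟨s.row, s.inStr, s.outStr⟩

section Bridge

variable {n : ℕ} {w : List (Fin n)} {k : Fin n}

theorem meets_toStep {r : Fin w.length} {u : Fin (n + 1)} :
    (diagram w k).Meets r u ↔ Meets w r u := by
  simp [OrientedDiagram.Meets, Meets, diagram]

theorem entry_toStep (s : PathStep n w.length) : (diagram w k).entry s.toStep = s.entry k := by
  simp [OrientedDiagram.entry, PathStep.entry, diagram, PathStep.toStep]

theorem exit_toStep (s : PathStep n w.length) : (diagram w k).exit s.toStep = s.exit k := by
  simp [OrientedDiagram.exit, PathStep.exit, diagram, PathStep.toStep]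

theorem isAllowed_toStep {s : PathStep n w.length} :
    (diagram w k).IsAllowed s.toStep ↔ s.IsValid w ∧ ¬ s.IsBad w k := by
  have h1 : (diagram w k).IsForbidden s.toStep ↔ s.IsBad w k := by
    simp [OrientedDiagram.IsForbidden, PathStep.IsBad, diagram, PathStep.toStep]
  have h2 : s.toStep.row < (diagram w k).depth := s.row.2
  have h3 : ∀ u, (diagram w k).Meets s.toStep.row u ↔ Meets w s.row u := fun u => meets_toStep
  unfold OrientedDiagram.IsAllowed PathStep.IsValid
  rw [h1, h3, h3]
  exact ⟨fun h => h.2, fun h => ⟨h2, h⟩⟩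

theorem isPath_toStep {s : PathStep n w.length} {p : List (PathStep n w.length)}
    {y : Fin (n + 1) × ℕ} :
    (diagram w k).IsPath (s.inStr, s.entry k) y ((s :: p).map PathStep.toStep) ↔
      (∀ t ∈ s :: p, t.IsValid w ∧ ¬ t.IsBad w k) ∧
        (s :: p).IsChain (fun t t' => t.outStr = t'.inStr ∧ t.exit k = t'.entry k) ∧
        ∃ t ∈ (s :: p).getLast?, (t.outStr, t.exit k) = y := by
  induction p generalizing s with
  | nil =>
    simp only [List.map_cons, List.map_nil, OrientedDiagram.IsPath, entry_toStep, exit_toStep,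
      isAllowed_toStep, List.mem_singleton, forall_eq, List.isChain_singleton, true_and,
      List.getLast?_singleton, Option.mem_def, Option.some.injEq, exists_eq_left']
    exact ⟨fun h => h.2, fun h => ⟨rfl, h⟩⟩
  | cons t p ih =>
    have ih' := ih (s := t)
    rw [List.map_cons, OrientedDiagram.IsPath, entry_toStep, exit_toStep, isAllowed_toStep,
      List.isChain_cons_cons, List.forall_mem_cons, List.getLast?_cons_cons]
    constructor
    · rintro ⟨-, h1, h2⟩
      have h3 : ((s.toStep).dst, s.exit k) = (t.inStr, t.entry k) := by
        rw [← entry_toStep (w := w)]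
        exact h2.1
      rw [h3] at h2
      obtain ⟨a, b, c⟩ := ih'.1 h2
      exact ⟨⟨h1, a⟩, ⟨Prod.ext_iff.1 h3, b⟩, c⟩
    · rintro ⟨⟨h1, a⟩, ⟨h3, b⟩, c⟩
      refine ⟨rfl, h1, ?_⟩
      have h4 : ((s.toStep).dst, s.exit k) = (t.inStr, t.entry k) := Prod.ext h3.1 h3.2
      rw [h4]
      exact ih'.2 ⟨a, b, c⟩

theorem isRigorousPath_iff {p : List (PathStep n w.length)} :
    IsRigorousPath w k p ↔
      (diagram w k).IsPath (k.castSucc, w.length) (k.succ, w.length) (p.map PathStep.toStep) ∧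
        (diagram w k).IsSimple (p.map PathStep.toStep) := by
  have hsimple : (diagram w k).IsSimple (p.map PathStep.toStep) ↔
      p.Pairwise fun s s' =>
        Meets w s.row s.inStr → Meets w s'.row s'.inStr → s.row ≠ s'.row := by
    unfold OrientedDiagram.IsSimple
    rw [List.pairwise_map]
    refine List.Pairwise.iff fun s s' => ?_
    have e : ∀ t : PathStep n w.length,
        (diagram w k).Meets t.toStep.row t.toStep.src ↔ Meets w t.row t.inStr :=
      fun t => meets_toStep
    unfold OrientedDiagram.Apart
    rw [e, e]
    simp [PathStep.toStep, Fin.ext_iff]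
  rw [hsimple]
  rcases p with _ | ⟨s, p⟩
  · constructor
    · intro h
      obtain ⟨s, hs, -⟩ := h.start
      simp at hs
    · rintro ⟨h, -⟩
      have := congrArg Prod.fst h
      exact absurd this Fin.castSucc_lt_succ.ne
  · constructor
    · rintro ⟨h1, ⟨t, ht, h2⟩, h3, h4, h5, h6⟩
      refine ⟨?_, h5⟩
      obtain rfl : s = t := by simpa using ht
      have e : (k.castSucc, w.length) = (s.inStr, s.entry k) := Prod.ext h2.1.symm h2.2.symm
      rw [e]
      refine isPath_toStep.2 ⟨fun t ht => ⟨h1 t ht, h6 t ht⟩, h4, ?_⟩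
      obtain ⟨t, ht, h7⟩ := h3
      exact ⟨t, ht, Prod.ext h7.1 h7.2⟩
    · rintro ⟨h, h5⟩
      have h1 : (k.castSucc, w.length) = (s.inStr, s.entry k) := by
        rw [← entry_toStep (w := w)]
        exact h.1
      rw [h1] at h
      obtain ⟨a, b, t, ht, c⟩ := isPath_toStep.1 h
      exact ⟨fun s hs => (a s hs).1, ⟨s, by simp, (Prod.ext_iff.1 h1).imp Eq.symm Eq.symm⟩,
        ⟨t, ht, Prod.ext_iff.1 c⟩, b, h5, fun s hs => (a s hs).2⟩

theorem pathExponent_eq {p : List (PathStep n w.length)} (h : IsRigorousPath w k p)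
    (r : Fin w.length) : pathExponent p r = exponentAt (p.map PathStep.toStep) r := by
  obtain ⟨h1, h2⟩ := isRigorousPath_iff.1 h
  have key : ∀ s ∈ p, s.row = r → s.inStr ≠ s.outStr →
      exponentAt (p.map PathStep.toStep) r = s.toStep.sign := by
    rintro s hs rfl hne
    refine exponentAt_eq_sign h1.isAllowed h2 (List.mem_map_of_mem hs) ?_
    refine meets_toStep.2 ?_
    rcases h.valid s hs with h3 | h3
    · exact absurd h3.symm hne
    · exact h3.1
  unfold pathExponent
  split_ifs with h3 h4
  · obtain ⟨s, hs, hr, hlt⟩ := h3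
    rw [key s hs hr hlt.ne]
    simp [Step.sign, PathStep.toStep, hlt]
  · obtain ⟨s, hs, hr, hlt⟩ := h4
    rw [key s hs hr hlt.ne']
    simp [Step.sign, PathStep.toStep, hlt, hlt.not_gt]
  · symm
    apply exponentAt_eq_zero
    intro t ht hr
    obtain ⟨s, hs, rfl⟩ := List.mem_map.1 ht
    have hr' : s.row = r := Fin.ext hr
    apply Step.sign_of_eq
    refine le_antisymm (not_lt.1 fun hlt => ?_) (not_lt.1 fun hlt => ?_)
    · exact h3 ⟨s, hs, hr', hlt⟩
    · exact h4 ⟨s, hs, hr', hlt⟩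

theorem pathVectors_eq_zero {M : ℕ → ℤ} (hM : M ∈ pathVectors w) {r : ℕ} (hr : w.length ≤ r) :
    M r = 0 := by
  obtain ⟨k, p, hp, -, rfl⟩ := hM
  apply exponentAt_eq_zero
  intro s hs h
  have := (hp.isAllowed s hs).1
  change s.row < w.length at this
  omega

theorem extendZero_mem_pathVectors {M : Fin w.length → ℤ} :
    extendZero M ∈ pathVectors w ↔ M ∈ stringExponents w := by
  constructor
  · rintro ⟨k, p, hp, hs, hM⟩
    have : ∃ q : List (PathStep n w.length), q.map PathStep.toStep = p := by
      have h := hp.isAllowed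
      clear hp hs hM
      induction p with
      | nil => exact ⟨[], rfl⟩
      | cons s p ih =>
        obtain ⟨q, hq⟩ := ih fun t ht => h t (List.mem_cons_of_mem _ ht)
        exact ⟨⟨⟨s.row, (h s (by simp)).1⟩, s.src, s.dst⟩ :: q, by rw [List.map_cons, hq]; rfl⟩
    obtain ⟨q, rfl⟩ := this
    have hq := isRigorousPath_iff.2 ⟨hp, hs⟩
    refine ⟨k, q, hq, ?_⟩
    funext r
    rw [pathExponent_eq hq, ← hM, extendZero_val]
  · rintro ⟨k, p, hp, rfl⟩
    obtain ⟨h1, h2⟩ := isRigorousPath_iff.1 hp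
    refine ⟨k, _, h1, h2, ?_⟩
    funext r
    unfold extendZero
    split_ifs with hr
    · exact pathExponent_eq hp ⟨r, hr⟩
    · symm
      apply exponentAt_eq_zero
      intro s hs h
      have := (h1.isAllowed s hs).1
      change s.row < w.length at this
      omega

end Bridge

/-! ### Flux and planarity -/

namespace OrientedDiagram

variable {σ : Type} [LinearOrder σ] (D : OrientedDiagram σ)

/-- The contribution of a step to the flux from below to level `m` on the string `u`. -/
def belowTerm (m : ℕ) (u : σ) (s : Step σ) : ℤ :=
  (if s.row + 1 = m ∧ s.src = u ∧ D.up u = true then 1 else 0) -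
    (if s.row + 1 = m ∧ s.dst = u ∧ D.up u = false then 1 else 0)

/-- The contribution of a step to the flux from the row `m` to level `m` on the string `u`. -/
def aboveTerm (m : ℕ) (u : σ) (s : Step σ) : ℤ :=
  (if s.row = m ∧ s.dst = u ∧ D.up u = true then 1 else 0) -
    (if s.row = m ∧ s.src = u ∧ D.up u = false then 1 else 0)

/-- The number of times that a path crosses level `m` on the string `u`, counted with sign `1` if
it runs upward and `-1` if it runs downward; the steps of the row above level `m` are counted. -/
def flux (p : List (Step σ)) (m : ℕ) (u : σ) : ℤ := (p.map (D.belowTerm m u)).sum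

/-- The flux through level `m`, computed from the steps of the row below level `m`. -/
def fluxAbove (p : List (Step σ)) (m : ℕ) (u : σ) : ℤ := (p.map (D.aboveTerm m u)).sum

variable {D}

theorem flux_zero (p : List (Step σ)) (u : σ) : D.flux p 0 u = 0 := by
  unfold flux
  apply List.sum_eq_zero
  intro x hx
  obtain ⟨s, -, rfl⟩ := List.mem_map.1 hx
  simp [belowTerm]

theorem IsPath.fluxAbove_eq {x y : σ × ℕ} {p : List (Step σ)} (h : D.IsPath x y p) (m : ℕ)
    (u : σ) : D.fluxAbove p m u =
      D.flux p m u + (if y = (u, m) then 1 else 0) - (if x = (u, m) then 1 else 0) := by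
  induction p generalizing x with
  | nil => cases h; simp [fluxAbove, flux]
  | cons s p ih =>
    have h1 := ih h.2.2
    have h2 : D.aboveTerm m u s = D.belowTerm m u s +
        (if (s.dst, D.exit s) = (u, m) then 1 else 0) - (if x = (u, m) then 1 else 0) := by
      rw [h.1]
      simp only [aboveTerm, belowTerm, exit, entry, Prod.mk.injEq]
      by_cases e1 : s.src = u <;> by_cases e2 : s.dst = u <;> cases e3 : D.up u <;>
        simp [e1, e2, e3]
    simp only [fluxAbove, flux, List.map_cons, List.sum_cons] at h1 ⊢
    rw [h1, h2]
    ring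

/-- Kirchhoff's law: the flux along a string changes at a crossing by the exponent there. -/
theorem flux_succ_eq {p : List (Step σ)} (h : ∀ s ∈ p, D.IsAllowed s) {r : ℕ}
    (hr : D.left r < D.right r) (u : σ) : D.flux p (r + 1) u = D.fluxAbove p r u -
      exponentAt p r * ((if u = D.left r then 1 else 0) - (if u = D.right r then 1 else 0)) := by
  induction p with
  | nil => simp [flux, fluxAbove, exponentAt]
  | cons s p ih =>
    have h1 := ih fun t ht => h t (List.mem_cons_of_mem _ ht)
    have h2 : D.belowTerm (r + 1) u s = D.aboveTerm r u s - (if s.row = r then s.sign else 0) *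
        ((if u = D.left r then 1 else 0) - (if u = D.right r then 1 else 0)) := by
      by_cases hrow : s.row = r
      · have h3 := (h s (by simp)).2.1
        simp only [aboveTerm, belowTerm, hrow, true_and, if_true]
        rcases h3 with h3 | ⟨h3, h4⟩
        · rw [Step.sign_of_eq h3, h3]
          cases D.up u <;> by_cases e : s.src = u <;> simp [e]
        · rw [hrow] at h3 h4
          have hne := hr.ne
          unfold Step.sign
          rcases h3 with h3 | h3 <;> rcases h4 with h4 | h4 <;> rw [h3, h4] <;>
            simp only [hr, hr.not_gt, lt_self_iff_false, if_true, if_false] <;>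
            cases D.up u <;> by_cases e1 : u = D.left r <;> by_cases e2 : u = D.right r <;>
            simp_all [eq_comm]
      · simp [aboveTerm, belowTerm, hrow]
    simp only [fluxAbove, flux, List.map_cons, List.sum_cons, exponentAt_cons] at h1 ⊢
    rw [h1, h2]
    ring

theorem flux_sub_eq {x y : σ × ℕ} {p : List (Step σ)} (hp : D.IsPath x y p)
    (hx : x.2 = D.depth) (hy : y.2 = D.depth) {r : ℕ} (hrd : r < D.depth)
    (hr : D.left r < D.right r) (u : σ) : D.flux p (r + 1) u = D.flux p r u -
      exponentAt p r * ((if u = D.left r then 1 else 0) - (if u = D.right r then 1 else 0)) := by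
  rw [flux_succ_eq hp.isAllowed hr, hp.fluxAbove_eq, if_neg, if_neg]
  · ring
  · intro h
    rw [h] at hx
    simp at hx
    omega
  · intro h
    rw [h] at hy
    simp at hy
    omega

theorem flux_depth {x y : σ × ℕ} {p : List (Step σ)} (hp : D.IsPath x y p) (u : σ) :
    D.flux p D.depth u =
      (if x = (u, D.depth) then 1 else 0) - (if y = (u, D.depth) then 1 else 0) := by
  have h1 := hp.fluxAbove_eq D.depth u
  have h2 : D.fluxAbove p D.depth u = 0 := by
    unfold fluxAbove
    apply List.sum_eq_zero
    intro x hx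
    obtain ⟨s, hs, rfl⟩ := List.mem_map.1 hx
    have := (hp.isAllowed s hs).1
    simp [aboveTerm, this.ne]
  rw [h2] at h1
  linarith

theorem belowTerm_nonneg {m : ℕ} {u : σ} (hu : D.up u = true) (s : Step σ) :
    0 ≤ D.belowTerm m u s := by
  simp only [belowTerm, hu]
  split_ifs <;> simp_all

theorem belowTerm_nonpos {m : ℕ} {u : σ} (hu : D.up u = false) (s : Step σ) :
    D.belowTerm m u s ≤ 0 := by
  simp only [belowTerm, hu]
  split_ifs <;> simp_all

theorem aboveTerm_nonneg {m : ℕ} {u : σ} (hu : D.up u = true) (s : Step σ) :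
    0 ≤ D.aboveTerm m u s := by
  simp only [aboveTerm, hu]
  split_ifs <;> simp_all

theorem aboveTerm_nonpos {m : ℕ} {u : σ} (hu : D.up u = false) (s : Step σ) :
    D.aboveTerm m u s ≤ 0 := by
  simp only [aboveTerm, hu]
  split_ifs <;> simp_all

theorem flux_nonneg (p : List (Step σ)) (m : ℕ) {u : σ} (hu : D.up u = true) :
    0 ≤ D.flux p m u := by
  apply List.sum_nonneg
  intro x hx
  obtain ⟨s, -, rfl⟩ := List.mem_map.1 hx
  exact belowTerm_nonneg hu s

theorem flux_nonpos (p : List (Step σ)) (m : ℕ) {u : σ} (hu : D.up u = false) :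
    D.flux p m u ≤ 0 := by
  rw [← neg_nonneg]
  unfold flux
  rw [List.sum_neg]
  apply List.sum_nonneg
  intro x hx
  simp only [List.map_map, List.mem_map, Function.comp] at hx
  obtain ⟨s, -, rfl⟩ := hx
  exact neg_nonneg.2 (belowTerm_nonpos hu s)

variable (D) in
/-- `P m u` is the position of the string `u` on level `m`. -/
structure IsPosition (P : ℕ → σ → ℕ) : Prop where
  injective : ∀ m, Function.Injective (P m)
  right_eq : ∀ r < D.depth, P r (D.right r) = P r (D.left r) + 1
  succ_left : ∀ r < D.depth, P (r + 1) (D.left r) = P r (D.right r)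
  succ_right : ∀ r < D.depth, P (r + 1) (D.right r) = P r (D.left r)
  succ_other : ∀ r < D.depth, ∀ u, ¬ D.Meets r u → P (r + 1) u = P r u

/-- `D.Crosses p u m`: the path `p` passes through the point on the string `u` on level `m`. -/
def Crosses (D : OrientedDiagram σ) (p : List (Step σ)) (u : σ) (m : ℕ) : Prop :=
  ∃ s ∈ p, (s.src = u ∧ D.entry s = m) ∨ (s.dst = u ∧ D.exit s = m)

theorem Crosses.flux_ne_zero {x y : σ × ℕ} {p : List (Step σ)} (hp : D.IsPath x y p)
    (hx : x.2 = D.depth) (hy : y.2 = D.depth) {u : σ} {m : ℕ}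
    (h : D.Crosses p u m) : D.flux p m u ≠ 0 := by
  have hfl : ∀ s ∈ p, s.row = m → D.fluxAbove p m u = D.flux p m u := by
    rintro s hs rfl
    have hm := (hp.isAllowed s hs).1
    rw [hp.fluxAbove_eq, if_neg, if_neg, add_zero, sub_zero]
    · rintro rfl; exact hm.ne hx
    · rintro rfl; exact hm.ne hy
  have pos : ∀ (f : Step σ → ℤ), (∀ s ∈ p, 0 ≤ f s) → (∃ s ∈ p, f s ≠ 0) →
      (p.map f).sum ≠ 0 := by
    rintro f h0 ⟨s, hs, h1⟩ h2
    have h3 : f s ≤ (p.map f).sum := List.single_le_sum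
      (fun a ha => by obtain ⟨t, ht, rfl⟩ := List.mem_map.1 ha; exact h0 t ht) _
      (List.mem_map_of_mem hs)
    have := h0 s hs
    omega
  have neg : ∀ (f : Step σ → ℤ), (∀ s ∈ p, f s ≤ 0) → (∃ s ∈ p, f s ≠ 0) →
      (p.map f).sum ≠ 0 := by
    rintro f h0 ⟨s, hs, h1⟩ h2
    refine pos (fun s => - f s) (fun s hs => by have := h0 s hs; omega)
      ⟨s, hs, by omega⟩ ?_
    have : p.map (fun s => - f s) = (p.map f).map (fun x => -x) := by simp
    rw [this, ← List.sum_neg, h2, neg_zero]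
  obtain ⟨s, hs, ⟨rfl, h1⟩ | ⟨rfl, h1⟩⟩ := h
  · cases hu : D.up s.src
    · rw [entry, hu] at h1
      rw [← hfl s hs h1]
      refine neg _ (fun t _ => aboveTerm_nonpos hu t) ⟨s, hs, ?_⟩
      simp [aboveTerm, hu, ← h1]
    · refine pos _ (fun t _ => belowTerm_nonneg hu t) ⟨s, hs, ?_⟩
      rw [entry, hu] at h1
      simp [belowTerm, hu, ← h1]
  · cases hu : D.up s.dst
    · refine neg _ (fun t _ => belowTerm_nonpos hu t) ⟨s, hs, ?_⟩
      rw [exit, hu] at h1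
      simp [belowTerm, hu, ← h1]
    · rw [exit, hu] at h1
      rw [← hfl s hs h1]
      refine pos _ (fun t _ => aboveTerm_nonneg hu t) ⟨s, hs, ?_⟩
      simp [aboveTerm, hu, ← h1]

section Planarity

variable [Fintype σ] {P : ℕ → σ → ℕ}

variable (D P) in
/-- The flux through level `m` to the left of the position `q`: the winding number of the closed-up
path around the face to the left of the position `q`. -/
def height (p : List (Step σ)) (m q : ℕ) : ℤ := ∑ u : σ, if P m u < q then D.flux p m u else 0

theorem height_succ (hP : D.IsPosition P) (p : List (Step σ)) (m : ℕ) (v : σ) :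
    D.height P p m (P m v + 1) = D.height P p m (P m v) + D.flux p m v := by
  have : ∀ u : σ, (if P m u < P m v + 1 then D.flux p m u else 0) =
      (if P m u < P m v then D.flux p m u else 0) + if u = v then D.flux p m u else 0 := by
    intro u
    by_cases h : u = v
    · simp [h]
    · have : P m u ≠ P m v := fun e => h (hP.injective m e)
      rcases lt_or_gt_of_ne this with h1 | h1
      · simp [h, h1, h1.trans (Nat.lt_succ_self _)]
      · simp [h, h1.not_gt, Nat.not_lt.2 (Nat.succ_le_of_lt h1)]
  unfold height
  rw [Finset.sum_congr rfl fun u _ => this u, Finset.sum_add_distrib]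
  simp

theorem height_level (hP : D.IsPosition P) (hD : ∀ r < D.depth, D.left r < D.right r)
    {x y : σ × ℕ} {p : List (Step σ)} (hp : D.IsPath x y p)
    (hx : x.2 = D.depth) (hy : y.2 = D.depth) {r : ℕ} (hr : r < D.depth) {q : ℕ}
    (hq : q ≠ P r (D.left r) + 1) : D.height P p (r + 1) q = D.height P p r q := by
  have h1 := hP.right_eq r hr
  have h2 := hP.succ_left r hr
  have h3 := hP.succ_right r hr
  have hpos : ∀ u, P (r + 1) u < q ↔ P r u < q := by
    intro u
    by_cases hu : D.Meets r u
    · rcases hu with rfl | rfl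
      · rw [h2]; omega
      · rw [h3]; omega
    · rw [hP.succ_other r hr u hu]
  unfold height
  have : ∀ u, (if P (r + 1) u < q then D.flux p (r + 1) u else 0) =
      (if P r u < q then D.flux p r u else 0) -
        ((if u = D.left r then (if P r u < q then exponentAt p r else 0) else 0) -
        (if u = D.right r then (if P r u < q then exponentAt p r else 0) else 0)) := by
    intro u
    simp only [hpos u]
    rw [flux_sub_eq hp hx hy hr (hD r hr)]
    split_ifs <;> simp
  rw [Finset.sum_congr rfl fun u _ => this u, Finset.sum_sub_distrib, Finset.sum_sub_distrib,
    Finset.sum_ite_eq' Finset.univ, Finset.sum_ite_eq' Finset.univ]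
  have h4 : P r (D.left r) < q ↔ P r (D.right r) < q := by omega
  simp [h4]

variable (D P) in
/-- The winding number around the face to the left of the path at the point `x`. -/
def leftFace (p : List (Step σ)) (x : σ × ℕ) : ℤ :=
  D.height P p x.2 (if D.up x.1 then P x.2 x.1 else P x.2 x.1 + 1)

/-- A step of a simple path does not change the face to the left of the path. -/
theorem leftFace_step (hP : D.IsPosition P) (hD : ∀ r < D.depth, D.left r < D.right r)
    {x y : σ × ℕ} {p : List (Step σ)} (hp : D.IsPath x y p) (hs : D.IsSimple p)
    (hx : x.2 = D.depth) (hy : y.2 = D.depth) {s : Step σ} (h : s ∈ p) :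
    D.leftFace P p (s.dst, D.exit s) = D.leftFace P p (s.src, D.entry s) := by
  have hal := hp.isAllowed s h
  have hr := hal.1
  have h1 := hP.right_eq _ hr
  have h2 := hP.succ_left _ hr
  have h3 := hP.succ_right _ hr
  have hlev : ∀ q, q ≠ P s.row (D.left s.row) + 1 →
      D.height P p (s.row + 1) q = D.height P p s.row q :=
    fun q hq => height_level hP hD hp hx hy hr hq
  have hne := (hD _ hr).ne
  by_cases hm : D.Meets s.row s.src
  · -- `s` is the only step of the simple path at this crossing, so it alone determines the fluxes
    -- along the two crossing strings just below (`hb`) and just above (`ha`) the crossing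
    have hm' : D.Meets s.row s.dst := by
      rcases hal.2.1 with h4 | h4
      · rwa [h4]
      · exact h4.2
    have hb : ∀ u, D.Meets s.row u → D.flux p (s.row + 1) u = D.belowTerm (s.row + 1) u s := by
      intro u hu
      refine hs.sum_eq hp.isAllowed h hm _ ?_
      intro t _ ht
      by_cases hrow : t.row = s.row
      · obtain ⟨h5, h6⟩ := ht hrow
        have : t.src ≠ u := by
          rintro rfl
          rw [hrow] at h5
          exact h5 hu
        simp [belowTerm, h6, this]
      · simp [belowTerm, hrow]
    have ha : ∀ u, D.Meets s.row u → D.flux p s.row u = D.aboveTerm s.row u s := by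
      intro u hu
      have e := hp.fluxAbove_eq s.row u
      rw [if_neg, if_neg, add_zero, sub_zero] at e
      · rw [← e]
        refine hs.sum_eq hp.isAllowed h hm _ ?_
        intro t _ ht
        by_cases hrow : t.row = s.row
        · obtain ⟨h5, h6⟩ := ht hrow
          have : t.src ≠ u := by
            rintro rfl
            rw [hrow] at h5
            exact h5 hu
          simp [aboveTerm, h6, this]
        · simp [aboveTerm, hrow]
      · rintro rfl
        exact hr.ne hx
      · rintro rfl
        exact hr.ne hy
    have hl : D.Meets s.row (D.left s.row) := Or.inl rfl
    have hr' : D.Meets s.row (D.right s.row) := Or.inr rfl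
    have a1 := height_succ hP p s.row (D.left s.row)
    have a2 := height_succ hP p s.row (D.right s.row)
    have b1 := height_succ hP p (s.row + 1) (D.right s.row)
    have b2 := height_succ hP p (s.row + 1) (D.left s.row)
    have c1 := hlev (P s.row (D.left s.row)) (by omega)
    have c2 := hlev (P s.row (D.left s.row) + 1 + 1) (by omega)
    rw [ha _ hl] at a1
    rw [ha _ hr', h1] at a2
    rw [hb _ hr', h3] at b1
    rw [hb _ hl, h2, h1] at b2
    simp only [leftFace, exit, entry]
    simp only [aboveTerm, belowTerm, true_and] at a1 a2 b1 b2
    -- the four possible steps for each of the four orientations of the two strings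
    rcases hm with hm | hm <;> rcases hm' with hm' | hm' <;>
      cases hul : D.up (D.left s.row) <;> cases hur : D.up (D.right s.row) <;>
      simp only [hm, hm', hul, hur, h1, h2, h3, hne, hne.symm, if_true, if_false, and_true,
        and_false, sub_zero, zero_sub, add_zero, sub_self,
        Bool.false_eq_true, reduceCtorEq] at a1 a2 b1 b2 ⊢ <;> linarith
  · -- the step follows a string past the crossing of its row, and the height changes only in the
    -- column of this crossing
    have hdst := hal.dst_eq hm
    have hpos := hP.succ_other _ hr _ hm
    have hne1 : P s.row s.src ≠ P s.row (D.left s.row) :=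
      fun e => hm (Or.inl (hP.injective _ e))
    have hne2 : P s.row s.src ≠ P s.row (D.right s.row) :=
      fun e => hm (Or.inr (hP.injective _ e))
    simp only [leftFace, exit, entry, hdst]
    cases D.up s.src
    · simp only [Bool.false_eq_true, if_false, hpos]
      exact hlev _ (by omega)
    · simp only [if_true, hpos]
      exact (hlev _ (by omega)).symm

/-- The discrete Jordan curve theorem: all points of a simple path have the same face to the left
of the path. -/
theorem leftFace_eq (hP : D.IsPosition P) (hD : ∀ r < D.depth, D.left r < D.right r)
    {x y : σ × ℕ} {p : List (Step σ)} (hp : D.IsPath x y p) (hs : D.IsSimple p)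
    (hx : x.2 = D.depth) (hy : y.2 = D.depth) {s : Step σ} (h : s ∈ p) :
    D.leftFace P p (s.src, D.entry s) = D.leftFace P p x ∧
      D.leftFace P p (s.dst, D.exit s) = D.leftFace P p x := by
  have key : ∀ (q : List (Step σ)) (z : σ × ℕ), q ⊆ p → D.IsPath z y q →
      D.leftFace P p z = D.leftFace P p x → ∀ s ∈ q,
        D.leftFace P p (s.src, D.entry s) = D.leftFace P p x := by
    intro q
    induction q with
    | nil => simp
    | cons t q ih =>
      intro z hsub hq hz s hs'
      have h1 : D.leftFace P p (t.src, D.entry t) = D.leftFace P p x := by rw [← hq.1, hz]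
      rcases List.mem_cons.1 hs' with rfl | hs'
      · exact h1
      · refine ih _ (fun a ha => hsub (List.mem_cons_of_mem _ ha)) hq.2.2 ?_ s hs'
        rw [leftFace_step hP hD hp hs hx hy (hsub (by simp)), h1]
  have h1 := key p x (fun _ h => h) hp rfl s h
  exact ⟨h1, (leftFace_step hP hD hp hs hx hy h).trans h1⟩

/-- A simple path does not cross a level in the same direction at two adjacent positions. -/
theorem not_crosses_adjacent (hP : D.IsPosition P) (hD : ∀ r < D.depth, D.left r < D.right r)
    {x y : σ × ℕ} {p : List (Step σ)} (hp : D.IsPath x y p) (hs : D.IsSimple p)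
    (hx : x.2 = D.depth) (hy : y.2 = D.depth) {u v : σ} {m : ℕ}
    (huv : P m v = P m u + 1) (hup : D.up u = D.up v) (hu : D.Crosses p u m)
    (hv : D.Crosses p v m) : False := by
  have face : ∀ {u : σ}, D.Crosses p u m → D.leftFace P p (u, m) = D.leftFace P p x := by
    rintro u ⟨s, hs', ⟨rfl, rfl⟩ | ⟨rfl, rfl⟩⟩
    · exact (leftFace_eq hP hD hp hs hx hy hs').1
    · exact (leftFace_eq hP hD hp hs hx hy hs').2
  have h1 := (face hu).trans (face hv).symm
  have h2 := height_succ hP p m u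
  have h3 := height_succ hP p m v
  simp only [leftFace, ← hup] at h1
  rw [huv] at h1 h3
  cases hd : D.up u
  · rw [hd] at h1
    simp only [Bool.false_eq_true, if_false] at h1
    exact hv.flux_ne_zero hp hx hy (by linarith)
  · rw [hd] at h1
    simp only [if_true] at h1
    exact hu.flux_ne_zero hp hx hy (by linarith)

end Planarity

end OrientedDiagram

/-! ### Replacing the part of a path inside a region -/

namespace OrientedDiagram

variable {σ τ : Type}

/-- A run through a small diagram: a path from a boundary level to a boundary level which does not
touch a boundary level in between. -/
inductive IsRun (E : OrientedDiagram τ) : τ × ℕ → τ × ℕ → List (Step τ) → Prop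
  | last (s : Step τ) (h : E.IsAllowed s) (h' : E.exit s = 0 ∨ E.exit s = E.depth) :
      IsRun E (s.src, E.entry s) (s.dst, E.exit s) [s]
  | cons (s : Step τ) (y : τ × ℕ) (q : List (Step τ)) (h : E.IsAllowed s)
      (h' : ¬ (E.exit s = 0 ∨ E.exit s = E.depth)) (hq : IsRun E (s.dst, E.exit s) y q) :
      IsRun E (s.src, E.entry s) y (s :: q)

/-- The run `q'` through `E'` has the same ends as the run `q` through `E`. -/
def SameEnds (E E' : OrientedDiagram τ) (q q' : List (Step τ)) : Prop :=
  ∀ x y, E.IsRun x y q → E'.IsRun x y q'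

/-- A step of a small diagram as a step of the large diagram in which it sits below level `a`. -/
def embedStep (a : ℕ) (f : τ → σ) (s : Step τ) : Step σ := ⟨a + s.row, f s.src, f s.dst⟩

/-- The rows of `D` below level `a` form a copy of the small diagram `E`, in which `f` gives the
strings. -/
structure IsRegion (D : OrientedDiagram σ) (E : OrientedDiagram τ) (a : ℕ) (f : τ → σ) :
    Prop where
  injective : Function.Injective f
  left_eq : ∀ r < E.depth, D.left (a + r) = f (E.left r)
  right_eq : ∀ r < E.depth, D.right (a + r) = f (E.right r)
  up_eq : ∀ u, D.up (f u) = E.up u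
  depth_le : a + E.depth ≤ D.depth

/-- The diagrams `D` and `D'` agree outside the rows between the levels `a` and `b`. -/
structure AgreeOutside (D D' : OrientedDiagram σ) (a b : ℕ) : Prop where
  left_eq : ∀ r, ¬ (a ≤ r ∧ r < b) → D'.left r = D.left r
  right_eq : ∀ r, ¬ (a ≤ r ∧ r < b) → D'.right r = D.right r
  up_eq : D'.up = D.up
  depth_eq : D'.depth = D.depth

variable {D D' : OrientedDiagram σ} {E E' : OrientedDiagram τ} {a : ℕ} {f : τ → σ}

theorem IsRegion.meets_iff (hR : D.IsRegion E a f) {r : ℕ} (hr : r < E.depth) (u : τ) :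
    D.Meets (a + r) (f u) ↔ E.Meets r u := by
  unfold Meets
  rw [hR.left_eq r hr, hR.right_eq r hr, hR.injective.eq_iff, hR.injective.eq_iff]

theorem IsRegion.entry_embedStep (hR : D.IsRegion E a f) (s : Step τ) :
    D.entry (embedStep a f s) = a + E.entry s := by
  simp only [entry, embedStep, hR.up_eq]
  split_ifs <;> omega

theorem IsRegion.exit_embedStep (hR : D.IsRegion E a f) (s : Step τ) :
    D.exit (embedStep a f s) = a + E.exit s := by
  simp only [exit, embedStep, hR.up_eq]
  split_ifs <;> omega

theorem IsRegion.isAllowed_iff (hR : D.IsRegion E a f) {s : Step τ} (hr : s.row < E.depth) :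
    D.IsAllowed (embedStep a f s) ↔ E.IsAllowed s := by
  have h1 : D.IsForbidden (embedStep a f s) ↔ E.IsForbidden s := by
    simp only [IsForbidden, embedStep, hR.left_eq _ hr, hR.right_eq _ hr, hR.up_eq,
      hR.injective.eq_iff]
  have h2 := hR.depth_le
  unfold IsAllowed
  rw [h1]
  simp only [embedStep, hR.meets_iff hr, hR.injective.eq_iff, hr, true_and, and_iff_right_iff_imp]
  intro _
  omega

theorem IsRun.isAllowed {x y : τ × ℕ} {q : List (Step τ)} (h : E.IsRun x y q) :
    ∀ s ∈ q, E.IsAllowed s := by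
  induction h with
  | last s h h' => simpa using h
  | cons s y q h h' hq ih => simpa using ⟨h, ih⟩

theorem IsRun.isPath_map (hR : D.IsRegion E a f) {x y : τ × ℕ} {q : List (Step τ)}
    (h : E.IsRun x y q) : D.IsPath (f x.1, a + x.2) (f y.1, a + y.2) (q.map (embedStep a f)) := by
  induction h with
  | last s h h' =>
    refine ⟨by rw [hR.entry_embedStep]; rfl, (hR.isAllowed_iff h.1).2 h, ?_⟩
    rw [hR.exit_embedStep]
    rfl
  | cons s y q h h' hq ih =>
    refine ⟨by rw [hR.entry_embedStep]; rfl, (hR.isAllowed_iff h.1).2 h, ?_⟩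
    rw [hR.exit_embedStep]
    exact ih

theorem IsRun.end_level {x y : τ × ℕ} {q : List (Step τ)} (h : E.IsRun x y q) :
    y.2 = 0 ∨ y.2 = E.depth := by
  induction h with
  | last s h h' => exact h'
  | cons s y q h h' hq ih => exact ih

theorem IsRun.start_level_le {x y : τ × ℕ} {q : List (Step τ)} (h : E.IsRun x y q) :
    x.2 ≤ E.depth := by
  have key : ∀ s, E.IsAllowed s → E.entry s ≤ E.depth := by
    intro s hs
    have := hs.1
    unfold entry
    split_ifs <;> omega
  cases h with
  | last s h h' => exact key s h
  | cons s y q h h' hq => exact key s h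

theorem IsRegion.eq_embedStep (hR : D.IsRegion E a f) {s : Step σ} (hs : D.IsAllowed s) {r : ℕ}
    (hr : r < E.depth) (hrow : s.row = a + r) {u : τ} (hu : s.src = f u) :
    ∃ v, s = embedStep a f ⟨r, u, v⟩ := by
  obtain ⟨row, src, dst⟩ := s
  obtain rfl : row = a + r := hrow
  obtain rfl : src = f u := hu
  rcases hs.2.1 with h | ⟨-, h | h⟩
  · exact ⟨u, by rw [show dst = f u from h]; rfl⟩
  · exact ⟨E.left r, by rw [show dst = D.left (a + r) from h, hR.left_eq r hr]; rfl⟩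
  · exact ⟨E.right r, by rw [show dst = D.right (a + r) from h, hR.right_eq r hr]; rfl⟩

theorem exit_le (E : OrientedDiagram τ) {s : Step τ} (h : s.row < E.depth) :
    E.exit s ≤ E.depth := by
  unfold exit
  split_ifs <;> omega

/-- The point is not on a string of the region strictly between its boundary levels. -/
def NotInside (E : OrientedDiagram τ) (a : ℕ) (f : τ → σ) (x : σ × ℕ) : Prop :=
  ∀ u m, x = (f u, a + m) → ¬ (0 < m ∧ m < E.depth)

/-- A path that steps into the region starts with a run through it. -/
theorem IsRegion.exists_run (hR : D.IsRegion E a f) {y : σ × ℕ} (hy : E.NotInside a f y)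
    (p : List (Step σ)) : ∀ {s : Step σ} {u : τ} {r : ℕ}, D.IsPath (s.src, D.entry s) y (s :: p) →
      s.src = f u → s.row = a + r → r < E.depth →
      ∃ x z q p', E.IsRun x z q ∧ s :: p = q.map (embedStep a f) ++ p' ∧
        D.IsPath (f z.1, a + z.2) y p' ∧ (s.src, D.entry s) = (f x.1, a + x.2) := by
  induction p with
  | nil =>
    intro s u r hp hu hrow hr
    obtain ⟨v, rfl⟩ := hR.eq_embedStep hp.2.1 hr hrow hu
    have hal := (hR.isAllowed_iff (s := ⟨r, u, v⟩) hr).1 hp.2.1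
    have hle := exit_le E (s := ⟨r, u, v⟩) hr
    have he : E.exit ⟨r, u, v⟩ = 0 ∨ E.exit ⟨r, u, v⟩ = E.depth := by
      have h1 : (f v, D.exit (embedStep a f ⟨r, u, v⟩)) = y := hp.2.2
      have := hy v _ (by rw [← h1, hR.exit_embedStep])
      omega
    refine ⟨_, _, _, [], IsRun.last _ hal he, rfl, ?_, ?_⟩
    · rw [← hR.exit_embedStep]
      exact hp.2.2
    · rw [hR.entry_embedStep]; rfl
  | cons t p ih =>
    intro s u r hp hu hrow hr
    obtain ⟨v, rfl⟩ := hR.eq_embedStep hp.2.1 hr hrow hu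
    have hal := (hR.isAllowed_iff (s := ⟨r, u, v⟩) hr).1 hp.2.1
    have hle := exit_le E (s := ⟨r, u, v⟩) hr
    by_cases he : E.exit ⟨r, u, v⟩ = 0 ∨ E.exit ⟨r, u, v⟩ = E.depth
    · refine ⟨_, _, _, t :: p, IsRun.last _ hal he, rfl, ?_, ?_⟩
      · rw [← hR.exit_embedStep]
        exact hp.2.2
      · rw [hR.entry_embedStep]; rfl
    · have h2 := hp.2.2
      have h3 : (f v, a + E.exit ⟨r, u, v⟩) = (t.src, D.entry t) := by
        rw [← hR.exit_embedStep]; exact h2.1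
      have h4 : t.src = f v := (Prod.ext_iff.1 h3).1.symm
      have h5 : D.entry t = a + E.exit ⟨r, u, v⟩ := (Prod.ext_iff.1 h3).2.symm
      have h6 : ∃ r', t.row = a + r' ∧ r' < E.depth := by
        unfold entry at h5
        split_ifs at h5
        · exact ⟨E.exit ⟨r, u, v⟩ - 1, by omega, by omega⟩
        · exact ⟨E.exit ⟨r, u, v⟩, by omega, by omega⟩
      obtain ⟨r', h6, h7⟩ := h6
      have h8 : D.IsPath (t.src, D.entry t) y (t :: p) := by
        rw [← h3, ← hR.exit_embedStep]; exact h2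
      obtain ⟨x, z, q, p', hq, e, hp', hx⟩ := ih h8 h4 h6 h7
      have hx' : x = (v, E.exit ⟨r, u, v⟩) := by
        rw [← h3] at hx
        obtain ⟨e1, e2⟩ := Prod.ext_iff.1 hx
        refine Prod.ext (hR.injective e1.symm) ?_
        simp at e2
        exact e2.symm
      subst hx'
      refine ⟨_, z, _, p', IsRun.cons ⟨r, u, v⟩ z q hal he hq, ?_, hp', ?_⟩
      · rw [e]; rfl
      · rw [hR.entry_embedStep]; rfl

/-- A path decomposes into steps outside the region and runs through the region, and in another
diagram that agrees outside the region the runs may be replaced by runs with the same ends. -/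
theorem IsRegion.decompose (hR : D.IsRegion E a f) (hR' : D'.IsRegion E' a f)
    (hE : E'.depth = E.depth) (hD : D.AgreeOutside D' a (a + E.depth)) {y : σ × ℕ}
    (hy : E.NotInside a f y) (p : List (Step σ)) : ∀ {x : σ × ℕ}, E.NotInside a f x →
      D.IsPath x y p → ∃ (O : List (Step σ)) (Rs : List (List (Step τ))),
        p.Perm (O ++ Rs.flatten.map (embedStep a f)) ∧
        (∀ s ∈ O, ¬ (a ≤ s.row ∧ s.row < a + E.depth) ∨
          (¬ D'.Meets s.row s.src ∧ s.dst = s.src)) ∧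
        (∀ q ∈ Rs, ∃ x z, E.IsRun x z q ∧ (x.2 = 0 ∨ x.2 = E.depth)) ∧
        ∀ Rs', List.Forall₂ (SameEnds E E') Rs Rs' → ∃ p', D'.IsPath x y p' ∧
          p'.Perm (O ++ Rs'.flatten.map (embedStep a f)) := by
  induction hl : p.length using Nat.strong_induction_on generalizing p with
  | _ l ih =>
  intro x hx hp
  rcases p with _ | ⟨s, p⟩
  · refine ⟨[], [], by simp, by simp, by simp, ?_⟩
    intro Rs' h
    cases h
    exact ⟨[], hp, by simp⟩
  by_cases hin : (a ≤ s.row ∧ s.row < a + E.depth) ∧ ∃ u, s.src = f u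
  · -- the path enters the region: split off the run up to the point where it leaves the region
    obtain ⟨⟨h1, h2⟩, u, hu⟩ := hin
    have hx' := hp.1
    subst hx'
    obtain ⟨x', z, q, p', hq, e, hp', hx'⟩ := hR.exists_run hy p (r := s.row - a) hp hu
      (by omega) (by omega)
    have hlen : p'.length < l := by
      have : q ≠ [] := by rintro rfl; cases hq
      have h3 := congrArg List.length e
      have h4 := List.length_pos_iff.2 this
      rw [hl, List.length_append, List.length_map] at h3
      omega
    have hz : E.NotInside a f (f z.1, a + z.2) := by
      intro v m h
      have h5 := (Prod.ext_iff.1 h).2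
      simp only at h5
      have h6 := hq.end_level
      omega
    obtain ⟨O, Rs, hperm, hO, hRs, hsub⟩ := ih _ hlen p' rfl hz hp'
    refine ⟨O, q :: Rs, ?_, hO, ?_, ?_⟩
    · rw [e, List.flatten_cons, List.map_append]
      refine (List.Perm.append_left _ hperm).trans ?_
      rw [← List.append_assoc, ← List.append_assoc]
      exact List.Perm.append_right _ List.perm_append_comm
    · intro q' hq'
      rcases List.mem_cons.1 hq' with rfl | hq'
      · refine ⟨x', z, hq, ?_⟩
        have h3 := hx x'.1 x'.2 hx'
        have h4 := hq.start_level_le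
        omega
      · exact hRs q' hq'
    · intro Rs' h
      obtain ⟨q', Rs'', h7, h8, rfl⟩ := List.forall₂_cons_left_iff.1 h
      obtain ⟨p'', hp'', hperm'⟩ := hsub Rs'' h8
      refine ⟨q'.map (embedStep a f) ++ p'', ?_, ?_⟩
      · rw [hx']
        exact ((h7 _ _ hq).isPath_map hR').append hp''
      · rw [List.flatten_cons, List.map_append]
        refine (List.Perm.append_left _ hperm').trans ?_
        rw [← List.append_assoc, ← List.append_assoc]
        exact List.Perm.append_right _ List.perm_append_comm
  · -- the step stays outside the region and is a step of the other diagram as well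
    have hal := hp.2.1
    have hstep : D'.IsAllowed s ∧ E.NotInside a f (s.dst, D.exit s) ∧
        (¬ (a ≤ s.row ∧ s.row < a + E.depth) ∨ (¬ D'.Meets s.row s.src ∧ s.dst = s.src)) := by
      by_cases hrow : a ≤ s.row ∧ s.row < a + E.depth
      · have hsrc : ∀ u, s.src ≠ f u := fun u hu => hin ⟨hrow, u, hu⟩
        have e : s.row = a + (s.row - a) := by omega
        have hm : ¬ D.Meets s.row s.src := by
          rw [e]
          rintro (h | h)
          · rw [hR.left_eq _ (by omega)] at h; exact hsrc _ h
          · rw [hR.right_eq _ (by omega)] at h; exact hsrc _ h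
        have hm' : ¬ D'.Meets s.row s.src := by
          rw [e]
          rintro (h | h)
          · rw [hR'.left_eq _ (by omega)] at h; exact hsrc _ h
          · rw [hR'.right_eq _ (by omega)] at h; exact hsrc _ h
        have hdst := hal.dst_eq hm
        refine ⟨⟨by rw [hD.depth_eq]; exact hal.1, Or.inl hdst, ?_⟩, ?_, Or.inr ⟨hm', hdst⟩⟩
        · rintro ⟨-, ⟨h, -⟩ | ⟨h, -⟩⟩
          · exact hm' (Or.inl h)
          · exact hm' (Or.inr h)
        · intro u m h
          rw [hdst] at h
          exact absurd (Prod.ext_iff.1 h).1 (hsrc u)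
      · refine ⟨?_, ?_, Or.inl hrow⟩
        · have h1 := hD.left_eq _ hrow
          have h2 := hD.right_eq _ hrow
          simp only [IsAllowed, IsForbidden, Meets, h1, h2, hD.up_eq, hD.depth_eq]
          exact hal
        · intro u m h
          have h5 := (Prod.ext_iff.1 h).2
          simp only [exit] at h5
          split_ifs at h5 <;> omega
    obtain ⟨hal', hne, hor⟩ := hstep
    obtain ⟨O, Rs, hperm, hO, hRs, hsub⟩ := ih p.length (by rw [← hl]; simp) p rfl hne hp.2.2
    refine ⟨s :: O, Rs, hperm.cons s, ?_, hRs, ?_⟩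
    · intro t ht
      rcases List.mem_cons.1 ht with rfl | ht
      · exact hor
      · exact hO t ht
    · intro Rs' h
      obtain ⟨p', hp', hperm'⟩ := hsub Rs' h
      refine ⟨s :: p', ⟨?_, hal', ?_⟩, hperm'.cons s⟩
      · rw [hp.1]
        simp only [entry, hD.up_eq]
      · simp only [exit, hD.up_eq]
        exact hp'

theorem IsRegion.apart_iff (hR : D.IsRegion E a f) {s t : Step τ} (hs : s.row < E.depth)
    (ht : t.row < E.depth) : D.Apart (embedStep a f s) (embedStep a f t) ↔ E.Apart s t := by
  have h1 : D.Meets (embedStep a f s).row (embedStep a f s).src ↔ E.Meets s.row s.src :=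
    hR.meets_iff hs _
  have h2 : D.Meets (embedStep a f t).row (embedStep a f t).src ↔ E.Meets t.row t.src :=
    hR.meets_iff ht _
  unfold Apart
  rw [h1, h2]
  simp [embedStep]

theorem IsRegion.isSimple_map (hR : D.IsRegion E a f) {q : List (Step τ)}
    (hq : ∀ s ∈ q, s.row < E.depth) :
    D.IsSimple (q.map (embedStep a f)) ↔ E.IsSimple q := by
  unfold IsSimple
  rw [List.pairwise_map]
  exact ⟨fun h => h.imp_of_mem fun hs ht h => (hR.apart_iff (hq _ hs) (hq _ ht)).1 h,
    fun h => h.imp_of_mem fun hs ht h => (hR.apart_iff (hq _ hs) (hq _ ht)).2 h⟩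

theorem IsRegion.sign_embedStep [LinearOrder σ] [LinearOrder τ] (hR : D.IsRegion E a f)
    (hE : ∀ r < E.depth, E.left r < E.right r)
    (hD : ∀ r < D.depth, D.left r < D.right r) {s : Step τ} (hs : E.IsAllowed s) :
    (embedStep a f s).sign = s.sign := by
  have h1 := hE _ hs.1
  have h2 := hD (a + s.row) (by have := hs.1; have := hR.depth_le; omega)
  rw [hR.left_eq _ hs.1, hR.right_eq _ hs.1] at h2
  rcases hs.2.1 with h | ⟨h, h'⟩
  · rw [Step.sign_of_eq h, Step.sign_of_eq (by simp [embedStep, h])]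
  · unfold Step.sign embedStep
    rcases h with h | h <;> rcases h' with h' | h' <;> simp only [h, h', lt_self_iff_false, if_false]
    · simp [h1, h2]
    · simp [h1, h2, h1.not_gt, h2.not_gt]

theorem IsRegion.exponentAt_map [LinearOrder σ] [LinearOrder τ] (hR : D.IsRegion E a f)
    (hE : ∀ r < E.depth, E.left r < E.right r)
    (hD : ∀ r < D.depth, D.left r < D.right r) {q : List (Step τ)} (hq : ∀ s ∈ q, E.IsAllowed s)
    (r : ℕ) : exponentAt (q.map (embedStep a f)) (a + r) = exponentAt q r := by
  induction q with
  | nil => simp [exponentAt]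
  | cons s q ih =>
    rw [List.map_cons, exponentAt_cons, exponentAt_cons,
      ih fun t ht => hq t (List.mem_cons_of_mem _ ht),
      hR.sign_embedStep hE hD (hq s (by simp))]
    simp [embedStep]

end OrientedDiagram

/-! ### Enumeration of the runs through a small diagram -/

namespace OrientedDiagram

variable {σ : Type} {c : ℕ}

instance [DecidableEq σ] (D : OrientedDiagram σ) (r : ℕ) (u : σ) : Decidable (D.Meets r u) :=
  inferInstanceAs (Decidable (u = D.left r ∨ u = D.right r))

instance [DecidableEq σ] (D : OrientedDiagram σ) : DecidablePred D.IsForbidden := fun s =>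
  inferInstanceAs (Decidable (s.dst = s.src ∧
    ((s.src = D.left s.row ∧ D.up s.src ∧ D.up (D.right s.row)) ∨
      (s.src = D.right s.row ∧ ¬ D.up s.src ∧ ¬ D.up (D.left s.row)))))

instance [DecidableEq σ] (D : OrientedDiagram σ) : DecidablePred D.IsAllowed := fun s =>
  inferInstanceAs (Decidable (s.row < D.depth ∧
    (s.dst = s.src ∨ (D.Meets s.row s.src ∧ D.Meets s.row s.dst)) ∧ ¬ D.IsForbidden s))

instance [DecidableEq σ] (D : OrientedDiagram σ) (s s' : Step σ) : Decidable (D.Apart s s') :=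
  inferInstanceAs (Decidable (D.Meets s.row s.src → D.Meets s'.row s'.src → s.row ≠ s'.row))

instance [DecidableEq σ] (D : OrientedDiagram σ) : DecidablePred D.IsSimple := fun p =>
  inferInstanceAs (Decidable (p.Pairwise D.Apart))

instance [DecidableEq σ] (D : OrientedDiagram σ) (p : List (Step σ)) (u : σ) (m : ℕ) :
    Decidable (D.Crosses p u m) :=
  inferInstanceAs (Decidable
    (∃ s ∈ p, (s.src = u ∧ D.entry s = m) ∨ (s.dst = u ∧ D.exit s = m)))

/-- The allowed steps that come into their row at the point `x`. -/
def stepsFrom (E : OrientedDiagram (Fin c)) (x : Fin c × ℕ) : List (Step (Fin c)) :=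
  if E.up x.1 = true ∧ x.2 = 0 then []
  else ((List.finRange c).map
    (Step.mk (if E.up x.1 = true then x.2 - 1 else x.2) x.1)).filter fun s => decide (E.IsAllowed s)

/-- The runs from the point `x` with at most `N` steps; the entry `none` stands for paths with `N`
steps that have not reached a boundary level. -/
def runsFrom (E : OrientedDiagram (Fin c)) : ℕ → Fin c × ℕ → List (Option (List (Step (Fin c))))
  | 0, _ => [none]
  | N + 1, x => (E.stepsFrom x).flatMap fun s =>
      if E.exit s = 0 ∨ E.exit s = E.depth then [some [s]]
      else (runsFrom E N (s.dst, E.exit s)).map (Option.map (s :: ·))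

theorem mem_stepsFrom {E : OrientedDiagram (Fin c)} {x : Fin c × ℕ} {s : Step (Fin c)} :
    s ∈ E.stepsFrom x ↔ E.IsAllowed s ∧ x = (s.src, E.entry s) := by
  obtain ⟨u, m⟩ := x
  obtain ⟨r, src, dst⟩ := s
  simp only [stepsFrom]
  have hmem : ∀ (l : List (Step (Fin c))) (s : Step (Fin c)),
      s ∈ l.filter (fun s => decide (E.IsAllowed s)) ↔ s ∈ l ∧ E.IsAllowed s := by
    intro l s
    rw [List.mem_filter, decide_eq_true_iff]
  by_cases h : E.up u = true ∧ m = 0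
  · rw [if_pos h]
    simp only [List.not_mem_nil, false_iff, not_and]
    rintro - h'
    obtain ⟨rfl, rfl⟩ := Prod.mk.inj h'
    simp [entry, h.1] at h
  · rw [if_neg h, hmem, and_comm]
    refine and_congr_right fun _ => ?_
    simp only [List.mem_map, List.mem_finRange, true_and, Step.mk.injEq, Prod.mk.injEq, entry]
    cases hu : E.up u
    · simp only [Bool.false_eq_true, if_false]
      constructor
      · rintro ⟨v, rfl, rfl, rfl⟩
        exact ⟨rfl, by rw [hu]; rfl⟩
      · rintro ⟨rfl, hm⟩
        rw [hu] at hm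
        exact ⟨dst, hm, rfl, rfl⟩
    · have hm0 : m ≠ 0 := fun e => h ⟨hu, e⟩
      simp only [if_true]
      constructor
      · rintro ⟨v, rfl, rfl, rfl⟩
        refine ⟨rfl, ?_⟩
        rw [hu, if_pos rfl]
        omega
      · rintro ⟨rfl, hm⟩
        rw [hu, if_pos rfl] at hm
        exact ⟨dst, by omega, rfl, rfl⟩

theorem IsRun.of_mem_runsFrom {E : OrientedDiagram (Fin c)} {N : ℕ} {x : Fin c × ℕ}
    {q : List (Step (Fin c))} (h : some q ∈ E.runsFrom N x) : ∃ y, E.IsRun x y q := by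
  induction N generalizing x q with
  | zero => simp [runsFrom] at h
  | succ N ih =>
    simp only [runsFrom, List.mem_flatMap] at h
    obtain ⟨s, hs, h⟩ := h
    obtain ⟨hal, rfl⟩ := mem_stepsFrom.1 hs
    split_ifs at h with he
    · simp only [List.mem_singleton, Option.some.injEq] at h
      subst h
      exact ⟨_, IsRun.last s hal he⟩
    · simp only [List.mem_map, Option.map_eq_some_iff] at h
      obtain ⟨o, ho, q', rfl, rfl⟩ := h
      obtain ⟨y, hy⟩ := ih ho
      exact ⟨y, IsRun.cons s y q' hal he hy⟩

theorem IsRun.mem_runsFrom {E : OrientedDiagram (Fin c)} {x y : Fin c × ℕ}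
    {q : List (Step (Fin c))} (h : E.IsRun x y q) (N : ℕ) :
    some q ∈ E.runsFrom N x ∨ none ∈ E.runsFrom N x := by
  induction h generalizing N with
  | last s h h' =>
    cases N with
    | zero => simp [runsFrom]
    | succ N =>
      left
      simp only [runsFrom, List.mem_flatMap]
      exact ⟨s, mem_stepsFrom.2 ⟨h, rfl⟩, by simp [h']⟩
  | cons s y q h h' hq ih =>
    cases N with
    | zero => simp [runsFrom]
    | succ N =>
      have hs := mem_stepsFrom.2 ⟨h, rfl⟩
      rcases ih N with h1 | h1
      · left
        simp only [runsFrom, List.mem_flatMap]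
        refine ⟨s, hs, ?_⟩
        rw [if_neg h']
        exact List.mem_map.2 ⟨_, h1, rfl⟩
      · right
        simp only [runsFrom, List.mem_flatMap]
        refine ⟨s, hs, ?_⟩
        rw [if_neg h']
        exact List.mem_map.2 ⟨_, h1, rfl⟩

/-- The boundary points of a small diagram. -/
def boundaryPoints (E : OrientedDiagram (Fin c)) : List (Fin c × ℕ) :=
  (List.finRange c).flatMap fun u => [(u, 0), (u, E.depth)]

/-- A bound on the number of steps of the runs through the diagrams that occur below. -/
def maxSteps : ℕ := 8

/-- The runs through a small diagram, with their first points. -/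
def runs (E : OrientedDiagram (Fin c)) : List ((Fin c × ℕ) × List (Step (Fin c))) :=
  E.boundaryPoints.flatMap fun x => ((E.runsFrom maxSteps x).filterMap id).map (Prod.mk x)

/-- The last point of a list of steps. -/
def lastPoint (E : OrientedDiagram (Fin c)) (q : List (Step (Fin c))) : Option (Fin c × ℕ) :=
  q.getLast?.map fun s => (s.dst, E.exit s)

theorem IsRun.lastPoint_eq {E : OrientedDiagram (Fin c)} {x y : Fin c × ℕ}
    {q : List (Step (Fin c))} (h : E.IsRun x y q) : E.lastPoint q = some y := by
  induction h with
  | last s h h' => rfl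
  | cons s y q h h' hq ih =>
    cases q with
    | nil => cases ih
    | cons t q => exact ih

theorem IsRun.start_eq {E : OrientedDiagram (Fin c)} {x x' y y' : Fin c × ℕ}
    {q : List (Step (Fin c))} (h : E.IsRun x y q) (h' : E.IsRun x' y' q) : x = x' := by
  have key : ∀ {x y : Fin c × ℕ}, E.IsRun x y q →
      some x = q.head?.map fun s => (s.src, E.entry s) := by
    intro x y h
    cases h <;> rfl
  exact Option.some_injective _ ((key h).trans (key h').symm)

theorem mem_runs {E : OrientedDiagram (Fin c)} (hE : ∀ x ∈ E.boundaryPoints,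
    ∀ o ∈ E.runsFrom maxSteps x, o.isSome = true) {x : Fin c × ℕ} {q : List (Step (Fin c))} :
    (x, q) ∈ E.runs ↔ (x.2 = 0 ∨ x.2 = E.depth) ∧ ∃ y, E.IsRun x y q := by
  have hb : x ∈ E.boundaryPoints ↔ (x.2 = 0 ∨ x.2 = E.depth) := by
    obtain ⟨u, m⟩ := x
    simp only [boundaryPoints, List.mem_flatMap, List.mem_finRange, true_and, List.mem_cons,
      Prod.mk.injEq, List.not_mem_nil, or_false]
    exact ⟨fun ⟨_, h⟩ => h.imp And.right And.right, fun h => ⟨u, h.imp (⟨rfl, ·⟩) (⟨rfl, ·⟩)⟩⟩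
  simp only [runs, List.mem_flatMap, List.mem_map, List.mem_filterMap, id, exists_eq_right,
    Prod.mk.injEq]
  constructor
  · rintro ⟨x', hx', q', hq', rfl, rfl⟩
    exact ⟨hb.1 hx', IsRun.of_mem_runsFrom hq'⟩
  · rintro ⟨hx, y, hy⟩
    exact ⟨x, hb.2 hx, q, (hy.mem_runsFrom maxSteps).resolve_right
      fun h => by simpa using hE x (hb.2 hx) _ h, rfl, rfl⟩

/-- The exponents of the crossings of a small diagram. -/
def localVector (E : OrientedDiagram (Fin c)) (q : List (Step (Fin c))) : List ℤ :=
  (List.range E.depth).map (exponentAt q)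

/-- The runs through `E'` with the same ends as the run `q` through `E`. -/
def parallelRuns (E E' : OrientedDiagram (Fin c)) (q : (Fin c × ℕ) × List (Step (Fin c))) :
    List (List (Step (Fin c))) :=
  (E'.runs.filter fun q' => decide (q'.1 = q.1 ∧ E'.lastPoint q'.2 = E.lastPoint q.2)).map Prod.snd

/-- A simple list of steps that does not cross a boundary level on two strings related by `X`. -/
def IsPlanar (E : OrientedDiagram (Fin c)) (X : Fin c → Fin c → Bool)
    (q : List (Step (Fin c))) : Prop :=
  E.IsSimple q ∧ ∀ u v, X u v = true → ∀ m ∈ [0, E.depth], ¬ (E.Crosses q u m ∧ E.Crosses q v m)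

instance (E : OrientedDiagram (Fin c)) (X : Fin c → Fin c → Bool) :
    DecidablePred (E.IsPlanar X) := fun q =>
  inferInstanceAs (Decidable (E.IsSimple q ∧
    ∀ u v, X u v = true → ∀ m ∈ [0, E.depth], ¬ (E.Crosses q u m ∧ E.Crosses q v m)))

/-- The finitely many facts about the runs through the small diagrams `E` and `E'` on which the
comparison of the paths rests. The vectors of planar collections of runs through `E` satisfy
`adm`, and each vector in the list `targets` (with the flag `true` for `E'` and `false` for `E`) is
the vector of a simple collection of runs with the same ends. -/
structure RunsMatch (E E' : OrientedDiagram (Fin c)) (X : Fin c → Fin c → Bool)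
    (adm : List ℤ → Bool) (targets : List ℤ → List (Bool × List ℤ)) : Prop where
  bounded : ∀ x ∈ E.boundaryPoints, ∀ o ∈ E.runsFrom maxSteps x, o.isSome = true
  bounded' : ∀ x ∈ E'.boundaryPoints, ∀ o ∈ E'.runsFrom maxSteps x, o.isSome = true
  zero : adm (E.localVector []) = true ∧
    ∀ t ∈ targets (E.localVector []), t.2 = E.localVector []
  one : ∀ q ∈ E.runs, E.IsPlanar X q.2 → adm (E.localVector q.2) = true ∧
    ∀ t ∈ targets (E.localVector q.2),
      ∃ q' ∈ E.parallelRuns (if t.1 then E' else E) q,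
        (if t.1 then E' else E).IsSimple q' ∧ E.localVector q' = t.2
  two : ∀ q₁ ∈ E.runs, ∀ q₂ ∈ E.runs, E.IsPlanar X (q₁.2 ++ q₂.2) →
    adm (E.localVector (q₁.2 ++ q₂.2)) = true ∧
    (∀ t ∈ targets (E.localVector (q₁.2 ++ q₂.2)),
      ∃ q₁' ∈ E.parallelRuns (if t.1 then E' else E) q₁,
      ∃ q₂' ∈ E.parallelRuns (if t.1 then E' else E) q₂,
        (if t.1 then E' else E).IsSimple (q₁' ++ q₂') ∧ E.localVector (q₁' ++ q₂') = t.2) ∧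
    ∀ q₃ ∈ E.runs, ¬ E.IsPlanar X (q₁.2 ++ q₂.2 ++ q₃.2)

/-- Three strings that cross pairwise, in one of the two possible orders. -/
def tripleDiagram (b : Bool) (t : ℕ) : OrientedDiagram (Fin 3) where
  left r := match b, r with
    | true, 0 => 0
    | true, 1 => 0
    | true, _ => 1
    | false, 0 => 1
    | false, 1 => 0
    | false, _ => 0
  right r := match b, r with
    | true, 0 => 1
    | true, 1 => 2
    | true, _ => 2
    | false, 0 => 2
    | false, 1 => 2
    | false, _ => 1
  depth := 3
  up u := decide (u.val < t)

/-- Strings that are adjacent at the boundary levels of a triple and have the same orientation. -/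
def adjacentSame (t : ℕ) (u v : Fin 3) : Bool :=
  decide (v.val = u.val + 1 ∧ (u.val < t ↔ v.val < t))

/-- The local exponent vectors that occur at a triple of crossings. -/
def tripleAdmissible : List ℤ → Bool
  | [x, y, z] => decide (x = z ∨ (x = -1 ∧ z = 0 ∧ (y = 0 ∨ y = 1)) ∨
      (x = 0 ∧ z = 1 ∧ (y = -1 ∨ y = 0)) ∨ (x = z + 1 ∧ y = 0 ∧ (x = 0 ∨ x = 1)))
  | _ => false

/-- The local exponent vectors that occur together with a given one, with the flag `true` if they
occur on the other side of a braid move. -/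
def tripleTargets : List ℤ → List (Bool × List ℤ)
  | [x, y, z] =>
    if x = z then [(true, [y, x, y])]
    else if x = -1 then [(false, [0, y - 1, 1]), (true, [y, 0, y - 1])]
    else if z = 1 then [(false, [-1, y + 1, 0]), (true, [y + 1, 0, y])]
    else [(true, [-1, x, 0]), (true, [0, x - 1, 1])]
  | _ => []

theorem runsMatch_triple (b : Bool) (t : ℕ) (ht : t < 4) :
    RunsMatch (tripleDiagram b t) (tripleDiagram (!b) t) (adjacentSame t) tripleAdmissible
      tripleTargets := by
  interval_cases t <;> cases b <;> constructor <;> decide +kernel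

end OrientedDiagram

/-! ### Enumeration of the runs through two disjoint crossings -/

namespace OrientedDiagram

variable {σ : Type} [LinearOrder σ] {c : ℕ}

/-- Two disjoint pairs of crossing strings, whose crossings come in one of the two possible
orders. -/
def pairsDiagram (b : Bool) (t₁ t₂ : ℕ) : OrientedDiagram (Fin 4) where
  left r := match b, r with
    | true, 0 => 0
    | true, _ => 2
    | false, 0 => 2
    | false, _ => 0
  right r := match b, r with
    | true, 0 => 1
    | true, _ => 3
    | false, 0 => 3
    | false, _ => 1
  depth := 2
  up u := if u.val < 2 then decide (u.val < t₁) else decide (u.val < t₂ + 2)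

/-- A commutation of two crossings exchanges the exponents. -/
def pairsTargets : List ℤ → List (Bool × List ℤ)
  | [x, y] => [(true, [y, x])]
  | _ => []

theorem runsMatch_pairs (b : Bool) (t₁ t₂ : ℕ) (h₁ : t₁ < 3) (h₂ : t₂ < 3) :
    RunsMatch (pairsDiagram b t₁ t₂) (pairsDiagram (!b) t₁ t₂) (fun _ _ => false)
      (fun _ => true) pairsTargets := by
  interval_cases t₁ <;> interval_cases t₂ <;> cases b <;> constructor <;> decide +kernel

/-! ### Transfer of paths -/

variable {D D' : OrientedDiagram σ} {E E' : OrientedDiagram (Fin c)} {a : ℕ} {f : Fin c → σ}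

/-- A simple path is encoded by its runs through the region, and simple collections of runs with
the same ends give simple paths in a diagram which agrees outside the region. -/
theorem IsRegion.exists_runs (hR : D.IsRegion E a f) (hR' : D'.IsRegion E' a f)
    (hdepth : E'.depth = E.depth) (hag : D.AgreeOutside D' a (a + E.depth))
    (hE : ∀ r < E.depth, E.left r < E.right r) (hD : ∀ r < D.depth, D.left r < D.right r)
    (hE' : ∀ r < E.depth, E'.left r < E'.right r) (hD' : ∀ r < D.depth, D'.left r < D'.right r)
    {x y : σ × ℕ} (hx : x.2 = D.depth) (hy : y.2 = D.depth) {p : List (Step σ)}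
    (hp : D.IsPath x y p) (hs : D.IsSimple p) :
    ∃ Rs : List (List (Step (Fin c))),
      (∀ q ∈ Rs, ∃ x z, E.IsRun x z q ∧ (x.2 = 0 ∨ x.2 = E.depth)) ∧
      E.IsSimple Rs.flatten ∧
      (∀ u m, E.Crosses Rs.flatten u m → D.Crosses p (f u) (a + m)) ∧
      (∀ r < E.depth, exponentAt Rs.flatten r = exponentAt p (a + r)) ∧
      ∀ Rs', List.Forall₂ (SameEnds E E') Rs Rs' → E'.IsSimple Rs'.flatten →
        ∃ p', D'.IsPath x y p' ∧ D'.IsSimple p' ∧ ∀ r, exponentAt p' r =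
          if a ≤ r ∧ r < a + E.depth then exponentAt Rs'.flatten (r - a) else exponentAt p r := by
  have hin : ∀ x : σ × ℕ, x.2 = D.depth → E.NotInside a f x := by
    rintro x hx u m rfl
    have := hR.depth_le
    simp only at hx
    omega
  obtain ⟨O, Rs, hperm, hO, hRs, hsub⟩ := hR.decompose hR' hdepth hag (hin y hy) p (hin x hx) hp
  have hal : ∀ s ∈ Rs.flatten, E.IsAllowed s := by
    intro s hs
    obtain ⟨q, hq, hs⟩ := List.mem_flatten.1 hs
    obtain ⟨x, z, h, -⟩ := hRs q hq
    exact h.isAllowed s hs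
  have hs' := hs.perm hperm
  obtain ⟨hsO, hsR, -⟩ := List.pairwise_append.1 hs'
  have hzero : ∀ r, a ≤ r ∧ r < a + E.depth → exponentAt O r = 0 := by
    intro r hr
    apply exponentAt_eq_zero
    rintro s hs rfl
    rcases hO s hs with h | h
    · exact absurd hr h
    · exact Step.sign_of_eq h.2
  have hzero' : ∀ (q : List (Step (Fin c))) r, (∀ s ∈ q, s.row < E.depth) →
      ¬ (a ≤ r ∧ r < a + E.depth) → exponentAt (q.map (embedStep a f)) r = 0 := by
    intro q r hq hr
    apply exponentAt_eq_zero
    rintro s hs rfl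
    obtain ⟨t, ht, rfl⟩ := List.mem_map.1 hs
    have := hq t ht
    simp only [embedStep] at hr
    omega
  refine ⟨Rs, hRs, (hR.isSimple_map fun s hs => (hal s hs).1).1 hsR, ?_, ?_, ?_⟩
  · rintro u m ⟨s, hs, h⟩
    refine ⟨embedStep a f s, hperm.mem_iff.2 (List.mem_append_right _ (List.mem_map_of_mem hs)), ?_⟩
    rw [hR.entry_embedStep, hR.exit_embedStep]
    rcases h with ⟨rfl, rfl⟩ | ⟨rfl, rfl⟩
    · exact Or.inl ⟨rfl, rfl⟩
    · exact Or.inr ⟨rfl, rfl⟩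
  · intro r hr
    rw [exponentAt_perm hperm, exponentAt_append, hzero _ (by omega), zero_add,
      hR.exponentAt_map hE hD hal]
  · intro Rs' hRs' hsimple
    obtain ⟨p', hp', hperm'⟩ := hsub Rs' hRs'
    have hal' : ∀ s ∈ Rs'.flatten, E'.IsAllowed s := by
      clear hsub hperm hs' hsR hal hperm' hsimple
      induction hRs' with
      | nil => simp
      | @cons q₀ _ _ _ h _ ih =>
        intro s hs
        rw [List.flatten_cons, List.mem_append] at hs
        rcases hs with hs | hs
        · obtain ⟨x, z, hq, -⟩ := hRs q₀ (by simp)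
          exact (h x z hq).isAllowed s hs
        · exact ih (fun q hq => hRs q (List.mem_cons_of_mem _ hq)) s hs
    have hrow' : ∀ s ∈ Rs'.flatten, s.row < E.depth := fun s hs => hdepth ▸ (hal' s hs).1
    refine ⟨p', hp', ?_, ?_⟩
    · refine IsSimple.perm ?_ hperm'.symm
      unfold IsSimple
      have hmeets : ∀ s ∈ O, D'.Meets s.row s.src →
          ¬ (a ≤ s.row ∧ s.row < a + E.depth) ∧ D.Meets s.row s.src := by
        intro s hs hm
        rcases hO s hs with h | h
        · refine ⟨h, ?_⟩
          unfold Meets at hm ⊢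
          rwa [← hag.left_eq _ h, ← hag.right_eq _ h]
        · exact absurd hm h.1
      rw [List.pairwise_append]
      refine ⟨?_, (hR'.isSimple_map fun s hs => (hal' s hs).1).2 hsimple, ?_⟩
      · refine hsO.imp_of_mem fun {s t} hs ht hst hms hmt => ?_
        exact hst (hmeets s hs hms).2 (hmeets t ht hmt).2
      · intro s hs t ht hms _ e
        obtain ⟨t', ht', rfl⟩ := List.mem_map.1 ht
        have := (hmeets s hs hms).1
        have := hrow' t' ht'
        rw [e] at *
        simp only [embedStep] at *
        omega
    · intro r
      rw [exponentAt_perm hperm', exponentAt_append]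
      split_ifs with hr
      · obtain ⟨r', rfl⟩ : ∃ r', r = a + r' := ⟨r - a, by omega⟩
        rw [hzero _ hr, zero_add, Nat.add_sub_cancel_left,
          hR'.exponentAt_map (fun r hr => hE' r (hdepth ▸ hr))
            (fun r hr => hD' r (hag.depth_eq ▸ hr)) hal']
      · rw [hzero' _ r hrow' hr, exponentAt_perm hperm, exponentAt_append,
          hzero' _ r (fun s hs => (hal s hs).1) hr]

theorem SameEnds.of_mem_parallelRuns (hbd' : ∀ x ∈ E'.boundaryPoints,
    ∀ o ∈ E'.runsFrom maxSteps x, o.isSome = true) {x : Fin c × ℕ} {q q' : List (Step (Fin c))}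
    {z : Fin c × ℕ} (hq : E.IsRun x z q) (h : q' ∈ E.parallelRuns E' (x, q)) :
    SameEnds E E' q q' := by
  intro x₁ z₁ h₁
  obtain rfl := hq.start_eq h₁
  obtain ⟨⟨x', q''⟩, hmem, rfl⟩ := List.mem_map.1 h
  rw [List.mem_filter, decide_eq_true_iff] at hmem
  obtain ⟨hmem, rfl, hlast⟩ := hmem
  obtain ⟨-, z', hrun⟩ := (mem_runs hbd').1 hmem
  simp only [hrun.lastPoint_eq, h₁.lastPoint_eq, Option.some.injEq] at hlast
  exact hlast ▸ hrun

theorem IsPlanar.of_sublist {X : Fin c → Fin c → Bool} {q q' : List (Step (Fin c))}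
    (h : E.IsPlanar X q) (hsub : q'.Sublist q) : E.IsPlanar X q' := by
  refine ⟨h.1.sublist hsub, fun u v huv m hm hc => h.2 u v huv m hm ?_⟩
  exact hc.imp (fun ⟨s, hs, h⟩ => ⟨s, hsub.subset hs, h⟩) fun ⟨s, hs, h⟩ => ⟨s, hsub.subset hs, h⟩

theorem localVector_eq {v : ℕ → ℤ} {q : List (Step (Fin c))}
    (h : ∀ r < E.depth, exponentAt q r = v r) : E.localVector q = (List.range E.depth).map v := by
  refine List.map_congr_left fun r hr => h r (List.mem_range.1 hr)

/-- The enumeration `RunsMatch` covers every planar collection of runs, because such a collection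
has at most two members. -/
theorem RunsMatch.exists_replacement {X : Fin c → Fin c → Bool} {adm : List ℤ → Bool}
    {targets : List ℤ → List (Bool × List ℤ)} (h : RunsMatch E E' X adm targets)
    {Rs : List (List (Step (Fin c)))}
    (hRs : ∀ q ∈ Rs, ∃ x z, E.IsRun x z q ∧ (x.2 = 0 ∨ x.2 = E.depth))
    (hpl : E.IsPlanar X Rs.flatten) :
    adm (E.localVector Rs.flatten) = true ∧ ∀ t ∈ targets (E.localVector Rs.flatten),
      ∃ Rs', List.Forall₂ (SameEnds E (if t.1 then E' else E)) Rs Rs' ∧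
        (if t.1 then E' else E).IsSimple Rs'.flatten ∧ E.localVector Rs'.flatten = t.2 := by
  have hmem : ∀ q ∈ Rs, ∃ x z, E.IsRun x z q ∧ (x, q) ∈ E.runs := by
    intro q hq
    obtain ⟨x, z, hrun, hx⟩ := hRs q hq
    exact ⟨x, z, hrun, (mem_runs h.bounded).2 ⟨hx, z, hrun⟩⟩
  have hbd : ∀ b : Bool, ∀ x ∈ (if b then E' else E).boundaryPoints,
      ∀ o ∈ (if b then E' else E).runsFrom maxSteps x, o.isSome = true := by
    rintro (_ | _)
    · exact h.bounded
    · exact h.bounded'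
  rcases Rs with _ | ⟨q₁, _ | ⟨q₂, _ | ⟨q₃, Rs⟩⟩⟩
  · refine ⟨h.zero.1, fun t ht => ⟨[], List.Forall₂.nil, List.Pairwise.nil, ?_⟩⟩
    exact (h.zero.2 t ht).symm
  · obtain ⟨x, z, hrun, hq⟩ := hmem q₁ (by simp)
    simp only [List.flatten_cons, List.flatten_nil, List.append_nil] at hpl ⊢
    obtain ⟨h1, h2⟩ := h.one _ hq hpl
    refine ⟨h1, fun t ht => ?_⟩
    obtain ⟨q', hq', h3, h4⟩ := h2 t ht
    refine ⟨[q'], List.Forall₂.cons (.of_mem_parallelRuns (hbd _) hrun hq') .nil, ?_, ?_⟩ <;>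
      simpa using by assumption
  · obtain ⟨x₁, z₁, hrun₁, hq₁⟩ := hmem q₁ (by simp)
    obtain ⟨x₂, z₂, hrun₂, hq₂⟩ := hmem q₂ (by simp)
    simp only [List.flatten_cons, List.flatten_nil, List.append_nil] at hpl ⊢
    obtain ⟨h1, h2, -⟩ := h.two _ hq₁ _ hq₂ hpl
    refine ⟨h1, fun t ht => ?_⟩
    obtain ⟨q₁', hq₁', q₂', hq₂', h3, h4⟩ := h2 t ht
    refine ⟨[q₁', q₂'], List.Forall₂.cons (.of_mem_parallelRuns (hbd _) hrun₁ hq₁')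
      (.cons (.of_mem_parallelRuns (hbd _) hrun₂ hq₂') .nil), ?_, ?_⟩ <;>
      simpa using by assumption
  · obtain ⟨x₁, z₁, hrun₁, hq₁⟩ := hmem q₁ (by simp)
    obtain ⟨x₂, z₂, hrun₂, hq₂⟩ := hmem q₂ (by simp)
    obtain ⟨x₃, z₃, hrun₃, hq₃⟩ := hmem q₃ (by simp)
    have hpl3 : E.IsPlanar X (q₁ ++ q₂ ++ q₃) := by
      refine hpl.of_sublist ?_
      simp only [List.flatten_cons, ← List.append_assoc]
      exact List.sublist_append_left _ _
    have hpl2 : E.IsPlanar X (q₁ ++ q₂) := hpl3.of_sublist (List.sublist_append_left _ _)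
    exact absurd hpl3 ((h.two _ hq₁ _ hq₂ hpl2).2.2 _ hq₃)

/-- The vectors of the simple paths of two diagrams that differ in a region are related by the
local rule `targets`. -/
theorem RunsMatch.transfer {X : Fin c → Fin c → Bool} {adm : List ℤ → Bool}
    {targets : List ℤ → List (Bool × List ℤ)} (h : RunsMatch E E' X adm targets)
    (hR : D.IsRegion E a f) (hR' : D'.IsRegion E' a f) (hdepth : E'.depth = E.depth)
    (hag : D.AgreeOutside D' a (a + E.depth))
    (hE : ∀ r < E.depth, E.left r < E.right r) (hD : ∀ r < D.depth, D.left r < D.right r)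
    (hE' : ∀ r < E.depth, E'.left r < E'.right r) (hD' : ∀ r < D.depth, D'.left r < D'.right r)
    {x y : σ × ℕ} (hx : x.2 = D.depth) (hy : y.2 = D.depth) {p : List (Step σ)}
    (hp : D.IsPath x y p) (hs : D.IsSimple p)
    (hX : ∀ u v, X u v = true → ∀ m ∈ [0, E.depth],
      ¬ (D.Crosses p (f u) (a + m) ∧ D.Crosses p (f v) (a + m))) {v : List ℤ}
    (hv : v = (List.range E.depth).map fun r => exponentAt p (a + r)) :
    adm v = true ∧ ∀ t ∈ targets v, ∃ p', (if t.1 then D' else D).IsPath x y p' ∧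
      (if t.1 then D' else D).IsSimple p' ∧ ∀ r, exponentAt p' r =
        if a ≤ r ∧ r < a + E.depth then t.2.getD (r - a) 0 else exponentAt p r := by
  have key : ∀ b : Bool, adm v = true ∧ ∀ t ∈ targets v, t.1 = b →
      ∃ p', (if b then D' else D).IsPath x y p' ∧
      (if b then D' else D).IsSimple p' ∧ ∀ r, exponentAt p' r =
        if a ≤ r ∧ r < a + E.depth then t.2.getD (r - a) 0 else exponentAt p r := by
    intro b
    obtain ⟨Rs, hRs, hsimple, hcr, hexp, hsub⟩ := hR.exists_runs
      (D' := if b then D' else D) (E' := if b then E' else E)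
      (by cases b <;> assumption) (by cases b; rfl; exact hdepth)
      (by cases b; exact ⟨fun _ _ => rfl, fun _ _ => rfl, rfl, rfl⟩; exact hag) hE hD
      (by cases b <;> assumption) (by cases b <;> assumption) hx hy hp hs
    have hpl : E.IsPlanar X Rs.flatten := ⟨hsimple, fun u v huv m hm hc =>
      hX u v huv m hm (hc.imp (hcr u m) (hcr v m))⟩
    obtain ⟨h1, h2⟩ := h.exists_replacement hRs hpl
    rw [localVector_eq hexp, ← hv] at h1 h2
    refine ⟨h1, ?_⟩
    rintro t ht rfl
    obtain ⟨Rs', h3, h4, h5⟩ := h2 t ht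
    obtain ⟨p', h6, h7, h8⟩ := hsub Rs' h3 h4
    refine ⟨p', h6, h7, fun r => ?_⟩
    rw [h8]
    split_ifs with hr
    · rw [← h5, localVector, List.getD_eq_getElem _ _ (by simp; omega)]
      simp
    · rfl
  exact ⟨(key true).1, fun t ht => (key t.1).2 t ht rfl⟩

end OrientedDiagram

/-! ### String diagrams of words -/

section Words

variable {n : ℕ}

/-- At every crossing of the word the string from the upper left has the smaller number. -/
def IsAscending (w : List (Fin n)) : Prop :=
  ∀ r : Fin w.length, leftString w r < rightString w r

theorem diagram_left {w : List (Fin n)} {k : Fin n} {r : ℕ} (hr : r < w.length) :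
    (diagram w k).left r = wordProd (w.take r) (w[r]).castSucc := by
  simp [diagram, hr, leftString, stringAt, column]

theorem diagram_right {w : List (Fin n)} {k : Fin n} {r : ℕ} (hr : r < w.length) :
    (diagram w k).right r = wordProd (w.take r) (w[r]).succ := by
  simp [diagram, hr, rightString, stringAt, column]

theorem IsAscending.lt {w : List (Fin n)} (hw : IsAscending w) (k : Fin n) :
    ∀ r < (diagram w k).depth, (diagram w k).left r < (diagram w k).right r := by
  intro r hr
  have hr' : r < w.length := hr
  have := hw ⟨r, hr'⟩
  simpa [diagram, hr'] using this

/-- The position of the string `u` on level `m`. -/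
def position (w : List (Fin n)) (m : ℕ) (u : Fin (n + 1)) : ℕ := ((wordProd (w.take m))⁻¹ u).val

theorem position_wordProd (w : List (Fin n)) (m : ℕ) (p : Fin (n + 1)) :
    position w m (wordProd (w.take m) p) = p := by
  simp [position]

theorem wordProd_take_succ {w : List (Fin n)} {r : ℕ} (hr : r < w.length) :
    wordProd (w.take (r + 1)) = wordProd (w.take r) * simpleRefl w[r] := by
  rw [List.take_succ_eq_append_getElem hr, wordProd_concat]

theorem position_succ {w : List (Fin n)} {r : ℕ} (hr : r < w.length) (u : Fin (n + 1)) :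
    position w (r + 1) u = simpleRefl w[r] ((wordProd (w.take r))⁻¹ u) := by
  have h : (simpleRefl w[r])⁻¹ = simpleRefl w[r] := inv_eq_of_mul_eq_one_left (simpleRefl_mul_self _)
  rw [position, wordProd_take_succ hr, mul_inv_rev, h, Equiv.Perm.mul_apply]

theorem isPosition_position (w : List (Fin n)) (k : Fin n) :
    (diagram w k).IsPosition (position w) where
  injective m u v h := by
    have := Fin.ext h
    simpa using this
  right_eq r hr := by
    have hr' : r < w.length := hr
    rw [diagram_left hr', diagram_right hr', position_wordProd, position_wordProd]
    simp
  succ_left r hr := by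
    have hr' : r < w.length := hr
    rw [diagram_left hr', diagram_right hr', position_succ hr', position_wordProd]
    simp [simpleRefl_castSucc]
  succ_right r hr := by
    have hr' : r < w.length := hr
    rw [diagram_left hr', diagram_right hr', position_succ hr', position_wordProd]
    simp [simpleRefl_succ]
  succ_other r hr u hu := by
    have hr' : r < w.length := hr
    rw [position_succ hr', position]
    congr 1
    refine Equiv.swap_apply_of_ne_of_ne ?_ ?_
    · rintro h
      exact hu (Or.inl (by rw [diagram_left hr', ← h]; simp))
    · rintro h
      exact hu (Or.inr (by rw [diagram_right hr', ← h]; simp))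

theorem length_append_middle (A B μ : List (Fin n)) {r : ℕ} (hr : r < μ.length) :
    A.length + r < (A ++ μ ++ B).length := by
  simp only [List.length_append]
  omega

theorem getElem_append_middle (A B μ : List (Fin n)) {r : ℕ} (hr : r < μ.length) :
    (A ++ μ ++ B)[A.length + r]'(length_append_middle A B μ hr) = μ[r] := by
  rw [List.getElem_append_left (by simp; omega), List.getElem_append_right (by omega)]
  simp

theorem wordProd_take_middle (A B μ : List (Fin n)) {r : ℕ} (hr : r ≤ μ.length) :
    wordProd ((A ++ μ ++ B).take (A.length + r)) = wordProd A * wordProd (μ.take r) := by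
  rw [List.append_assoc, List.take_length_add_append, List.take_append_of_le_length hr,
    wordProd_append]

theorem diagram_left_middle (A B μ : List (Fin n)) (k : Fin n) {r : ℕ} (hr : r < μ.length) :
    (diagram (A ++ μ ++ B) k).left (A.length + r) =
      wordProd A (wordProd (μ.take r) (μ[r]).castSucc) := by
  rw [diagram_left (length_append_middle A B μ hr), getElem_append_middle,
    wordProd_take_middle A B μ hr.le, Equiv.Perm.mul_apply]

theorem diagram_right_middle (A B μ : List (Fin n)) (k : Fin n) {r : ℕ} (hr : r < μ.length) :
    (diagram (A ++ μ ++ B) k).right (A.length + r) =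
      wordProd A (wordProd (μ.take r) (μ[r]).succ) := by
  rw [diagram_right (length_append_middle A B μ hr), getElem_append_middle,
    wordProd_take_middle A B μ hr.le, Equiv.Perm.mul_apply]

theorem getElem_agree {A B μ μ' : List (Fin n)} (hl : μ'.length = μ.length) {r : ℕ}
    (h : ¬ (A.length ≤ r ∧ r < A.length + μ.length)) (hr : r < (A ++ μ ++ B).length)
    (hr' : r < (A ++ μ' ++ B).length) : (A ++ μ' ++ B)[r] = (A ++ μ ++ B)[r] := by
  rcases lt_or_ge r A.length with h1 | h1
  · simp [List.append_assoc, List.getElem_append_left h1]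
  · rw [List.getElem_append_right (by simp; omega), List.getElem_append_right (by simp; omega)]
    simp [hl]

theorem agreeOutside_diagram {A B μ μ' : List (Fin n)} (hl : μ'.length = μ.length)
    (hp : wordProd μ' = wordProd μ) (k : Fin n) :
    (diagram (A ++ μ ++ B) k).AgreeOutside (diagram (A ++ μ' ++ B) k) A.length
      (A.length + μ.length) := by
  have hlen : (A ++ μ' ++ B).length = (A ++ μ ++ B).length := by simp [hl]
  have htake : ∀ r, ¬ (A.length ≤ r ∧ r < A.length + μ.length) →
      wordProd ((A ++ μ' ++ B).take r) = wordProd ((A ++ μ ++ B).take r) := by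
    intro r h
    rcases lt_or_ge r A.length with h1 | h1
    · rw [List.append_assoc, List.append_assoc, List.take_append_of_le_length h1.le,
        List.take_append_of_le_length h1.le]
    · obtain ⟨m, rfl⟩ : ∃ m, r = A.length + μ.length + m := ⟨r - (A.length + μ.length), by omega⟩
      have e1 : A.length + μ.length = (A ++ μ).length := by simp
      have e2 : A.length + μ.length = (A ++ μ').length := by simp [hl]
      conv_lhs => rw [e2, List.take_length_add_append]
      conv_rhs => rw [e1, List.take_length_add_append]
      simp only [wordProd_append, hp]
  refine ⟨fun r h => ?_, fun r h => ?_, rfl, hlen⟩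
  · by_cases hr : r < (A ++ μ ++ B).length
    · rw [diagram_left hr, diagram_left (hlen ▸ hr), htake r h,
        getElem_agree hl h hr (hlen ▸ hr)]
    · have hr' : ¬ r < (A ++ μ' ++ B).length := by rwa [hlen]
      simp only [diagram, dif_neg hr, dif_neg hr']
  · by_cases hr : r < (A ++ μ ++ B).length
    · rw [diagram_right hr, diagram_right (hlen ▸ hr), htake r h,
        getElem_agree hl h hr (hlen ▸ hr)]
    · have hr' : ¬ r < (A ++ μ' ++ B).length := by rwa [hlen]
      simp only [diagram, dif_neg hr, dif_neg hr']

/-! ### Braid moves and the exponent vectors -/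

/-- The word `A s_i s_j s_i B`. -/
abbrev braidWord (A B : List (Fin n)) (i j : Fin n) : List (Fin n) := A ++ [i, j, i] ++ B

/-- The columns `i` and `j` are adjacent. -/
def Adjacent (i j : Fin n) : Prop := (i : ℕ) + 1 = j ∨ (j : ℕ) + 1 = i

theorem Adjacent.symm {i j : Fin n} (h : Adjacent i j) : Adjacent j i := Or.symm h

/-- The strings that cross in the middle part of a braid word, from left to right. -/
def tripleStrings (A : List (Fin n)) {i j : Fin n} (h : Adjacent i j) (u : Fin 3) : Fin (n + 1) :=
  wordProd A ⟨min (i : ℕ) j + u, by have := i.2; have := j.2; rcases h with h | h <;> omega⟩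

theorem left_triple (A B : List (Fin n)) {i j : Fin n} (h : Adjacent i j) (k : Fin n) (t : ℕ)
    {r : ℕ} (hr : r < 3) : (diagram (braidWord A B i j) k).left (A.length + r) =
      tripleStrings A h ((OrientedDiagram.tripleDiagram (decide ((i : ℕ) + 1 = j)) t).left r) := by
  rw [diagram_left_middle A B [i, j, i] k (by simpa using hr)]
  unfold tripleStrings
  congr 1
  rcases h with h | h
  · have : decide ((i : ℕ) + 1 = j) = true := by simp [h]
    simp only [this, Fin.ext_iff]
    interval_cases r <;>
      simp [wordProd, OrientedDiagram.tripleDiagram, simpleRefl_apply_val] <;> grind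
  · have : decide ((i : ℕ) + 1 = j) = false := by simp; omega
    simp only [this, Fin.ext_iff]
    interval_cases r <;>
      simp [wordProd, OrientedDiagram.tripleDiagram, simpleRefl_apply_val] <;> grind

theorem right_triple (A B : List (Fin n)) {i j : Fin n} (h : Adjacent i j) (k : Fin n) (t : ℕ)
    {r : ℕ} (hr : r < 3) : (diagram (braidWord A B i j) k).right (A.length + r) =
      tripleStrings A h ((OrientedDiagram.tripleDiagram (decide ((i : ℕ) + 1 = j)) t).right r) := by
  rw [diagram_right_middle A B [i, j, i] k (by simpa using hr)]
  unfold tripleStrings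
  congr 1
  rcases h with h | h
  · have : decide ((i : ℕ) + 1 = j) = true := by simp [h]
    simp only [this, Fin.ext_iff]
    interval_cases r <;>
      simp [wordProd, OrientedDiagram.tripleDiagram, simpleRefl_apply_val] <;> grind
  · have : decide ((i : ℕ) + 1 = j) = false := by simp; omega
    simp only [this, Fin.ext_iff]
    interval_cases r <;>
      simp [wordProd, OrientedDiagram.tripleDiagram, simpleRefl_apply_val] <;> grind

theorem isRegion_triple (A B : List (Fin n)) {i j : Fin n} (h : Adjacent i j) (k : Fin n) {t : ℕ}
    (ht : ∀ u, IsUp k (tripleStrings A h u) ↔ u.val < t) :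
    (diagram (braidWord A B i j) k).IsRegion
      (OrientedDiagram.tripleDiagram (decide ((i : ℕ) + 1 = j)) t) A.length
      (tripleStrings A h) where
  injective u v huv := by
    have := (wordProd A).injective huv
    simp only [Fin.mk.injEq] at this
    omega
  left_eq r hr := left_triple A B h k t hr
  right_eq r hr := right_triple A B h k t hr
  up_eq u := by
    have := ht u
    simp [diagram, OrientedDiagram.tripleDiagram, this]
  depth_le := by
    simp only [diagram, OrientedDiagram.tripleDiagram, braidWord, List.length_append,
      List.length_cons, List.length_nil]
    omega

end Words

/-! ### The exponent vectors on the two sides of a braid move -/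

section Words

variable {n : ℕ}

/-- The function `M` with the values at `a`, `a + 1` and `a + 2` replaced by `x`, `y` and `z`. -/
def patch (a : ℕ) (M : ℕ → ℤ) (x y z : ℤ) : ℕ → ℤ := fun r =>
  if r = a then x else if r = a + 1 then y else if r = a + 2 then z else M r

theorem patch_zero (a : ℕ) (M : ℕ → ℤ) (x y z : ℤ) : patch a M x y z a = x := by simp [patch]

theorem patch_one (a : ℕ) (M : ℕ → ℤ) (x y z : ℤ) : patch a M x y z (a + 1) = y := by simp [patch]

theorem patch_two (a : ℕ) (M : ℕ → ℤ) (x y z : ℤ) : patch a M x y z (a + 2) = z := by simp [patch]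

theorem patch_other {a r : ℕ} (h : ¬ (a ≤ r ∧ r < a + 3)) (M : ℕ → ℤ) (x y z : ℤ) :
    patch a M x y z r = M r := by
  unfold patch
  rw [if_neg (by omega), if_neg (by omega), if_neg (by omega)]

theorem patch_patch (a : ℕ) (M : ℕ → ℤ) (x y z x' y' z' : ℤ) :
    patch a (patch a M x y z) x' y' z' = patch a M x' y' z' := by
  funext r
  unfold patch
  split_ifs <;> rfl

theorem patch_eq_self {a : ℕ} {M : ℕ → ℤ} {x y z : ℤ} (hx : x = M a) (hy : y = M (a + 1))
    (hz : z = M (a + 2)) : patch a M x y z = M := by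
  funext r
  unfold patch
  split_ifs with h1 h2 h3
  · rw [h1, hx]
  · rw [h2, hy]
  · rw [h3, hz]
  · rfl

theorem wordProd_braid {i j : Fin n} (h : Adjacent i j) :
    wordProd [j, i, j] = wordProd [i, j, i] := by
  have := (WordMove.braid [] [] i j h).wordProd_eq
  simpa using this.symm

theorem tripleStrings_symm (A : List (Fin n)) {i j : Fin n} (h : Adjacent i j) :
    tripleStrings A h.symm = tripleStrings A h := by
  funext u
  unfold tripleStrings
  congr 2
  rw [min_comm]

theorem tripleDiagram_lt (b : Bool) (t : ℕ) : ∀ r < (OrientedDiagram.tripleDiagram b t).depth,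
    (OrientedDiagram.tripleDiagram b t).left r < (OrientedDiagram.tripleDiagram b t).right r := by
  intro r hr
  have hr' : r < 3 := hr
  interval_cases r <;> cases b <;> simp [OrientedDiagram.tripleDiagram]

theorem decide_adjacent_symm {i j : Fin n} (h : Adjacent i j) :
    decide ((j : ℕ) + 1 = i) = !decide ((i : ℕ) + 1 = j) := by
  rcases h with h | h
  · have h' : ¬ (j : ℕ) + 1 = i := by omega
    simp [h, h']
  · have h' : ¬ (i : ℕ) + 1 = j := by omega
    simp [h, h']

/-- The numbers of the strings of a triple increase from left to right. -/
theorem tripleStrings_strictMono {A B : List (Fin n)} {i j : Fin n} (h : Adjacent i j)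
    (hw : IsAscending (braidWord A B i j)) : StrictMono (tripleStrings A h) := by
  have key : ∀ r < 3,
      tripleStrings A h ((OrientedDiagram.tripleDiagram (decide ((i : ℕ) + 1 = j)) 0).left r) <
      tripleStrings A h ((OrientedDiagram.tripleDiagram (decide ((i : ℕ) + 1 = j)) 0).right r) := by
    intro r hr
    rw [← left_triple A B h i 0 hr, ← right_triple A B h i 0 hr]
    refine hw.lt i _ ?_
    simp only [diagram, braidWord, List.length_append, List.length_cons, List.length_nil]
    omega
  have h0 := key 0 (by omega)
  have h2 := key 2 (by omega)
  rw [Fin.strictMono_iff_lt_succ]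
  clear key
  revert h0 h2
  cases decide ((i : ℕ) + 1 = j) <;>
    · intro h0 h2 u
      fin_cases u
      · first | exact h0 | exact h2
      · first | exact h0 | exact h2

theorem exists_threshold {f : Fin 3 → Fin (n + 1)} (hf : StrictMono f) (k : Fin n) :
    ∃ t < 4, ∀ u, IsUp k (f u) ↔ u.val < t := by
  have h01 : f 0 < f 1 := hf (by decide)
  have h12 : f 1 < f 2 := hf (by decide)
  simp only [IsUp]
  by_cases h2 : f 2 ≤ k.castSucc
  · refine ⟨3, by omega, fun u => ?_⟩
    have := hf.monotone (Fin.le_last u : u ≤ 2)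
    exact ⟨fun _ => u.2, fun _ => this.trans h2⟩
  by_cases h1 : f 1 ≤ k.castSucc
  · refine ⟨2, by omega, fun u => ?_⟩
    fin_cases u
    · simpa using h01.le.trans h1
    · simpa using h1
    · simpa using h2
  by_cases h0 : f 0 ≤ k.castSucc
  · refine ⟨1, by omega, fun u => ?_⟩
    fin_cases u
    · simpa using h0
    · simpa using h1
    · simpa using h2
  · refine ⟨0, by omega, fun u => ?_⟩
    fin_cases u
    · simpa using h0
    · simpa using h1
    · simpa using h2

theorem position_tripleStrings_top (A B : List (Fin n)) {i j : Fin n} (h : Adjacent i j)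
    (u : Fin 3) :
    position (braidWord A B i j) A.length (tripleStrings A h u) = min (i : ℕ) j + u := by
  have := wordProd_take_middle A B [i, j, i] (r := 0) (by simp)
  rw [add_zero, List.take_zero, show wordProd ([] : List (Fin n)) = 1 from rfl, mul_one] at this
  rw [tripleStrings, ← this, position_wordProd]

theorem position_tripleStrings_bot (A B : List (Fin n)) {i j : Fin n} (h : Adjacent i j)
    (u : Fin 3) : position (braidWord A B i j) (A.length + 3) (tripleStrings A h u) + u =
      min (i : ℕ) j + 2 := by
  have h1 := wordProd_take_middle A B [i, j, i] (r := 3) (by simp)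
  rw [show [i, j, i].take 3 = [i, j, i] from rfl] at h1
  have h2 : tripleStrings A h u = wordProd ((A ++ [i, j, i] ++ B).take (A.length + 3))
      ⟨min (i : ℕ) j + (2 - u), by have := i.2; have := j.2; rcases h with h | h <;> omega⟩ := by
    rw [h1, tripleStrings, Equiv.Perm.mul_apply]
    congr 1
    simp only [wordProd, List.map_cons, List.map_nil, List.prod_cons, List.prod_nil, mul_one,
      Equiv.Perm.mul_apply, Fin.ext_iff, simpleRefl_apply_val]
    rcases h with h | h
    · rw [min_eq_left (by omega)]
      fin_cases u <;> simp <;> grind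
    · rw [min_eq_right (by omega)]
      fin_cases u <;> simp <;> grind
  rw [h2, position_wordProd]
  simp only
  omega

/-- The effect of a braid move on the exponent vectors: the exponents of the triple of crossings
satisfy `tripleAdmissible` and may be replaced by those listed in `tripleTargets`. -/
theorem braid_transfer {A B : List (Fin n)} {i j : Fin n} (h : Adjacent i j)
    (hw : IsAscending (braidWord A B i j)) (hw' : IsAscending (braidWord A B j i))
    {M : ℕ → ℤ} (hM : M ∈ pathVectors (braidWord A B i j)) :
    OrientedDiagram.tripleAdmissible [M A.length, M (A.length + 1), M (A.length + 2)] = true ∧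
      ∀ b x y z, (b, [x, y, z]) ∈ OrientedDiagram.tripleTargets
          [M A.length, M (A.length + 1), M (A.length + 2)] →
        patch A.length M x y z ∈
          pathVectors (if b then braidWord A B j i else braidWord A B i j) := by
  obtain ⟨k, p, hp, hs, rfl⟩ := hM
  have hmono := tripleStrings_strictMono h hw
  obtain ⟨t, ht4, ht⟩ := exists_threshold hmono k
  have hlen : (braidWord A B j i).length = (braidWord A B i j).length := by simp [braidWord]
  have hR := isRegion_triple A B h k ht
  have hR' := isRegion_triple A B h.symm k (t := t) (by rwa [tripleStrings_symm A h])
  rw [tripleStrings_symm A h, decide_adjacent_symm h] at hR'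
  have hag : (diagram (braidWord A B i j) k).AgreeOutside (diagram (braidWord A B j i) k) A.length
      (A.length + 3) := agreeOutside_diagram (μ := [i, j, i]) (μ' := [j, i, j]) rfl (wordProd_braid h) k
  have hdepth : (diagram (braidWord A B j i) k).depth = (diagram (braidWord A B i j) k).depth :=
    hlen
  obtain ⟨h1, h2⟩ := (OrientedDiagram.runsMatch_triple (decide ((i : ℕ) + 1 = j)) t ht4).transfer
    hR hR' rfl hag (tripleDiagram_lt _ _) (hw.lt k)
    (tripleDiagram_lt (!decide ((i : ℕ) + 1 = j)) t)
    (hdepth ▸ hw'.lt k) rfl rfl hp hs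
    (v := [exponentAt p A.length, exponentAt p (A.length + 1), exponentAt p (A.length + 2)])
    (by
      intro u v huv m hm hc
      have hadj := of_decide_eq_true huv
      have hup : (diagram (braidWord A B i j) k).up (tripleStrings A h u) =
          (diagram (braidWord A B i j) k).up (tripleStrings A h v) := by
        simp only [diagram, ht u, ht v, hadj.2]
      have hpos := isPosition_position (braidWord A B i j) k
      rcases List.mem_pair.1 hm with rfl | rfl
      · refine OrientedDiagram.not_crosses_adjacent hpos (hw.lt k) hp hs rfl rfl ?_ hup hc.1 hc.2
        rw [add_zero, position_tripleStrings_top, position_tripleStrings_top, hadj.1]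
        rfl
      · refine OrientedDiagram.not_crosses_adjacent hpos (hw.lt k) hp hs rfl rfl ?_ hup.symm
          hc.2 hc.1
        have e1 := position_tripleStrings_bot A B h u
        have e2 := position_tripleStrings_bot A B h v
        have := hadj.1
        change position _ (A.length + 3) _ = position _ (A.length + 3) _ + 1
        omega)
    rfl
  refine ⟨h1, fun b x y z hmem => ?_⟩
  obtain ⟨p', h3, h4, h5⟩ := h2 _ hmem
  have h6 : patch A.length (exponentAt p) x y z = exponentAt p' := by
    funext r
    rw [h5]
    change _ = if A.length ≤ r ∧ r < A.length + 3 then [x, y, z].getD (r - A.length) 0 else _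
    by_cases hr : A.length ≤ r ∧ r < A.length + 3
    · rw [if_pos hr]
      obtain ⟨r', rfl⟩ : ∃ r', r = A.length + r' := ⟨r - A.length, by omega⟩
      have hr' : r' < 3 := by omega
      interval_cases r' <;> simp [patch]
    · rw [if_neg hr, patch_other hr]
  rw [h6]
  cases b
  · exact ⟨k, p', h3, h4, rfl⟩
  · refine ⟨k, p', ?_, h4, rfl⟩
    simp only [if_true] at h3 ⊢
    rw [hlen]
    exact h3

/-! ### Commutation moves and the exponent vectors -/

/-- The columns `i` and `j` are distinct and not adjacent. -/
def Distant (i j : Fin n) : Prop := (i : ℕ) + 1 < j ∨ (j : ℕ) + 1 < i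

theorem Distant.symm {i j : Fin n} (h : Distant i j) : Distant j i := Or.symm h

/-- The word `A s_i s_j B`. -/
abbrev pairWord (A B : List (Fin n)) (i j : Fin n) : List (Fin n) := A ++ [i, j] ++ B

theorem wordProd_pair {i j : Fin n} (h : Distant i j) : wordProd [j, i] = wordProd [i, j] := by
  have := (WordMove.commute [] [] i j h).wordProd_eq
  simpa using this.symm

/-- The strings that stand at the positions `i`, `i + 1`, `j`, `j + 1` below the word `A`. -/
def pairStrings (A : List (Fin n)) (i j : Fin n) (u : Fin 4) : Fin (n + 1) :=
  wordProd A (match u with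
    | 0 => i.castSucc
    | 1 => i.succ
    | 2 => j.castSucc
    | 3 => j.succ)

theorem simpleRefl_distant {i j : Fin n} (h : Distant i j) :
    simpleRefl i j.castSucc = j.castSucc ∧ simpleRefl i j.succ = j.succ := by
  constructor <;>
  · refine Equiv.swap_apply_of_ne_of_ne ?_ ?_ <;>
    · intro e
      have := congrArg Fin.val e
      simp at this
      rcases h with h | h <;> omega

theorem isRegion_pair (A B : List (Fin n)) {i j : Fin n} (h : Distant i j) (k : Fin n) {t₁ t₂ : ℕ}
    (h0 : IsUp k (pairStrings A i j 0) ↔ 0 < t₁) (h1 : IsUp k (pairStrings A i j 1) ↔ 1 < t₁)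
    (h2 : IsUp k (pairStrings A i j 2) ↔ 0 < t₂) (h3 : IsUp k (pairStrings A i j 3) ↔ 1 < t₂) :
    (diagram (pairWord A B i j) k).IsRegion (OrientedDiagram.pairsDiagram true t₁ t₂) A.length
      (pairStrings A i j) ∧
    (diagram (pairWord A B j i) k).IsRegion (OrientedDiagram.pairsDiagram false t₁ t₂) A.length
      (pairStrings A i j) := by
  have inj : Function.Injective (pairStrings A i j) := by
    intro u v huv
    have := congrArg Fin.val ((wordProd A).injective huv)
    fin_cases u <;> fin_cases v <;> simp at this ⊢ <;> rcases h with h | h <;> omega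
  have up : ∀ u, decide (IsUp k (pairStrings A i j u)) =
      (OrientedDiagram.pairsDiagram true t₁ t₂).up u := by
    intro u
    fin_cases u <;> simp_all [OrientedDiagram.pairsDiagram] <;> omega
  constructor
  · refine ⟨inj, fun r hr => ?_, fun r hr => ?_, up, ?_⟩
    · have hr' : r < 2 := hr
      rw [diagram_left_middle A B [i, j] k (by simpa using hr')]
      interval_cases r
      · simp [wordProd, OrientedDiagram.pairsDiagram, pairStrings]
      · simp [wordProd, OrientedDiagram.pairsDiagram, pairStrings, simpleRefl_distant h]
    · have hr' : r < 2 := hr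
      rw [diagram_right_middle A B [i, j] k (by simpa using hr')]
      interval_cases r
      · simp [wordProd, OrientedDiagram.pairsDiagram, pairStrings]
      · simp [wordProd, OrientedDiagram.pairsDiagram, pairStrings, simpleRefl_distant h]
    · simp only [diagram, OrientedDiagram.pairsDiagram, pairWord, List.length_append,
        List.length_cons, List.length_nil]
      omega
  · refine ⟨inj, fun r hr => ?_, fun r hr => ?_, up, ?_⟩
    · have hr' : r < 2 := hr
      rw [diagram_left_middle A B [j, i] k (by simpa using hr')]
      interval_cases r
      · simp [wordProd, OrientedDiagram.pairsDiagram, pairStrings]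
      · simp [wordProd, OrientedDiagram.pairsDiagram, pairStrings, simpleRefl_distant h.symm]
    · have hr' : r < 2 := hr
      rw [diagram_right_middle A B [j, i] k (by simpa using hr')]
      interval_cases r
      · simp [wordProd, OrientedDiagram.pairsDiagram, pairStrings]
      · simp [wordProd, OrientedDiagram.pairsDiagram, pairStrings, simpleRefl_distant h.symm]
    · simp only [diagram, OrientedDiagram.pairsDiagram, pairWord, List.length_append,
        List.length_cons, List.length_nil]
      omega

theorem exists_threshold_pair {u v : Fin (n + 1)} (huv : u < v) (k : Fin n) :
    ∃ t < 3, (IsUp k u ↔ 0 < t) ∧ (IsUp k v ↔ 1 < t) := by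
  unfold IsUp
  by_cases hv : v ≤ k.castSucc
  · exact ⟨2, by omega, by simpa using huv.le.trans hv, by simpa using hv⟩
  by_cases hu : u ≤ k.castSucc
  · exact ⟨1, by omega, by simpa using hu, by simpa using hv⟩
  · exact ⟨0, by omega, by simpa using hu, by simpa using hv⟩

theorem pairsDiagram_lt (b : Bool) (t₁ t₂ : ℕ) :
    ∀ r < (OrientedDiagram.pairsDiagram b t₁ t₂).depth,
      (OrientedDiagram.pairsDiagram b t₁ t₂).left r <
        (OrientedDiagram.pairsDiagram b t₁ t₂).right r := by
  intro r hr
  have hr' : r < 2 := hr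
  interval_cases r <;> cases b <;> simp [OrientedDiagram.pairsDiagram]

theorem commute_transfer {A B : List (Fin n)} {i j : Fin n} (h : Distant i j)
    (hw : IsAscending (pairWord A B i j)) (hw' : IsAscending (pairWord A B j i))
    {M : ℕ → ℤ} (hM : M ∈ pathVectors (pairWord A B i j)) :
    M ∘ Equiv.swap A.length (A.length + 1) ∈ pathVectors (pairWord A B j i) := by
  obtain ⟨k, p, hp, hs, rfl⟩ := hM
  have hlen : (pairWord A B j i).length = (pairWord A B i j).length := by simp [pairWord]
  have hrow : ∀ r < 2, A.length + r < (pairWord A B i j).length := by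
    intro r hr
    simp only [pairWord, List.length_append, List.length_cons, List.length_nil]
    omega
  have hlt0 : pairStrings A i j 0 < pairStrings A i j 1 := by
    have := hw.lt k _ (hrow 0 (by omega))
    rw [diagram_left_middle A B [i, j] k (by simp),
      diagram_right_middle A B [i, j] k (by simp)] at this
    simpa [wordProd, pairStrings] using this
  have hlt1 : pairStrings A i j 2 < pairStrings A i j 3 := by
    have := hw.lt k _ (hrow 1 (by omega))
    rw [diagram_left_middle A B [i, j] k (by simp),
      diagram_right_middle A B [i, j] k (by simp)] at this
    simpa [wordProd, pairStrings, simpleRefl_distant h] using this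
  obtain ⟨t₁, ht₁, h0, h1⟩ := exists_threshold_pair hlt0 k
  obtain ⟨t₂, ht₂, h2, h3⟩ := exists_threshold_pair hlt1 k
  obtain ⟨hR, hR'⟩ := isRegion_pair A B h k h0 h1 h2 h3
  have hag : (diagram (pairWord A B i j) k).AgreeOutside (diagram (pairWord A B j i) k) A.length
      (A.length + 2) := agreeOutside_diagram (μ := [i, j]) (μ' := [j, i]) rfl (wordProd_pair h) k
  have hdepth : (diagram (pairWord A B j i) k).depth = (diagram (pairWord A B i j) k).depth :=
    hlen
  obtain ⟨-, h5⟩ := (OrientedDiagram.runsMatch_pairs true t₁ t₂ ht₁ ht₂).transfer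
    hR hR' rfl hag (pairsDiagram_lt _ _ _) (hw.lt k) (pairsDiagram_lt false t₁ t₂)
    (hdepth ▸ hw'.lt k) rfl rfl hp hs
    (v := [exponentAt p A.length, exponentAt p (A.length + 1)]) (by simp) rfl
  obtain ⟨p', h6, h7, h8⟩ := h5 _ (List.mem_singleton_self _)
  refine ⟨k, p', ?_, h7, ?_⟩
  · rw [hlen]
    exact h6
  · funext r
    rw [h8]
    change exponentAt p (Equiv.swap _ _ r) =
      if A.length ≤ r ∧ r < A.length + 2 then _ else _
    by_cases hr : A.length ≤ r ∧ r < A.length + 2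
    · rw [if_pos hr]
      obtain rfl | rfl : r = A.length ∨ r = A.length + 1 := by omega
      · simp
      · simp
    · rw [if_neg hr, Equiv.swap_apply_of_ne_of_ne] <;> omega

end Words

/-! ### Boxes and circulations -/

namespace OrientedDiagram

variable {σ : Type} [LinearOrder σ] {D : OrientedDiagram σ}

/-- A path that does not switch at a crossing of two strings with the same orientation does not
run along the string whose straight passage is forbidden there. -/
theorem flux_eq_zero_of_exponentAt {x y : σ × ℕ} {p : List (Step σ)} (hp : D.IsPath x y p)
    (hs : D.IsSimple p) {r : ℕ} (hr : D.left r < D.right r)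
    (h : exponentAt p r = 0) (hup : D.up (D.left r) = D.up (D.right r)) :
    D.flux p (r + 1) (if D.up (D.left r) then D.left r else D.right r) = 0 := by
  have straight : ∀ s ∈ p, s.row = r → D.Meets r s.src → s.dst = s.src := by
    rintro s hs' rfl hm
    have h1 := exponentAt_eq_sign hp.isAllowed hs hs' hm
    rw [h, Step.sign] at h1
    rcases lt_trichotomy s.src s.dst with h2 | h2 | h2
    · simp [h2] at h1
    · exact h2.symm
    · simp [h2, h2.not_gt] at h1
  unfold flux
  apply List.sum_eq_zero
  intro c hc
  obtain ⟨s, hs', rfl⟩ := List.mem_map.1 hc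
  have hal := hp.isAllowed s hs'
  cases hu : D.up (D.left r)
  · have hu' := hup.symm.trans hu
    simp only [Bool.false_eq_true, if_false, belowTerm, hu', and_false, zero_sub, and_true,
      neg_eq_zero, ite_eq_right_iff, one_ne_zero, imp_false]
    rintro ⟨e1, e2⟩
    obtain rfl : s.row = r := by omega
    have hm : D.Meets s.row s.src := by
      rcases hal.2.1 with h1 | h1
      · rw [← h1, e2]
        exact Or.inr rfl
      · exact h1.1
    have h1 := straight s hs' rfl hm
    exact hal.2.2 ⟨h1, Or.inr ⟨h1 ▸ e2, by rw [← h1, e2, hu']; simp, by rw [hu]; simp⟩⟩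
  · have hu' := hup.symm.trans hu
    simp only [if_true, belowTerm, hu, and_true, reduceCtorEq, and_false, if_false, sub_zero,
      ite_eq_right_iff, one_ne_zero, imp_false]
    rintro ⟨e1, e2⟩
    obtain rfl : s.row = r := by omega
    have h1 := straight s hs' rfl (Or.inl e2)
    exact hal.2.2 ⟨h1, Or.inl ⟨e2, by rw [e2, hu], hu'⟩⟩

end OrientedDiagram

section Words

variable {n : ℕ}

/-- The column of the crossing `r`, or `0` if there is no such crossing. -/
def columnAt (w : List (Fin n)) (r : ℕ) : ℕ := if h : r < w.length then (w[r] : ℕ) else 0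

theorem columnAt_eq {w : List (Fin n)} {r : ℕ} (h : r < w.length) : columnAt w r = w[r] :=
  dif_pos h

/-- The coefficient of a crossing in column `d` in the `λ`-inequality of an earlier crossing in
column `c`. -/
def columnPairing (c d : ℕ) : ℤ := if d = c then 2 else if d + 1 = c ∨ c + 1 = d then -1 else 0

theorem columnPairing_self (c : ℕ) : columnPairing c c = 2 := by simp [columnPairing]

/-- The exponent vector of the `λ`-inequality of the crossing `t`, extended by zero. -/
def lambdaVector (w : List (Fin n)) (t r : ℕ) : ℤ :=
  if r = t then 1 else
    if t < r ∧ r < w.length then columnPairing (columnAt w t) (columnAt w r) else 0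

theorem extendZero_lambdaExponent (w : List (Fin n)) (t : Fin w.length) :
    extendZero (lambdaExponent w t) = lambdaVector w t := by
  funext r
  by_cases hr : r < w.length
  · have := extendZero_val (lambdaExponent w t) ⟨r, hr⟩
    simp only at this
    rw [this]
    simp only [lambdaExponent, lambdaVector, columnPairing, columnAt_eq hr, columnAt_eq t.2,
      Fin.ext_iff, Fin.lt_def, hr, and_true, column, List.get_eq_getElem]
    split_ifs <;> first | rfl | simp_all
  · have h1 : r ≠ t := by have := t.2; omega
    rw [lambdaVector, if_neg h1, if_neg (by omega)]
    simp [extendZero, hr]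

/-- The crossings `t` and `b` are the upper and lower vertex of a box. -/
structure IsBoxAt (w : List (Fin n)) (t b : ℕ) : Prop where
  lt : t < b
  lt_length : b < w.length
  column_eq : columnAt w t = columnAt w b
  column_ne : ∀ r, t < r → r < b → columnAt w r ≠ columnAt w t

/-- The box condition for exponent vectors that are extended by zero. -/
structure BoxPair (w : List (Fin n)) (t b : ℕ) (M₁ M₂ : ℕ → ℤ) : Prop where
  isBox : IsBoxAt w t b
  add_eq : ∀ r, M₁ r + lambdaVector w t r = M₂ r + lambdaVector w b r
  top_eq : M₁ t = -1
  bot_eq : M₂ b = 1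

theorem boxCondition_iff {w : List (Fin n)} {t b : Fin w.length} {p₁ p₂ : stringExponents w} :
    BoxCondition w t b p₁ p₂ ↔ BoxPair w t b (extendZero p₁.1) (extendZero p₂.1) := by
  have hbox : IsBox w t b ↔ IsBoxAt w t b := by
    constructor
    · rintro ⟨h1, h2, h3⟩
      refine ⟨h1, b.2, ?_, fun r h4 h5 => ?_⟩
      · rw [columnAt_eq t.2, columnAt_eq b.2]
        exact congrArg Fin.val h2
      · have hr : r < w.length := h5.trans b.2
        rw [columnAt_eq hr, columnAt_eq t.2]
        intro e
        exact h3 ⟨r, hr⟩ h4 h5 (Fin.ext e)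
    · rintro ⟨h1, -, h2, h3⟩
      rw [columnAt_eq t.2, columnAt_eq b.2] at h2
      refine ⟨h1, Fin.ext h2, fun r h4 h5 e => h3 r h4 h5 ?_⟩
      rw [columnAt_eq r.2, columnAt_eq t.2]
      exact congrArg Fin.val e
  have hadd : p₁.1 + lambdaExponent w t = p₂.1 + lambdaExponent w b ↔
      ∀ r, extendZero p₁.1 r + lambdaVector w t r = extendZero p₂.1 r + lambdaVector w b r := by
    simp only [← extendZero_lambdaExponent]
    constructor
    · intro h r
      by_cases hr : r < w.length
      · simpa [extendZero, hr] using congrFun h ⟨r, hr⟩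
      · simp [extendZero, hr]
    · intro h
      funext r
      simpa [extendZero_val] using h r
  constructor
  · rintro ⟨h1, h2, h3, h4⟩
    exact ⟨hbox.1 h1, hadd.1 h2, by rwa [extendZero_val], by rwa [extendZero_val]⟩
  · rintro ⟨h1, h2, h3, h4⟩
    rw [extendZero_val] at h3 h4
    exact ⟨hbox.2 h1, hadd.2 h2, h3, h4⟩

theorem position_left {w : List (Fin n)} (k : Fin n) {r : ℕ} (hr : r < w.length) :
    position w r ((diagram w k).left r) = columnAt w r ∧
    position w r ((diagram w k).right r) = columnAt w r + 1 := by
  rw [diagram_left hr, diagram_right hr, position_wordProd, position_wordProd, columnAt_eq hr]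
  simp

theorem diagram_left_eq (w : List (Fin n)) (k k' : Fin n) :
    (diagram w k).left = (diagram w k').left := rfl

theorem diagram_right_eq (w : List (Fin n)) (k k' : Fin n) :
    (diagram w k).right = (diagram w k').right := rfl

/-- The difference of the fluxes of two paths that are related by a box circulates around the
box. -/
theorem BoxPair.flux_sub {w : List (Fin n)} (hw : IsAscending w) {t b : ℕ} {k₁ k₂ : Fin n}
    {p₁ p₂ : List (Step (Fin (n + 1)))}
    (hb : BoxPair w t b (exponentAt p₁) (exponentAt p₂))
    (hp₁ : (diagram w k₁).IsPath (k₁.castSucc, w.length) (k₁.succ, w.length) p₁)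
    (hp₂ : (diagram w k₂).IsPath (k₂.castSucc, w.length) (k₂.succ, w.length) p₂)
    (m : ℕ) (hm : m ≤ w.length) (u : Fin (n + 1)) :
    (diagram w k₂).flux p₂ m u - (diagram w k₁).flux p₁ m u =
      if t < m ∧ m ≤ b then (if position w m u = columnAt w t then 1 else 0) -
        (if position w m u = columnAt w t + 1 then 1 else 0) else 0 := by
  obtain ⟨⟨htb, hbN, hcol, hne⟩, hadd, -, -⟩ := hb
  -- Both sides vanish at the top level. At every crossing the exponents of the two paths differ by
  -- the difference of the two `λ`-vectors, which is the change of the circulation on the right.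
  induction m generalizing u with
  | zero => simp [OrientedDiagram.flux_zero]
  | succ r ih =>
    have hr : r < w.length := hm
    have ih := ih hr.le u
    have hlt₁ := hw.lt k₁ r hr
    have hlt₂ := hw.lt k₂ r hr
    rw [OrientedDiagram.flux_sub_eq hp₁ rfl rfl hr hlt₁,
      OrientedDiagram.flux_sub_eq hp₂ rfl rfl hr hlt₂,
      diagram_left_eq w k₂ k₁, diagram_right_eq w k₂ k₁]
    have hP := isPosition_position w k₁
    obtain ⟨hL, hR⟩ := position_left k₁ hr
    have hL' := hP.succ_left r hr
    have hR' := hP.succ_right r hr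
    rw [hR] at hL'
    rw [hL] at hR'
    have hadd := hadd r
    have hle := hne r
    have hMeets : (diagram w k₁).Meets r u ∨ ¬ (diagram w k₁).Meets r u := em _
    have hlne := hlt₁.ne
    rcases hMeets with hu | hu
    · have hcoef : exponentAt p₂ r - exponentAt p₁ r = lambdaVector w t r - lambdaVector w b r := by
        linarith
      have hlam : lambdaVector w t r - lambdaVector w b r =
          if r = t then 1 else if t < r ∧ r < b then
            (if columnAt w r + 1 = columnAt w t ∨ columnAt w t + 1 = columnAt w r then -1 else 0)
          else if r = b then 1 else 0 := by
        unfold lambdaVector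
        rcases lt_trichotomy r t with h1 | rfl | h1
        · have : r < b := h1.trans htb
          simp [h1.ne, this.ne, h1.not_gt, this.not_gt]
        · simp [htb.ne, htb.not_gt]
        · rcases lt_trichotomy r b with h2 | rfl | h2
          · simp [h1.ne', h1, h2.ne, h2.not_gt, h2, hr, columnPairing, hle h1 h2]
          · simp [h1.ne', h1, hr, ← hcol, columnPairing]
          · simp [h1.ne', h1, h2.ne', h2, hr, hcol, h2.not_gt]
      rcases hu with rfl | rfl
      · rw [if_pos rfl, if_neg hlne, hL']
        rw [hL] at ih
        have : ∀ x y e f : ℤ, (x - e * (1 - 0)) - (y - f * (1 - 0)) = (x - y) - (e - f) := by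
          intros; ring
        rw [this, ih, hcoef, hlam]
        rcases lt_trichotomy r t with h1 | rfl | h1
        · have : r < b := h1.trans htb
          simp [h1.ne, h1.not_gt, this.ne, Nat.not_lt.2 h1]
        · simp [show r + 1 ≤ b by omega]
        · rcases lt_trichotomy r b with h2 | rfl | h2
          · have := hle h1 h2
            simp only [h1.ne', if_false, h1, h2, and_self, if_true, h2.le,
              show t < r + 1 by omega, show r + 1 ≤ b by omega]
            split_ifs <;> first | rfl | omega
          · simp [h1.ne', h1, ← hcol]
          · simp [h1.ne', h2.ne', show ¬ (r < b) by omega, show ¬ (r ≤ b) by omega,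
              show ¬ (r + 1 ≤ b) by omega]
      · rw [if_pos rfl, if_neg hlne.symm, hR']
        rw [hR] at ih
        have : ∀ x y e f : ℤ, (x - e * (0 - 1)) - (y - f * (0 - 1)) = (x - y) + (e - f) := by
          intros; ring
        rw [this, ih, hcoef, hlam]
        rcases lt_trichotomy r t with h1 | rfl | h1
        · have : r < b := h1.trans htb
          simp [h1.ne, h1.not_gt, this.ne, Nat.not_lt.2 h1]
        · simp [show r + 1 ≤ b by omega]
        · rcases lt_trichotomy r b with h2 | rfl | h2
          · have := hle h1 h2
            simp only [h1.ne', if_false, h1, h2, and_self, if_true, h2.le,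
              show t < r + 1 by omega, show r + 1 ≤ b by omega]
            split_ifs <;> first | rfl | omega
          · simp [h1.ne', h1, ← hcol]
          · simp [h1.ne', h2.ne', show ¬ (r < b) by omega, show ¬ (r ≤ b) by omega,
              show ¬ (r + 1 ≤ b) by omega]
    · -- a string that does not meet the crossing keeps its position and its flux
      have h1 := hP.succ_other r hr u hu
      have h2 : u ≠ (diagram w k₁).left r := fun e => hu (Or.inl e)
      have h3 : u ≠ (diagram w k₁).right r := fun e => hu (Or.inr e)
      have h4 : position w r u ≠ columnAt w r := fun e => h2 (hP.injective r (e.trans hL.symm))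
      have h5 : position w r u ≠ columnAt w r + 1 := fun e => h3 (hP.injective r (e.trans hR.symm))
      rw [if_neg h2, if_neg h3, h1, sub_self, mul_zero, mul_zero, sub_zero, sub_zero, ih]
      by_cases e1 : r = t
      · subst e1
        simp [h4, h5]
      by_cases e2 : r = b
      · subst e2
        rw [hcol]
        simp [h4, h5]
      · exact if_congr (by omega) rfl rfl

/-- Two paths that are related by a box belong to the same orientation of the strings: they have the
same flux through the lowest level, where the flux determines the ends of a path. -/
theorem BoxPair.eq_threshold {w : List (Fin n)} (hw : IsAscending w) {t b : ℕ} {k₁ k₂ : Fin n}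
    {p₁ p₂ : List (Step (Fin (n + 1)))}
    (hb : BoxPair w t b (exponentAt p₁) (exponentAt p₂))
    (hp₁ : (diagram w k₁).IsPath (k₁.castSucc, w.length) (k₁.succ, w.length) p₁)
    (hp₂ : (diagram w k₂).IsPath (k₂.castSucc, w.length) (k₂.succ, w.length) p₂) : k₁ = k₂ := by
  have h := hb.flux_sub hw hp₁ hp₂ w.length le_rfl k₁.castSucc
  have hlt := hb.isBox.lt_length
  rw [if_neg (by omega)] at h
  have h1 := OrientedDiagram.flux_depth hp₁ k₁.castSucc
  have h2 := OrientedDiagram.flux_depth hp₂ k₁.castSucc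
  change (diagram w k₁).flux p₁ w.length _ = _ at h1
  change (diagram w k₂).flux p₂ w.length _ = _ at h2
  rw [h1, h2] at h
  have hd : ∀ k, (diagram w k).depth = w.length := fun _ => rfl
  simp only [hd, Prod.mk.injEq, and_true, Fin.ext_iff, Fin.val_castSucc, Fin.val_succ] at h
  apply Fin.ext
  split_ifs at h <;> simp at h <;> omega

/-- As a chain on the strings, the exponent vector of a path has the boundary that is given by the
ends of the path; in particular it is not a cycle. -/
theorem boundary_eq {w : List (Fin n)} (hw : IsAscending w) {M : ℕ → ℤ} (hM : M ∈ pathVectors w) :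
    ∃ k : Fin n, ∀ u, ∑ r ∈ Finset.range w.length, M r *
      ((if u = (diagram w k).left r then 1 else 0) -
        (if u = (diagram w k).right r then 1 else 0)) =
      (if u = k.succ then 1 else 0) - (if u = k.castSucc then (1 : ℤ) else 0) := by
  obtain ⟨k, p, hp, hs, rfl⟩ := hM
  refine ⟨k, fun u => ?_⟩
  have key : ∀ m ≤ w.length, ∑ r ∈ Finset.range m, exponentAt p r *
      ((if u = (diagram w k).left r then 1 else 0) -
        (if u = (diagram w k).right r then 1 else 0)) = - (diagram w k).flux p m u := by
    intro m
    induction m with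
    | zero => simp [OrientedDiagram.flux_zero]
    | succ r ih =>
      intro hr
      rw [Finset.sum_range_succ, ih (by omega),
        OrientedDiagram.flux_sub_eq hp rfl rfl hr (hw.lt k r hr)]
      ring
  rw [key _ le_rfl]
  have h1 := OrientedDiagram.flux_depth hp u
  change (diagram w k).flux p w.length u = _ at h1
  have hd : (diagram w k).depth = w.length := rfl
  rw [h1]
  simp only [hd, Prod.mk.injEq, and_true, eq_comm (b := u)]
  ring

end Words

/-! ### Boxes around the middle crossings of a braid word -/

section Words

variable {n : ℕ}

theorem isUp_of_le {k : Fin n} {u v : Fin (n + 1)} (h : u ≤ v) (hv : IsUp k v) : IsUp k u :=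
  le_trans h hv

theorem diagram_up (w : List (Fin n)) (k : Fin n) (u : Fin (n + 1)) :
    (diagram w k).up u = decide (IsUp k u) := rfl

/-- A box that surrounds the middle crossings of a braid word from the side of the first column
does not relate a path which switches only at the last of them, apart from the middle one, to a path
which switches only at the first of them. For each orientation of the middle string one of the two
paths has no flux along one of the outer strings at the boundary of the triple, and then the
circulation around the box gives the flux of the other path along this string the wrong sign. -/
theorem BoxPair.not_straddling {A B : List (Fin n)} {i j : Fin n} (h : Adjacent i j)
    (hw : IsAscending (braidWord A B i j)) {t b : ℕ} {M₁ M₂ : ℕ → ℤ}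
    (hM₁ : M₁ ∈ pathVectors (braidWord A B i j)) (hM₂ : M₂ ∈ pathVectors (braidWord A B i j))
    (hb : BoxPair (braidWord A B i j) t b M₁ M₂) (ht : t < A.length) (hlt : A.length + 3 ≤ b)
    (hq : columnAt (braidWord A B i j) t + 1 = i ∨ (i : ℕ) + 1 = columnAt (braidWord A B i j) t)
    (hj : columnAt (braidWord A B i j) t ≠ j) (h₁ : M₁ A.length = 0) (h₂ : M₂ (A.length + 2) = 0) :
    False := by
  obtain ⟨k, p₁, hp₁, hs₁, rfl⟩ := hM₁
  obtain ⟨k₂, p₂, hp₂, hs₂, rfl⟩ := hM₂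
  obtain rfl := hb.eq_threshold hw hp₁ hp₂
  have hbN := hb.isBox.lt_length
  have hmono := tripleStrings_strictMono h hw
  have h01 : tripleStrings A h 0 < tripleStrings A h 1 := hmono (by decide)
  have h12 : tripleStrings A h 1 < tripleStrings A h 2 := hmono (by decide)
  have top := fun u => hb.flux_sub hw hp₁ hp₂ A.length (by omega) (tripleStrings A h u)
  have bot := fun u => hb.flux_sub hw hp₁ hp₂ (A.length + 3) (by omega) (tripleStrings A h u)
  simp only [ht, hlt, position_tripleStrings_top, true_and, show A.length ≤ b by omega,
    show t < A.length + 3 by omega, if_true] at top bot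
  have posbot := position_tripleStrings_bot A B h
  have b0 := posbot 0
  have b2 := posbot 2
  have t0 := top 0
  have t2 := top 2
  have c0 := bot 0
  have c2 := bot 2
  have hrow : ∀ r < 3, A.length + r < (diagram (braidWord A B i j) k).depth := by
    intro r hr
    change _ < (braidWord A B i j).length
    omega
  have lt0 := hw.lt k (A.length + 0) (hrow 0 (by omega))
  have lt2 := hw.lt k (A.length + 2) (hrow 2 (by omega))
  have l0 := left_triple A B h k 0 (r := 0) (by omega)
  have r0 := right_triple A B h k 0 (r := 0) (by omega)
  have l2 := left_triple A B h k 0 (r := 2) (by omega)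
  have r2 := right_triple A B h k 0 (r := 2) (by omega)
  -- the flux along the two strings of the outer crossings
  have z1 := fun e => OrientedDiagram.flux_eq_zero_of_exponentAt hp₁ hs₁ lt0 h₁ e
  have z2 := fun e => OrientedDiagram.flux_eq_zero_of_exponentAt hp₂ hs₂ lt2 h₂ e
  have s1 := fun u => OrientedDiagram.flux_sub_eq hp₁ rfl rfl (hrow 0 (by omega)) lt0 u
  simp only [add_zero, h₁, zero_mul, sub_zero] at s1
  simp only [add_zero, s1] at z1
  simp only [add_zero] at l0 r0
  rw [l0, r0] at z1
  rw [l2, r2] at z2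
  have nonneg := fun (p : List (Step (Fin (n + 1)))) m (u : Fin (n + 1)) (hu : IsUp k u) =>
    OrientedDiagram.flux_nonneg (D := diagram (braidWord A B i j) k) p m (u := u)
      (by simpa [diagram_up] using hu)
  have nonpos := fun (p : List (Step (Fin (n + 1)))) m (u : Fin (n + 1)) (hu : ¬ IsUp k u) =>
    OrientedDiagram.flux_nonpos (D := diagram (braidWord A B i j) k) p m (u := u)
      (by simpa [diagram_up] using hu)
  simp only [diagram_up] at z1 z2
  simp only [Fin.val_zero, Fin.val_two, add_zero, Fin.isValue] at t0 t2 b0 b2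
  rcases id h with h' | h'
  · have hb' : decide ((i : ℕ) + 1 = j) = true := by simp [h']
    simp only [hb', OrientedDiagram.tripleDiagram] at z1 z2
    have hmin : min (i : ℕ) j = i := by omega
    have hcol : columnAt (braidWord A B i j) t + 1 = i := by omega
    rw [hmin] at t0 t2 b0 b2
    by_cases hu : IsUp k (tripleStrings A h 1)
    · have hu0 := isUp_of_le h01.le hu
      simp only [hu, hu0, decide_true, if_true, forall_const] at z1
      rw [z1, if_neg (by omega), if_pos hcol.symm] at t0
      have := nonneg p₂ A.length _ hu0
      omega
    · have hu2 : ¬ IsUp k (tripleStrings A h 2) := fun e => hu (isUp_of_le h12.le e)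
      simp only [hu, hu2, decide_false, Bool.false_eq_true, if_false, forall_const] at z2
      change (diagram (braidWord A B i j) k).flux p₂ (A.length + 3) _ = 0 at z2
      rw [z2, if_neg (by omega), if_pos (by omega)] at c2
      have := nonpos p₁ (A.length + 3) _ hu2
      omega
  · have hb' : decide ((i : ℕ) + 1 = j) = false := by simp; omega
    simp only [hb', OrientedDiagram.tripleDiagram] at z1 z2
    have hmin : min (i : ℕ) j = j := by omega
    have hcol : (i : ℕ) + 1 = columnAt (braidWord A B i j) t := by omega
    rw [hmin] at t0 t2 b0 b2
    by_cases hu : IsUp k (tripleStrings A h 1)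
    · have hu0 := isUp_of_le h01.le hu
      simp only [hu, hu0, decide_true, if_true, forall_const] at z2
      change (diagram (braidWord A B i j) k).flux p₂ (A.length + 3) _ = 0 at z2
      rw [z2, if_pos (by omega), if_neg (by omega)] at c0
      have := nonneg p₁ (A.length + 3) _ hu0
      omega
    · have hu2 : ¬ IsUp k (tripleStrings A h 2) := fun e => hu (isUp_of_le h12.le e)
      simp only [hu, hu2, decide_false, Bool.false_eq_true, if_false, forall_const] at z1
      rw [z1, if_pos (by omega), if_neg (by omega)] at t2
      have := nonpos p₂ A.length _ hu2
      omega

/-- A multiple of `(1, -1, 1)` at the three crossings of a braid word is not the vector of a path: it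
is a cycle, around the triangle that the three strings bound. -/
theorem not_mem_pathVectors_of_triple {A B : List (Fin n)} {i j : Fin n} (h : Adjacent i j)
    (hw : IsAscending (braidWord A B i j)) {l : ℤ} :
    patch A.length 0 l (-l) l ∉ pathVectors (braidWord A B i j) := by
  intro hM
  obtain ⟨k, hk⟩ := boundary_eq hw hM
  have hlen : (braidWord A B i j).length = A.length + (3 + B.length) := by
    simp only [braidWord, List.length_append, List.length_cons, List.length_nil]
    omega
  have key := hk k.succ
  rw [if_pos rfl, if_neg (by simp [Fin.ext_iff]), hlen, Finset.sum_range_add,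
    Finset.sum_eq_zero (s := Finset.range A.length), Finset.sum_range_add,
    Finset.sum_eq_zero (s := Finset.range B.length), zero_add, add_zero,
    Finset.sum_range_succ, Finset.sum_range_succ, Finset.sum_range_one] at key
  · have l0 := left_triple A B h k 0 (r := 0) (by omega)
    have r0 := right_triple A B h k 0 (r := 0) (by omega)
    have l1 := left_triple A B h k 0 (r := 1) (by omega)
    have r1 := right_triple A B h k 0 (r := 1) (by omega)
    have l2 := left_triple A B h k 0 (r := 2) (by omega)
    have r2 := right_triple A B h k 0 (r := 2) (by omega)
    rw [l0, r0, l1, r1, l2, r2, add_zero, patch_zero, patch_one, patch_two] at key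
    have cancel : ∀ x y z : ℤ,
        l * (x - y) + -l * (x - z) + l * (y - z) = 0 ∧
        l * (y - z) + -l * (x - z) + l * (x - y) = 0 := fun x y z => ⟨by ring, by ring⟩
    revert key
    cases decide ((i : ℕ) + 1 = j) <;> intro key <;>
      simp only [OrientedDiagram.tripleDiagram] at key
    · rw [(cancel _ _ _).2] at key
      norm_num at key
    · rw [(cancel _ _ _).1] at key
      norm_num at key
  · intro r _
    rw [patch_other (by omega)]
    simp
  · intro r hr
    rw [patch_other (by have := Finset.mem_range.1 hr; omega)]
    simp

end Words

/-! ### Boxes under braid moves -/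

section Words

variable {n : ℕ}

/-- The exponent vector that a braid move assigns to a vector with equal outer entries. -/
def exchange (a : ℕ) (M : ℕ → ℤ) : ℕ → ℤ := patch a M (M (a + 1)) (M a) (M (a + 1))

/-- The vector on the other side of a braid move that replaces a vector `(-1, y, 0)`. -/
def mergeLow (a : ℕ) (M : ℕ → ℤ) : ℕ → ℤ := patch a M (M (a + 1)) 0 (M (a + 1) - 1)

/-- The vector on the other side of a braid move that replaces a vector `(0, y, 1)`. -/
def mergeUp (a : ℕ) (M : ℕ → ℤ) : ℕ → ℤ := patch a M (M (a + 1) + 1) 0 (M (a + 1))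

/-- The first of the two vectors that replace a vector `(x, 0, x - 1)`. -/
def splitLow (a : ℕ) (M : ℕ → ℤ) : ℕ → ℤ := patch a M (-1) (M a) 0

/-- The second of the two vectors that replace a vector `(x, 0, x - 1)`. -/
def splitUp (a : ℕ) (M : ℕ → ℤ) : ℕ → ℤ := patch a M 0 (M a - 1) 1

/-- The relation between the exponent vectors of two words that differ by a braid move at `a`. -/
structure LocalLaw (a : ℕ) (S S' : Set (ℕ → ℤ)) : Prop where
  cases : ∀ M ∈ S, M a = M (a + 2) ∨
    (M a = -1 ∧ M (a + 2) = 0 ∧ (M (a + 1) = 0 ∨ M (a + 1) = 1)) ∨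
    (M a = 0 ∧ M (a + 2) = 1 ∧ (M (a + 1) = -1 ∨ M (a + 1) = 0)) ∨
    (M a = M (a + 2) + 1 ∧ M (a + 1) = 0 ∧ (M a = 0 ∨ M a = 1))
  exchange_mem : ∀ M ∈ S, M a = M (a + 2) → exchange a M ∈ S'
  mergeLow_mem : ∀ M ∈ S, M a = -1 → M (a + 2) = 0 → mergeLow a M ∈ S'
  mergeUp_mem : ∀ M ∈ S, M a = 0 → M (a + 2) = 1 → mergeUp a M ∈ S'
  splitLow_mem : ∀ M ∈ S, M a = M (a + 2) + 1 → splitLow a M ∈ S'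
  splitUp_mem : ∀ M ∈ S, M a = M (a + 2) + 1 → splitUp a M ∈ S'

/-- The three entries at a braid move determine which of the five ways of passing to the vectors of
the other word applies. -/
theorem localLaw {A B : List (Fin n)} {i j : Fin n} (h : Adjacent i j)
    (hw : IsAscending (braidWord A B i j)) (hw' : IsAscending (braidWord A B j i)) :
    LocalLaw A.length (pathVectors (braidWord A B i j)) (pathVectors (braidWord A B j i)) where
  cases M hM := by
    have := of_decide_eq_true (braid_transfer h hw hw' hM).1
    tauto
  exchange_mem M hM h0 := by
    refine (braid_transfer h hw hw' hM).2 true _ _ _ ?_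
    simp [OrientedDiagram.tripleTargets, h0]
  mergeLow_mem M hM h0 h1 := by
    refine (braid_transfer h hw hw' hM).2 true _ _ _ ?_
    simp [OrientedDiagram.tripleTargets, h0, h1]
  mergeUp_mem M hM h0 h1 := by
    refine (braid_transfer h hw hw' hM).2 true _ _ _ ?_
    simp [OrientedDiagram.tripleTargets, h0, h1]
  splitLow_mem M hM h0 := by
    have h1 := of_decide_eq_true (braid_transfer h hw hw' hM).1
    refine (braid_transfer h hw hw' hM).2 true _ _ _ ?_
    simp only [OrientedDiagram.tripleTargets]
    rw [if_neg (by omega), if_neg (by omega), if_neg (by omega)]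
    simp
  splitUp_mem M hM h0 := by
    have h1 := of_decide_eq_true (braid_transfer h hw hw' hM).1
    refine (braid_transfer h hw hw' hM).2 true _ _ _ ?_
    simp only [OrientedDiagram.tripleTargets]
    rw [if_neg (by omega), if_neg (by omega), if_neg (by omega)]
    simp

section Columns

variable {A B : List (Fin n)} {i j : Fin n}

theorem length_braidWord : (braidWord A B i j).length = A.length + B.length + 3 := by
  simp only [braidWord, List.length_append, List.length_cons, List.length_nil]
  omega

theorem columnAt_middle (μ : List (Fin n)) {r : ℕ} (hr : r < μ.length) :
    columnAt (A ++ μ ++ B) (A.length + r) = μ[r] := by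
  rw [columnAt_eq (length_append_middle A B μ hr), getElem_append_middle]

theorem columnAt_zero : columnAt (braidWord A B i j) A.length = i :=
  columnAt_middle [i, j, i] (r := 0) (by simp)

theorem columnAt_one : columnAt (braidWord A B i j) (A.length + 1) = j :=
  columnAt_middle [i, j, i] (r := 1) (by simp)

theorem columnAt_two : columnAt (braidWord A B i j) (A.length + 2) = i :=
  columnAt_middle [i, j, i] (r := 2) (by simp)

theorem columnAt_agree {μ μ' : List (Fin n)} (hl : μ'.length = μ.length) {r : ℕ}
    (h : ¬ (A.length ≤ r ∧ r < A.length + μ.length)) :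
    columnAt (A ++ μ' ++ B) r = columnAt (A ++ μ ++ B) r := by
  have hlen : (A ++ μ' ++ B).length = (A ++ μ ++ B).length := by simp [hl]
  by_cases hr : r < (A ++ μ ++ B).length
  · rw [columnAt_eq hr, columnAt_eq (hlen ▸ hr), getElem_agree hl h]
  · rw [columnAt, columnAt, dif_neg hr, dif_neg (by rwa [hlen])]

theorem columnAt_other {r : ℕ} (h : ¬ (A.length ≤ r ∧ r < A.length + 3)) :
    columnAt (braidWord A B j i) r = columnAt (braidWord A B i j) r :=
  columnAt_agree (μ := [i, j, i]) (μ' := [j, i, j]) rfl h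

theorem columnPairing_adjacent (h : Adjacent i j) : columnPairing i j = -1 := by
  rcases h with h | h
  · rw [columnPairing, if_neg (by omega), if_pos (by omega)]
  · rw [columnPairing, if_neg (by omega), if_pos (by omega)]

theorem lambdaVector_self (w : List (Fin n)) (t : ℕ) : lambdaVector w t t = 1 := by
  simp [lambdaVector]

theorem lambdaVector_of_lt {w : List (Fin n)} {t r : ℕ} (h : r < t) : lambdaVector w t r = 0 := by
  rw [lambdaVector, if_neg (by omega), if_neg (by omega)]

theorem lambdaVector_of_gt {w : List (Fin n)} {t r : ℕ} (h : t < r) (hr : r < w.length) :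
    lambdaVector w t r = columnPairing (columnAt w t) (columnAt w r) := by
  rw [lambdaVector, if_neg (by omega), if_pos ⟨h, hr⟩]

/-- The entries of the `λ`-vectors of a braid word at its middle crossings. -/
theorem lambdaVector_before {t : ℕ} (ht : t < A.length) {c : ℕ}
    (hc : columnAt (braidWord A B i j) t = c) :
    lambdaVector (braidWord A B i j) t A.length = columnPairing c i ∧
      lambdaVector (braidWord A B i j) t (A.length + 1) = columnPairing c j ∧
      lambdaVector (braidWord A B i j) t (A.length + 2) = columnPairing c i := by
  have hl := length_braidWord (A := A) (B := B) (i := i) (j := j)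
  rw [lambdaVector_of_gt ht (by omega), lambdaVector_of_gt (by omega) (by omega),
    lambdaVector_of_gt (by omega) (by omega), columnAt_zero, columnAt_one, columnAt_two, hc]
  exact ⟨rfl, rfl, rfl⟩

theorem lambdaVector_zero (h : Adjacent i j) :
    lambdaVector (braidWord A B i j) A.length A.length = 1 ∧
      lambdaVector (braidWord A B i j) A.length (A.length + 1) = -1 ∧
      lambdaVector (braidWord A B i j) A.length (A.length + 2) = 2 := by
  have hl := length_braidWord (A := A) (B := B) (i := i) (j := j)
  rw [lambdaVector_self, lambdaVector_of_gt (by omega) (by omega),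
    lambdaVector_of_gt (by omega) (by omega), columnAt_zero, columnAt_one, columnAt_two,
    columnPairing_self, columnPairing_adjacent h]
  exact ⟨rfl, rfl, rfl⟩

theorem lambdaVector_one (h : Adjacent i j) :
    lambdaVector (braidWord A B i j) (A.length + 1) A.length = 0 ∧
      lambdaVector (braidWord A B i j) (A.length + 1) (A.length + 1) = 1 ∧
      lambdaVector (braidWord A B i j) (A.length + 1) (A.length + 2) = -1 := by
  have hl := length_braidWord (A := A) (B := B) (i := i) (j := j)
  rw [lambdaVector_self, lambdaVector_of_lt (by omega), lambdaVector_of_gt (by omega) (by omega),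
    columnAt_one, columnAt_two, columnPairing_adjacent h.symm]
  exact ⟨rfl, rfl, rfl⟩

theorem lambdaVector_two :
    lambdaVector (braidWord A B i j) (A.length + 2) A.length = 0 ∧
      lambdaVector (braidWord A B i j) (A.length + 2) (A.length + 1) = 0 ∧
      lambdaVector (braidWord A B i j) (A.length + 2) (A.length + 2) = 1 := by
  rw [lambdaVector_self, lambdaVector_of_lt (by omega), lambdaVector_of_lt (by omega)]
  exact ⟨rfl, rfl, rfl⟩

theorem lambdaVector_after {t : ℕ} (ht : A.length + 3 ≤ t) :
    lambdaVector (braidWord A B i j) t A.length = 0 ∧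
      lambdaVector (braidWord A B i j) t (A.length + 1) = 0 ∧
      lambdaVector (braidWord A B i j) t (A.length + 2) = 0 := by
  rw [lambdaVector_of_lt (by omega), lambdaVector_of_lt (by omega), lambdaVector_of_lt (by omega)]
  exact ⟨rfl, rfl, rfl⟩

theorem lambdaVector_other {t r : ℕ} (ht : ¬ (A.length ≤ t ∧ t < A.length + 3))
    (hr : ¬ (A.length ≤ r ∧ r < A.length + 3)) :
    lambdaVector (braidWord A B j i) t r = lambdaVector (braidWord A B i j) t r := by
  unfold lambdaVector
  rw [columnAt_other ht, columnAt_other hr, length_braidWord, length_braidWord]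

theorem lambdaVector_middle {t t' r : ℕ} (ht : A.length ≤ t ∧ t < A.length + 3)
    (ht' : A.length ≤ t' ∧ t' < A.length + 3)
    (hc : columnAt (braidWord A B j i) t' = columnAt (braidWord A B i j) t)
    (hr : ¬ (A.length ≤ r ∧ r < A.length + 3)) :
    lambdaVector (braidWord A B j i) t' r = lambdaVector (braidWord A B i j) t r := by
  unfold lambdaVector
  rw [hc, columnAt_other hr, length_braidWord, length_braidWord,
    if_neg (show ¬ r = t' by omega), if_neg (show ¬ r = t by omega)]
  exact if_congr (by omega) rfl rfl

theorem Adjacent.val_ne (h : Adjacent i j) : (i : ℕ) ≠ j := by rcases h with h | h <;> omega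

/-- The boxes of a braid word that have a vertex among the middle crossings. -/
theorem IsBoxAt.cases (h : Adjacent i j) {t b : ℕ} (hb : IsBoxAt (braidWord A B i j) t b) :
    (¬ (A.length ≤ t ∧ t < A.length + 3) ∧ ¬ (A.length ≤ b ∧ b < A.length + 3)) ∨
    (t < A.length ∧ b = A.length) ∨ (t < A.length ∧ b = A.length + 1) ∨
    (t = A.length ∧ b = A.length + 2) ∨
    (t = A.length + 1 ∧ A.length + 3 ≤ b) ∨ (t = A.length + 2 ∧ A.length + 3 ≤ b) := by
  obtain ⟨hlt, -, hcol, hne⟩ := hb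
  have h0 := columnAt_zero (A := A) (B := B) (i := i) (j := j)
  have h1 := columnAt_one (A := A) (B := B) (i := i) (j := j)
  have h2 := columnAt_two (A := A) (B := B) (i := i) (j := j)
  have hij := h.val_ne
  by_contra hcon
  rcases lt_or_ge t A.length with ht | ht
  · have : b = A.length + 2 := by omega
    subst this
    exact hne A.length ht (by omega) (by rw [h0, hcol, h2])
  · rcases (show t = A.length ∨ t = A.length + 1 ∨ t = A.length + 2 by omega) with rfl | rfl | rfl
    · rcases (show b = A.length + 1 ∨ A.length + 2 < b by omega) with rfl | hb
      · omega
      · exact hne (A.length + 2) (by omega) hb (by rw [h0, h2])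
    · have : b = A.length + 2 := by omega
      subst this
      omega
    · omega

theorem IsBoxAt.transport {t b t' b' : ℕ}
    (hb : IsBoxAt (braidWord A B j i) t' b')
    (hc : columnAt (braidWord A B i j) t = columnAt (braidWord A B j i) t') (hlt : t < b)
    (hlen : b < (braidWord A B i j).length)
    (hcb : columnAt (braidWord A B i j) b = columnAt (braidWord A B j i) b')
    (hrange : ∀ r, t < r → r < b → (t' < r ∧ r < b' ∧ ¬ (A.length ≤ r ∧ r < A.length + 3)) ∨
      columnAt (braidWord A B i j) r ≠ columnAt (braidWord A B j i) t') :
    IsBoxAt (braidWord A B i j) t b where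
  lt := hlt
  lt_length := hlen
  column_eq := by rw [hc, hcb, hb.column_eq]
  column_ne r h1 h2 := by
    rw [hc]
    rcases hrange r h1 h2 with ⟨h3, h4, h5⟩ | h3
    · rw [← columnAt_other h5]
      exact hb.column_ne r h3 h4
    · exact h3

/-- Box conditions are preserved if they are preserved at the middle crossings. -/
theorem BoxPair.transport {t b t' b' : ℕ} {M₁ M₂ : ℕ → ℤ}
    (hp : BoxPair (braidWord A B j i) t' b' M₁ M₂) (hbox : IsBoxAt (braidWord A B i j) t b)
    (ht : ∀ r, ¬ (A.length ≤ r ∧ r < A.length + 3) →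
      lambdaVector (braidWord A B j i) t' r = lambdaVector (braidWord A B i j) t r)
    (hb : ∀ r, ¬ (A.length ≤ r ∧ r < A.length + 3) →
      lambdaVector (braidWord A B j i) b' r = lambdaVector (braidWord A B i j) b r)
    {x₁ y₁ z₁ x₂ y₂ z₂ : ℤ}
    (hx : x₁ + lambdaVector (braidWord A B i j) t A.length =
      x₂ + lambdaVector (braidWord A B i j) b A.length)
    (hy : y₁ + lambdaVector (braidWord A B i j) t (A.length + 1) =
      y₂ + lambdaVector (braidWord A B i j) b (A.length + 1))
    (hz : z₁ + lambdaVector (braidWord A B i j) t (A.length + 2) =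
      z₂ + lambdaVector (braidWord A B i j) b (A.length + 2))
    (htop : patch A.length M₁ x₁ y₁ z₁ t = -1) (hbot : patch A.length M₂ x₂ y₂ z₂ b = 1) :
    BoxPair (braidWord A B i j) t b (patch A.length M₁ x₁ y₁ z₁)
      (patch A.length M₂ x₂ y₂ z₂) where
  isBox := hbox
  add_eq r := by
    by_cases hr : A.length ≤ r ∧ r < A.length + 3
    · rcases (show r = A.length ∨ r = A.length + 1 ∨ r = A.length + 2 by omega) with
        rfl | rfl | rfl
      · simpa only [patch_zero] using hx
      · simpa only [patch_one] using hy
      · simpa only [patch_two] using hz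
    · rw [patch_other hr, patch_other hr, ← ht r hr, ← hb r hr]
      exact hp.add_eq r
  top_eq := htop
  bot_eq := hbot

end Columns

end Words

/-! ### Mutation of the coefficients -/

section Mutation

variable {n : ℕ} {R : Type} [CommRing R]

/-- The coefficients of the string inequalities after a braid move at `a`, expressed by the
coefficients `s` before it. -/
def mutateString (a : ℕ) (α β : Rˣ) (s : (ℕ → ℤ) → R) (M : ℕ → ℤ) : R :=
  if M a = M (a + 2) then s (exchange a M)
  else if M a = -1 ∧ M (a + 2) = 0 then α * s (mergeLow a M)
  else if M a = 0 ∧ M (a + 2) = 1 then β * s (mergeUp a M)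
  else ↑α⁻¹ * s (splitUp a M)

/-- The coefficients of the `λ`-inequalities after a braid move at `a`, expressed by the
coefficients `l` before it. -/
def mutateLambda (a : ℕ) (α β : Rˣ) (l : ℕ → R) (t : ℕ) : R :=
  if t = a then β * l (a + 1) else if t = a + 1 then ↑α⁻¹ * l a
  else if t = a + 2 then α * l (a + 1) else l t

/-- The functions `s` and `l` on the string inequalities and the `λ`-inequalities satisfy the box
equations. -/
def SolvesBoxes (w : List (Fin n)) (s : (ℕ → ℤ) → R) (l : ℕ → R) : Prop :=
  ∀ t b, ∀ M₁ ∈ pathVectors w, ∀ M₂ ∈ pathVectors w, BoxPair w t b M₁ M₂ →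
    s M₁ * l t = s M₂ * l b

variable {a : ℕ} {α β : Rˣ} {s : (ℕ → ℤ) → R} {l : ℕ → R} {M : ℕ → ℤ}

theorem mutateString_zero (h : M a = M (a + 2)) :
    mutateString a α β s M = s (exchange a M) := if_pos h

theorem mutateString_low (h : M a = -1) (h' : M (a + 2) = 0) :
    mutateString a α β s M = α * s (mergeLow a M) := by
  rw [mutateString, if_neg (by omega), if_pos ⟨h, h'⟩]

theorem mutateString_up (h : M a = 0) (h' : M (a + 2) = 1) :
    mutateString a α β s M = β * s (mergeUp a M) := by
  rw [mutateString, if_neg (by omega), if_neg (by omega), if_pos ⟨h, h'⟩]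

theorem mutateString_sing (h : M a = M (a + 2) + 1) :
    mutateString a α β s M = ↑α⁻¹ * s (splitUp a M) := by
  rw [mutateString, if_neg (by omega), if_neg (by omega), if_neg (by omega)]

theorem mutateLambda_zero : mutateLambda a α β l a = β * l (a + 1) := if_pos rfl

theorem mutateLambda_one : mutateLambda a α β l (a + 1) = ↑α⁻¹ * l a := by simp [mutateLambda]

theorem mutateLambda_two : mutateLambda a α β l (a + 2) = α * l (a + 1) := by simp [mutateLambda]

theorem mutateLambda_other {t : ℕ} (h : ¬ (a ≤ t ∧ t < a + 3)) :
    mutateLambda a α β l t = l t := by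
  rw [mutateLambda, if_neg (by omega), if_neg (by omega), if_neg (by omega)]

section Braid

variable {A B : List (Fin n)} {i j : Fin n}

/-- The box equation of the box between the outer two crossings of a braid word. -/
theorem SolvesBoxes.low_mul (h : Adjacent i j) (hs : SolvesBoxes (braidWord A B i j) s l)
    {x : ℤ} {M₁ : ℕ → ℤ} (h₁ : patch A.length M₁ (-1) x 0 ∈ pathVectors (braidWord A B i j))
    (h₂ : patch A.length M₁ 0 (x - 1) 1 ∈ pathVectors (braidWord A B i j)) :
    s (patch A.length M₁ (-1) x 0) * l A.length =
      s (patch A.length M₁ 0 (x - 1) 1) * l (A.length + 2) := by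
  have hlen := length_braidWord (A := A) (B := B) (i := i) (j := j)
  refine hs _ _ _ h₁ _ h₂ ⟨⟨by omega, by omega, ?_, ?_⟩, ?_, by rw [patch_zero], by rw [patch_two]⟩
  · rw [columnAt_zero, columnAt_two]
  · intro r h3 h4
    obtain rfl : r = A.length + 1 := by omega
    rw [columnAt_zero, columnAt_one]
    exact h.val_ne.symm
  · have e0 := lambdaVector_zero (A := A) (B := B) h
    have e2 := lambdaVector_two (A := A) (B := B) (i := i) (j := j)
    intro r
    by_cases hr : A.length ≤ r ∧ r < A.length + 3
    · rcases (show r = A.length ∨ r = A.length + 1 ∨ r = A.length + 2 by omega) with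
        rfl | rfl | rfl
      · rw [patch_zero, patch_zero, e0.1, e2.1]
        rfl
      · rw [patch_one, patch_one, e0.2.1, e2.2.1]
        ring
      · rw [patch_two, patch_two, e0.2.2, e2.2.2]
        rfl
    · rw [patch_other hr, patch_other hr]
      congr 1
      unfold lambdaVector
      rw [columnAt_zero, columnAt_two, if_neg (show ¬ r = A.length by omega),
        if_neg (show ¬ r = A.length + 2 by omega)]
      exact if_congr (by omega) rfl rfl

/-- The two expressions for the coefficient of a vector `(x, 0, x - 1)` agree. -/
theorem mutateString_sing' (h : Adjacent i j) (hs : SolvesBoxes (braidWord A B i j) s l)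
    (hl : IsUnit (l A.length)) (hαβ : α * l (A.length + 2) = β * l A.length)
    (hc : M A.length = M (A.length + 2) + 1)
    (h₁ : splitLow A.length M ∈ pathVectors (braidWord A B i j))
    (h₂ : splitUp A.length M ∈ pathVectors (braidWord A B i j)) :
    mutateString A.length α β s M = ↑β⁻¹ * s (splitLow A.length M) := by
  have h3 := hs.low_mul h h₁ h₂
  rw [mutateString_sing hc]
  unfold splitLow splitUp at *
  set x := s (patch A.length M (-1) (M A.length) 0)
  set y := s (patch A.length M 0 (M A.length - 1) 1)
  apply hl.mul_right_cancel
  linear_combination - (↑β⁻¹ : R) * h3 - ↑α⁻¹ * ↑β⁻¹ * y * hαβ +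
    ↑β⁻¹ * y * l (A.length + 2) * α.inv_mul - ↑α⁻¹ * y * l A.length * β.inv_mul

/-- Mutation with interchanged parameters is inverse to mutation. -/
theorem mutateString_mutateString (h : Adjacent i j)
    (law : LocalLaw A.length (pathVectors (braidWord A B i j)) (pathVectors (braidWord A B j i)))
    (law' : LocalLaw A.length (pathVectors (braidWord A B j i)) (pathVectors (braidWord A B i j)))
    (hs : SolvesBoxes (braidWord A B i j) s l) (hl : IsUnit (l A.length))
    (hαβ : α * l (A.length + 2) = β * l A.length)
    {M : ℕ → ℤ} (hM : M ∈ pathVectors (braidWord A B i j)) :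
    mutateString A.length β α (mutateString A.length α β s) M = s M := by
  rcases law.cases M hM with c | c | c | c
  · rw [mutateString_zero c, exchange, mutateString_zero (by simp only [patch_zero, patch_two]),
      exchange, patch_patch, patch_zero, patch_one, patch_eq_self rfl rfl c]
  · have h1 := law'.splitUp_mem _ (law.mergeLow_mem M hM c.1 c.2.1)
      (by rw [mergeLow, patch_zero, patch_two]; ring)
    have h2 : patch A.length M (-1) (M (A.length + 1)) 0 = M :=
      patch_eq_self c.1.symm rfl c.2.1.symm
    rw [mutateString_low c.1 c.2.1, mergeLow,
      mutateString_sing (by rw [patch_zero, patch_two]; ring), splitUp, patch_patch, patch_zero]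
    rw [splitUp, mergeLow, patch_patch, patch_zero] at h1
    have h3 := hs.low_mul h (by rwa [h2]) h1
    rw [h2] at h3
    apply hl.mul_right_cancel
    linear_combination (-1 : R) * h3 - ↑α⁻¹ * s (patch A.length M 0 (M (A.length + 1) - 1) 1) * hαβ +
      s (patch A.length M 0 (M (A.length + 1) - 1) 1) * l (A.length + 2) * α.inv_mul
  · rw [mutateString_up c.1 c.2.1, mergeUp,
      mutateString_sing (by rw [patch_zero, patch_two]), splitUp, patch_patch, patch_zero,
      patch_eq_self (by rw [c.1]) (by ring) (by rw [c.2.1])]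
    linear_combination s M * α.mul_inv
  · rw [mutateString_sing c.1, splitUp,
      mutateString_up (by rw [patch_zero]) (by rw [patch_two]), mergeUp, patch_patch, patch_one,
      patch_eq_self (by ring) (by rw [c.2.1]) (by rw [c.1]; ring)]
    linear_combination s M * β.inv_mul

theorem mutateLambda_mutateLambda (hαβ : α * l (a + 2) = β * l a) :
    mutateLambda a β α (mutateLambda a α β l) = l := by
  funext t
  by_cases ht : a ≤ t ∧ t < a + 3
  · rcases (show t = a ∨ t = a + 1 ∨ t = a + 2 by omega) with rfl | rfl | rfl
    · rw [mutateLambda_zero, mutateLambda_one]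
      linear_combination l t * α.mul_inv
    · rw [mutateLambda_one, mutateLambda_zero]
      linear_combination l (a + 1) * β.inv_mul
    · rw [mutateLambda_two, mutateLambda_one]
      linear_combination - ↑α⁻¹ * hαβ + l (a + 2) * α.inv_mul
  · rw [mutateLambda_other ht, mutateLambda_other ht]

/-- Mutation transforms solutions of the box equations into solutions of the box equations. Every
box equation of the new word is a multiple of a box equation of the old word, up to the relation
between `α` and `β`, except for the box between the outer two crossings, whose equation holds by the
definition of the mutation. -/
theorem SolvesBoxes.mutate (h : Adjacent i j) (hw' : IsAscending (braidWord A B j i))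
    (law : LocalLaw A.length (pathVectors (braidWord A B j i)) (pathVectors (braidWord A B i j)))
    (hs : SolvesBoxes (braidWord A B i j) s l) (hl : IsUnit (l A.length))
    (hαβ : α * l (A.length + 2) = β * l A.length) :
    SolvesBoxes (braidWord A B j i) (mutateString A.length α β s)
      (mutateLambda A.length α β l) := by
  intro t b M₁ hM₁ M₂ hM₂ hp
  have hbox := hp.isBox
  have hlen := length_braidWord (A := A) (B := B) (i := i) (j := j)
  have hlen' := length_braidWord (A := A) (B := B) (i := j) (j := i)
  have hbN := hbox.lt_length
  have e0 := hp.add_eq A.length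
  have e1 := hp.add_eq (A.length + 1)
  have e2 := hp.add_eq (A.length + 2)
  have lz := lambdaVector_zero (A := A) (B := B) h
  have lo := lambdaVector_one (A := A) (B := B) h
  have lt := lambdaVector_two (A := A) (B := B) (i := i) (j := j)
  have lz' := lambdaVector_zero (A := A) (B := B) h.symm
  have lo' := lambdaVector_one (A := A) (B := B) h.symm
  have lt' := lambdaVector_two (A := A) (B := B) (i := j) (j := i)
  have cz := columnAt_zero (A := A) (B := B) (i := i) (j := j)
  have co := columnAt_one (A := A) (B := B) (i := i) (j := j)
  have ct := columnAt_two (A := A) (B := B) (i := i) (j := j)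
  have cz' := columnAt_zero (A := A) (B := B) (i := j) (j := i)
  have co' := columnAt_one (A := A) (B := B) (i := j) (j := i)
  have ct' := columnAt_two (A := A) (B := B) (i := j) (j := i)
  have hij := h.val_ne
  have htop := hp.top_eq
  have hbot := hp.bot_eq
  have c₁ := law.cases M₁ hM₁
  have c₂ := law.cases M₂ hM₂
  have hlt := hbox.lt
  rcases hbox.cases h.symm with ⟨ht, hb⟩ | ⟨ht, rfl⟩ | ⟨ht, rfl⟩ | ⟨rfl, rfl⟩ | ⟨rfl, hb⟩ | ⟨rfl, hb⟩
  · -- both vertices lie outside the middle crossings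
    have hcb : columnAt (braidWord A B i j) t = columnAt (braidWord A B i j) b := by
      rw [← columnAt_other ht, ← columnAt_other hb, hbox.column_eq]
    have hboxw : IsBoxAt (braidWord A B i j) t b := by
      refine hbox.transport (columnAt_other ht).symm hlt (by omega) (columnAt_other hb).symm ?_
      intro r h1 h2
      by_cases hr : A.length ≤ r ∧ r < A.length + 3
      · right
        have n0 := hbox.column_ne A.length (by omega) (by omega)
        have n1 := hbox.column_ne (A.length + 1) (by omega) (by omega)
        rw [cz'] at n0
        rw [co'] at n1
        rcases (show r = A.length ∨ r = A.length + 1 ∨ r = A.length + 2 by omega) with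
          rfl | rfl | rfl
        · rwa [cz]
        · rwa [co]
        · rwa [ct]
      · exact Or.inl ⟨h1, h2, hr⟩
    have transport := fun {x₁ y₁ z₁ x₂ y₂ z₂ : ℤ} hx hy hz =>
      hp.transport (x₁ := x₁) (y₁ := y₁) (z₁ := z₁) (x₂ := x₂) (y₂ := y₂) (z₂ := z₂) hboxw
        (fun r hr => lambdaVector_other ht hr) (fun r hr => lambdaVector_other hb hr) hx hy hz
        (by rwa [patch_other ht]) (by rwa [patch_other hb])
    -- the entries of the two `λ`-vectors at the middle crossings differ only if the box
    -- surrounds them, and then the column of the box is adjacent to at most one of `i` and `j`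
    obtain ⟨x, y, hx0, hx1, hx2, hy0, hy1, hy2, hxy⟩ : ∃ x y : ℤ,
        M₁ A.length = M₂ A.length + x ∧ M₁ (A.length + 1) = M₂ (A.length + 1) + y ∧
        M₁ (A.length + 2) = M₂ (A.length + 2) + x ∧
        lambdaVector (braidWord A B i j) t A.length + y =
          lambdaVector (braidWord A B i j) b A.length ∧
        lambdaVector (braidWord A B i j) t (A.length + 1) + x =
          lambdaVector (braidWord A B i j) b (A.length + 1) ∧
        lambdaVector (braidWord A B i j) t (A.length + 2) + y =
          lambdaVector (braidWord A B i j) b (A.length + 2) ∧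
        ((x = 0 ∧ y = 0) ∨ (x = 0 ∧ y = 1) ∨
          (x = 1 ∧ y = 0 ∧ ¬ (M₁ A.length = 0 ∧ M₂ (A.length + 2) = 0))) := by
      rcases lt_or_ge b A.length with hb1 | hb1
      · have d1 := lambdaVector_before (B := B) (i := i) (j := j) (hlt.trans hb1) hcb
        have d2 := lambdaVector_before (B := B) (i := i) (j := j) hb1 rfl
        have d3 := lambdaVector_before (B := B) (i := j) (j := i) (hlt.trans hb1) hbox.column_eq
        have d4 := lambdaVector_before (B := B) (i := j) (j := i) hb1 rfl
        exact ⟨0, 0, by omega, by omega, by omega, by omega, by omega, by omega, by omega⟩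
      have d2 := lambdaVector_after (A := A) (B := B) (i := i) (j := j) (t := b) (by omega)
      have d4 := lambdaVector_after (A := A) (B := B) (i := j) (j := i) (t := b) (by omega)
      rcases lt_or_ge t A.length with ht1 | ht1
      · have d1 := lambdaVector_before (B := B) (i := i) (j := j) ht1 rfl
        have d3 := lambdaVector_before (B := B) (i := j) (j := i) ht1 rfl
        rw [columnAt_other ht] at d3
        have n0 := hbox.column_ne A.length (by omega) (by omega)
        have n1 := hbox.column_ne (A.length + 1) (by omega) (by omega)
        rw [cz', columnAt_other ht] at n0
        rw [co', columnAt_other ht] at n1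
        refine ⟨- columnPairing (columnAt (braidWord A B i j) t) j,
          - columnPairing (columnAt (braidWord A B i j) t) i, by omega, by omega, by omega,
          by omega, by omega, by omega, ?_⟩
        by_cases hq : columnAt (braidWord A B i j) t + 1 = j ∨
            (j : ℕ) + 1 = columnAt (braidWord A B i j) t
        · right; right
          refine ⟨?_, ?_, ?_⟩
          · rw [columnPairing, if_neg (by omega), if_pos (by omega)]
            rfl
          · rw [columnPairing, if_neg (by omega), if_neg]
            · rfl
            · rcases h with h | h <;> omega
          · rintro ⟨m1, m2⟩
            refine hp.not_straddling h.symm hw' hM₁ hM₂ ht1 (by omega) ?_ ?_ m1 m2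
            · rwa [columnAt_other ht]
            · rw [columnAt_other ht]
              exact n1.symm
        · have : columnPairing (columnAt (braidWord A B i j) t) j = 0 := by
            rw [columnPairing, if_neg (by omega), if_neg (by omega)]
          rw [this]
          unfold columnPairing
          rw [if_neg (by omega)]
          split_ifs <;> simp
      · have d1 := lambdaVector_after (A := A) (B := B) (i := i) (j := j) (t := t) (by omega)
        have d3 := lambdaVector_after (A := A) (B := B) (i := j) (j := i) (t := t) (by omega)
        exact ⟨0, 0, by omega, by omega, by omega, by omega, by omega, by omega, by omega⟩
    rw [mutateLambda_other ht, mutateLambda_other hb]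
    clear e0 e1 e2
    rcases c₁ with c₁ | c₁ | c₁ | c₁ <;> rcases c₂ with c₂ | c₂ | c₂ | c₂ <;>
      try (exfalso; omega)
    · rw [mutateString_zero c₁, mutateString_zero c₂]
      exact hs _ _ _ (law.exchange_mem _ hM₁ c₁) _ (law.exchange_mem _ hM₂ c₂)
        (transport (by omega) (by omega) (by omega))
    · rw [mutateString_low c₁.1 c₁.2.1, mutateString_low c₂.1 c₂.2.1]
      linear_combination (α : R) * hs _ _ _ (law.mergeLow_mem _ hM₁ c₁.1 c₁.2.1) _
        (law.mergeLow_mem _ hM₂ c₂.1 c₂.2.1) (transport (by omega) (by omega) (by omega))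
    · rw [mutateString_up c₁.1 c₁.2.1, mutateString_up c₂.1 c₂.2.1]
      linear_combination (β : R) * hs _ _ _ (law.mergeUp_mem _ hM₁ c₁.1 c₁.2.1) _
        (law.mergeUp_mem _ hM₂ c₂.1 c₂.2.1) (transport (by omega) (by omega) (by omega))
    · rw [mutateString_sing c₁.1, mutateString_sing c₂.1]
      linear_combination (↑α⁻¹ : R) * hs _ _ _ (law.splitUp_mem _ hM₁ c₁.1) _
        (law.splitUp_mem _ hM₂ c₂.1) (transport (by omega) (by omega) (by omega))
  · -- the lower vertex is the first of the middle crossings; it corresponds to the second one of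
    -- the old word
    have ht' : ¬ (A.length ≤ t ∧ t < A.length + 3) := by omega
    have hc : columnAt (braidWord A B i j) t = j := by
      rw [← columnAt_other ht', hbox.column_eq, cz']
    have d1 := lambdaVector_before ht hc
    have d3 := lambdaVector_before ht (hbox.column_eq.trans cz')
    rw [columnPairing_self, columnPairing_adjacent h.symm] at d1 d3
    have hboxw : IsBoxAt (braidWord A B i j) t (A.length + 1) := by
      refine hbox.transport (columnAt_other ht').symm (by omega) (by omega) (by rw [co, cz']) ?_
      intro r h1 h2
      rcases (show r < A.length ∨ r = A.length by omega) with h3 | rfl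
      · exact Or.inl ⟨h1, h3, by omega⟩
      · right
        rwa [cz, hbox.column_eq, cz']
    have transport := fun {x₁ y₁ z₁ x₂ y₂ z₂ : ℤ} hx hy hz (hb : y₂ = 1) =>
      hp.transport (x₁ := x₁) (y₁ := y₁) (z₁ := z₁) (x₂ := x₂) (y₂ := y₂) (z₂ := z₂) hboxw
        (fun r hr => lambdaVector_other ht' hr)
        (fun r hr => lambdaVector_middle (by omega) (by omega) (by rw [co, cz']) hr) hx hy hz
        (by rwa [patch_other ht']) (by rwa [patch_one])
    rw [mutateLambda_other ht', mutateLambda_zero]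
    rcases c₁ with c₁ | c₁ | c₁ | c₁ <;> rcases c₂ with c₂ | c₂ | c₂ | c₂ <;>
      try (exfalso; omega)
    · rw [mutateString_zero c₁, mutateString_sing' h hs hl hαβ c₂.1 (law.splitLow_mem _ hM₂ c₂.1)
        (law.splitUp_mem _ hM₂ c₂.1)]
      linear_combination hs _ _ _ (law.exchange_mem _ hM₁ c₁) _ (law.splitLow_mem _ hM₂ c₂.1)
        (transport (by omega) (by omega) (by omega) (by omega)) -
        s (splitLow A.length M₂) * l (A.length + 1) * β.inv_mul
    · rw [mutateString_up c₁.1 c₁.2.1, mutateString_zero c₂]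
      linear_combination (β : R) * hs _ _ _ (law.mergeUp_mem _ hM₁ c₁.1 c₁.2.1) _
        (law.exchange_mem _ hM₂ c₂) (transport (by omega) (by omega) (by omega) (by omega))
  · -- the lower vertex is the second of the middle crossings; it corresponds to the first one of
    -- the old word
    have ht' : ¬ (A.length ≤ t ∧ t < A.length + 3) := by omega
    have hc : columnAt (braidWord A B i j) t = i := by
      rw [← columnAt_other ht', hbox.column_eq, co']
    have d1 := lambdaVector_before ht hc
    have d3 := lambdaVector_before ht (hbox.column_eq.trans co')
    rw [columnPairing_self, columnPairing_adjacent h] at d1 d3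
    have hboxw : IsBoxAt (braidWord A B i j) t A.length := by
      refine hbox.transport (columnAt_other ht').symm (by omega) (by omega) (by rw [cz, co']) ?_
      intro r h1 h2
      exact Or.inl ⟨h1, by omega, by omega⟩
    have transport := fun {x₁ y₁ z₁ x₂ y₂ z₂ : ℤ} hx hy hz (hb : x₂ = 1) =>
      hp.transport (x₁ := x₁) (y₁ := y₁) (z₁ := z₁) (x₂ := x₂) (y₂ := y₂) (z₂ := z₂) hboxw
        (fun r hr => lambdaVector_other ht' hr)
        (fun r hr => lambdaVector_middle (by omega) (by omega) (by rw [cz, co']) hr) hx hy hz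
        (by rwa [patch_other ht']) (by rwa [patch_zero])
    rw [mutateLambda_other ht', mutateLambda_one]
    rcases c₁ with c₁ | c₁ | c₁ | c₁ <;> rcases c₂ with c₂ | c₂ | c₂ | c₂ <;>
      try (exfalso; omega)
    · rw [mutateString_zero c₁, mutateString_low c₂.1 c₂.2.1]
      linear_combination hs _ _ _ (law.exchange_mem _ hM₁ c₁) _ (law.mergeLow_mem _ hM₂ c₂.1 c₂.2.1)
        (transport (by omega) (by omega) (by omega) (by omega)) -
        s (mergeLow A.length M₂) * l A.length * α.mul_inv
    · rw [mutateString_sing c₁.1, mutateString_zero c₂]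
      linear_combination (↑α⁻¹ : R) * hs _ _ _ (law.splitUp_mem _ hM₁ c₁.1) _
        (law.exchange_mem _ hM₂ c₂) (transport (by omega) (by omega) (by omega) (by omega))
  · -- the box between the outer two of the middle crossings
    rw [mutateLambda_zero, mutateLambda_two]
    rcases c₁ with c₁ | c₁ | c₁ | c₁ <;> rcases c₂ with c₂ | c₂ | c₂ | c₂ <;>
      try (exfalso; omega)
    rw [mutateString_low c₁.1 c₁.2.1, mutateString_up c₂.1 c₂.2.1]
    have : mergeLow A.length M₁ = mergeUp A.length M₂ := by
      funext r
      by_cases hr : A.length ≤ r ∧ r < A.length + 3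
      · rcases (show r = A.length ∨ r = A.length + 1 ∨ r = A.length + 2 by omega) with
          rfl | rfl | rfl
        · rw [mergeLow, mergeUp, patch_zero, patch_zero]
          omega
        · rw [mergeLow, mergeUp, patch_one, patch_one]
        · rw [mergeLow, mergeUp, patch_two, patch_two]
          omega
      · rw [mergeLow, mergeUp, patch_other hr, patch_other hr]
        have := hp.add_eq r
        have e : lambdaVector (braidWord A B j i) A.length r =
            lambdaVector (braidWord A B j i) (A.length + 2) r := by
          unfold lambdaVector
          rw [cz', ct', if_neg (show ¬ r = A.length by omega),
            if_neg (show ¬ r = A.length + 2 by omega)]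
          exact if_congr (by omega) rfl rfl
        omega
    rw [this]
    ring
  · -- the upper vertex is the second of the middle crossings; it corresponds to the last one of
    -- the old word
    have hb' : ¬ (A.length ≤ b ∧ b < A.length + 3) := by omega
    have d1 := lambdaVector_after (A := A) (B := B) (i := i) (j := j) hb
    have d3 := lambdaVector_after (A := A) (B := B) (i := j) (j := i) hb
    have hboxw : IsBoxAt (braidWord A B i j) (A.length + 2) b := by
      refine hbox.transport (by rw [ct, co']) (by omega) (by omega) (columnAt_other hb').symm ?_
      intro r h1 h2
      exact Or.inl ⟨by omega, h2, by omega⟩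
    have transport := fun {x₁ y₁ z₁ x₂ y₂ z₂ : ℤ} hx hy hz (hb : z₁ = -1) =>
      hp.transport (x₁ := x₁) (y₁ := y₁) (z₁ := z₁) (x₂ := x₂) (y₂ := y₂) (z₂ := z₂) hboxw
        (fun r hr => lambdaVector_middle (by omega) (by omega) (by rw [ct, co']) hr)
        (fun r hr => lambdaVector_other hb' hr) hx hy hz
        (by rwa [patch_two]) (by rwa [patch_other hb'])
    rw [mutateLambda_other hb', mutateLambda_one]
    rcases c₁ with c₁ | c₁ | c₁ | c₁ <;> rcases c₂ with c₂ | c₂ | c₂ | c₂ <;>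
      try (exfalso; omega)
    · rw [mutateString_zero c₁, mutateString_sing' h hs hl hαβ c₂.1 (law.splitLow_mem _ hM₂ c₂.1)
        (law.splitUp_mem _ hM₂ c₂.1)]
      have e := hs _ _ _ (law.exchange_mem _ hM₁ c₁) _ (law.splitLow_mem _ hM₂ c₂.1)
        (transport (by omega) (by omega) (by omega) (by omega))
      set x := s (exchange A.length M₁)
      linear_combination (↑β⁻¹ : R) * e - ↑α⁻¹ * ↑β⁻¹ * x * hαβ +
        ↑β⁻¹ * x * l (A.length + 2) * α.inv_mul - ↑α⁻¹ * x * l A.length * β.inv_mul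
    · rw [mutateString_up c₁.1 c₁.2.1, mutateString_zero c₂]
      have e := hs _ _ _ (law.mergeUp_mem _ hM₁ c₁.1 c₁.2.1) _ (law.exchange_mem _ hM₂ c₂)
        (transport (by omega) (by omega) (by omega) (by omega))
      linear_combination e - ↑α⁻¹ * s (mergeUp A.length M₁) * hαβ +
        s (mergeUp A.length M₁) * l (A.length + 2) * α.inv_mul
  · -- the upper vertex is the last of the middle crossings; it corresponds to the second one of
    -- the old word
    have hb' : ¬ (A.length ≤ b ∧ b < A.length + 3) := by omega
    have d1 := lambdaVector_after (A := A) (B := B) (i := i) (j := j) hb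
    have d3 := lambdaVector_after (A := A) (B := B) (i := j) (j := i) hb
    have hboxw : IsBoxAt (braidWord A B i j) (A.length + 1) b := by
      refine hbox.transport (by rw [co, ct']) (by omega) (by omega) (columnAt_other hb').symm ?_
      intro r h1 h2
      rcases (show r = A.length + 2 ∨ A.length + 2 < r by omega) with rfl | h3
      · right
        rwa [ct, ct']
      · exact Or.inl ⟨h3, h2, by omega⟩
    have transport := fun {x₁ y₁ z₁ x₂ y₂ z₂ : ℤ} hx hy hz (hb : y₁ = -1) =>
      hp.transport (x₁ := x₁) (y₁ := y₁) (z₁ := z₁) (x₂ := x₂) (y₂ := y₂) (z₂ := z₂) hboxw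
        (fun r hr => lambdaVector_middle (by omega) (by omega) (by rw [co, ct']) hr)
        (fun r hr => lambdaVector_other hb' hr) hx hy hz
        (by rwa [patch_one]) (by rwa [patch_other hb'])
    rw [mutateLambda_other hb', mutateLambda_two]
    rcases c₁ with c₁ | c₁ | c₁ | c₁ <;> rcases c₂ with c₂ | c₂ | c₂ | c₂ <;>
      try (exfalso; omega)
    · rw [mutateString_zero c₁, mutateString_low c₂.1 c₂.2.1]
      linear_combination (α : R) * hs _ _ _ (law.exchange_mem _ hM₁ c₁) _
        (law.mergeLow_mem _ hM₂ c₂.1 c₂.2.1) (transport (by omega) (by omega) (by omega) (by omega))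
    · rw [mutateString_sing c₁.1, mutateString_zero c₂]
      linear_combination hs _ _ _ (law.splitUp_mem _ hM₁ c₁.1) _
        (law.exchange_mem _ hM₂ c₂) (transport (by omega) (by omega) (by omega) (by omega)) +
        s (splitUp A.length M₁) * l (A.length + 1) * α.inv_mul

end Braid

end Mutation

/-! ### The parameter rings -/

section Parameters

variable {n : ℕ} (w : List (Fin n))

theorem coefficient_isUnit (d : InequalityIndex w) : IsUnit (coefficient w d) := by
  classical
  refine IsUnit.map _ (IsUnit.of_mul_eq_one (AddMonoidAlgebra.single (- Pi.single d 1) 1) ?_)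
  rw [torusCoord, AddMonoidAlgebra.single_mul_single, AddMonoidAlgebra.one_def]
  congr 1
  · convert add_neg_cancel _
  · ring

theorem restrict_mem {M : ℕ → ℤ} (hM : M ∈ pathVectors w) :
    (fun r : Fin w.length => M r) ∈ stringExponents w := by
  rw [← extendZero_mem_pathVectors, extendZero_restrict (fun r hr => pathVectors_eq_zero hM hr)]
  exact hM

open Classical in
/-- The coefficient of a string inequality as a function of its exponent vector, extended to all
vectors by the value `1`. -/
noncomputable def stringCoeff (M : ℕ → ℤ) : ParamRing w :=
  if h : M ∈ pathVectors w then coefficient w (Sum.inr ⟨_, restrict_mem w h⟩) else 1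

/-- The coefficient of a `λ`-inequality, extended by the value `1`. -/
noncomputable def lambdaCoeff (t : ℕ) : ParamRing w :=
  if h : t < w.length then coefficient w (Sum.inl ⟨t, h⟩) else 1

theorem stringCoeff_extendZero (p : stringExponents w) :
    stringCoeff w (extendZero p.1) = coefficient w (Sum.inr p) := by
  rw [stringCoeff, dif_pos (extendZero_mem_pathVectors.2 p.2)]
  congr 2
  apply Subtype.ext
  funext r
  exact extendZero_val _ r

theorem lambdaCoeff_val (t : Fin w.length) :
    lambdaCoeff w t = coefficient w (Sum.inl t) := dif_pos t.2

theorem stringCoeff_isUnit (M : ℕ → ℤ) : IsUnit (stringCoeff w M) := by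
  unfold stringCoeff
  split_ifs
  · exact coefficient_isUnit _ _
  · exact isUnit_one

theorem lambdaCoeff_isUnit (t : ℕ) : IsUnit (lambdaCoeff w t) := by
  unfold lambdaCoeff
  split_ifs
  · exact coefficient_isUnit _ _
  · exact isUnit_one

theorem solvesBoxes_coeff : SolvesBoxes w (stringCoeff w) (lambdaCoeff w) := by
  intro t b M₁ hM₁ M₂ hM₂ hp
  have hb := hp.isBox.lt_length
  have ht := hp.isBox.lt.trans hb
  have h1 : extendZero (fun r : Fin w.length => M₁ r) = M₁ :=
    extendZero_restrict fun r hr => pathVectors_eq_zero hM₁ hr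
  have h2 : extendZero (fun r : Fin w.length => M₂ r) = M₂ :=
    extendZero_restrict fun r hr => pathVectors_eq_zero hM₂ hr
  rw [← h1, ← h2] at hp
  have key := (boxCondition_iff (t := ⟨t, ht⟩) (b := ⟨b, hb⟩) (p₁ := ⟨_, restrict_mem w hM₁⟩)
    (p₂ := ⟨_, restrict_mem w hM₂⟩)).2 hp
  rw [stringCoeff, dif_pos hM₁, stringCoeff, dif_pos hM₂, lambdaCoeff, dif_pos ht, lambdaCoeff,
    dif_pos hb]
  have := Ideal.Quotient.eq.2 (Ideal.subset_span ⟨_, _, _, _, key, rfl⟩ :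
    _ ∈ boxIdeal w)
  rwa [map_mul, map_mul] at this

variable {w} {R : Type} [CommRing R]

/-- The values of the coefficients that are given by functions `s` and `l`. -/
def coeffValue (s : (ℕ → ℤ) → Rˣ) (l : ℕ → Rˣ) : InequalityIndex w → Rˣ
  | Sum.inl t => l t
  | Sum.inr p => s (extendZero p.1)

/-- The character of the torus of coefficient vectors that is given by units. -/
def torusCharacter {ι : Type} [Fintype ι] (u : ι → Rˣ) : Multiplicative (ι → ℤ) →* R where
  toFun m := ((∏ d, u d ^ m.toAdd d : Rˣ) : R)
  map_one' := by simp
  map_mul' m m' := by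
    rw [← Units.val_mul, ← Finset.prod_mul_distrib]
    simp [zpow_add]

theorem torusCharacter_single {ι : Type} [Fintype ι] [DecidableEq ι] (u : ι → Rˣ) (d : ι) :
    torusCharacter u (.ofAdd (Pi.single d 1)) = u d := by
  change ((∏ e, u e ^ (Pi.single d 1 : ι → ℤ) e : Rˣ) : R) = u d
  rw [Finset.prod_eq_single d]
  · simp
  · intro e _ he
    simp [he]
  · simp

variable [Algebra ℂ R]

theorem lift_torusCoord (u : InequalityIndex w → Rˣ) (d : InequalityIndex w) :
    AddMonoidAlgebra.lift ℂ R (InequalityIndex w → ℤ) (torusCharacter u) (torusCoord w d) = u d := by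
  classical
  rw [torusCoord, AddMonoidAlgebra.lift_single, one_smul]
  convert torusCharacter_single u d

/-- The homomorphism from the parameter ring that is given by a solution of the box equations in
units. -/
noncomputable def paramHom (s : (ℕ → ℤ) → Rˣ) (l : ℕ → Rˣ)
    (h : SolvesBoxes w (fun M => (s M : R)) fun t => (l t : R)) : ParamRing w →ₐ[ℂ] R :=
  Ideal.Quotient.liftₐ (boxIdeal w)
    (AddMonoidAlgebra.lift ℂ R (InequalityIndex w → ℤ) (torusCharacter (coeffValue s l))) <| by
    intro x hx
    have : boxIdeal w ≤ RingHom.ker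
        (AddMonoidAlgebra.lift ℂ R (InequalityIndex w → ℤ) (torusCharacter (coeffValue s l))) := by
      rw [boxIdeal, Ideal.span_le]
      rintro _ ⟨t, b, p₁, p₂, hp, rfl⟩
      rw [SetLike.mem_coe, RingHom.mem_ker, map_sub, map_mul, map_mul, lift_torusCoord,
        lift_torusCoord, lift_torusCoord, lift_torusCoord, sub_eq_zero]
      exact h _ _ _ (extendZero_mem_pathVectors.2 p₁.2) _ (extendZero_mem_pathVectors.2 p₂.2)
        (boxCondition_iff.1 hp)
    exact this hx

theorem paramHom_coefficient (s : (ℕ → ℤ) → Rˣ) (l : ℕ → Rˣ)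
    (h : SolvesBoxes w (fun M => (s M : R)) fun t => (l t : R)) (d : InequalityIndex w) :
    paramHom s l h (coefficient w d) = coeffValue s l d :=
  lift_torusCoord _ d

theorem paramHom_stringCoeff (s : (ℕ → ℤ) → Rˣ) (l : ℕ → Rˣ)
    (h : SolvesBoxes w (fun M => (s M : R)) fun t => (l t : R)) {M : ℕ → ℤ}
    (hM : M ∈ pathVectors w) : paramHom s l h (stringCoeff w M) = s M := by
  rw [stringCoeff, dif_pos hM, paramHom_coefficient]
  simp only [coeffValue]
  rw [extendZero_restrict fun r hr => pathVectors_eq_zero hM hr]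

theorem paramHom_lambdaCoeff (s : (ℕ → ℤ) → Rˣ) (l : ℕ → Rˣ)
    (h : SolvesBoxes w (fun M => (s M : R)) fun t => (l t : R)) {t : ℕ} (ht : t < w.length) :
    paramHom s l h (lambdaCoeff w t) = l t := by
  rw [lambdaCoeff, dif_pos ht, paramHom_coefficient]
  rfl

/-- Homomorphisms from the parameter ring are determined by the values of the coefficients. -/
theorem paramHom_ext {f g : ParamRing w →ₐ[ℂ] R}
    (hs : ∀ M ∈ pathVectors w, f (stringCoeff w M) = g (stringCoeff w M))
    (hl : ∀ t < w.length, f (lambdaCoeff w t) = g (lambdaCoeff w t)) : f = g := by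
  classical
  have key : ∀ d, f (coefficient w d) = g (coefficient w d) := by
    rintro (t | p)
    · rw [← lambdaCoeff_val]
      exact hl _ t.2
    · rw [← stringCoeff_extendZero]
      exact hs _ (extendZero_mem_pathVectors.2 p.2)
  refine Ideal.Quotient.algHom_ext _ (AddMonoidAlgebra.algHom_ext ?_ (Subsingleton.elim _ _))
  let F (f : ParamRing w →ₐ[ℂ] R) : (InequalityIndex w → ℤ) →+ Additive R :=
    { toFun := fun m => Additive.ofMul
        (f (Ideal.Quotient.mk (boxIdeal w) (AddMonoidAlgebra.single m 1)))
      map_zero' := by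
        rw [← AddMonoidAlgebra.one_def, map_one, map_one]
        rfl
      map_add' := fun m m' => by
        rw [← ofMul_mul, ← map_mul, ← map_mul, AddMonoidAlgebra.single_mul_single, one_mul] }
  have : F f = F g := by
    refine AddMonoidHom.functions_ext' _ _ _ fun d => AddMonoidHom.ext_int ?_
    refine congrArg Additive.ofMul (?_ : f (Ideal.Quotient.mk (boxIdeal w) _) =
      g (Ideal.Quotient.mk (boxIdeal w) _))
    convert key d using 2 <;>
    · rw [coefficient, torusCoord]
      congr!
  exact fun m => congrArg Additive.toMul (DFunLike.congr_fun this m)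

end Parameters

/-! ### Mutation of the universal polynomial -/

section MutationSum

variable {a : ℕ} {S S' : Set (ℕ → ℤ)} {X : Type} [CommRing X]

/-- The vectors `(-1, y, 0)` of one word correspond to the vectors `(y, 0, y - 1)` of the other. -/
theorem LocalLaw.sum_low (law : LocalLaw a S S') (law' : LocalLaw a S' S) (hS : S.Finite)
    (hS' : S'.Finite) (f : (ℕ → ℤ) → X) :
    ∑ M ∈ hS.toFinset with M a = -1 ∧ M (a + 2) = 0, f M =
      ∑ M ∈ hS'.toFinset with M a = M (a + 2) + 1, f (splitLow a M) := by
  refine Finset.sum_nbij' (mergeLow a) (splitLow a) ?_ ?_ ?_ ?_ ?_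
  · intro M hM
    simp only [Finset.mem_filter, Set.Finite.mem_toFinset] at hM ⊢
    refine ⟨law.mergeLow_mem M hM.1 hM.2.1 hM.2.2, ?_⟩
    rw [mergeLow, patch_zero, patch_two]
    ring
  · intro M hM
    simp only [Finset.mem_filter, Set.Finite.mem_toFinset] at hM ⊢
    refine ⟨law'.splitLow_mem M hM.1 hM.2, ?_⟩
    rw [splitLow, patch_zero, patch_two]
    exact ⟨rfl, rfl⟩
  · intro M hM
    simp only [Finset.mem_filter, Set.Finite.mem_toFinset] at hM
    rw [splitLow, mergeLow, patch_patch, patch_zero]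
    exact patch_eq_self hM.2.1.symm rfl hM.2.2.symm
  · intro M hM
    simp only [Finset.mem_filter, Set.Finite.mem_toFinset] at hM
    have := law'.cases M hM.1
    rw [splitLow, mergeLow, patch_patch, patch_one]
    exact patch_eq_self rfl (by omega) (by omega)
  · intro M hM
    simp only [Finset.mem_filter, Set.Finite.mem_toFinset] at hM
    rw [splitLow, mergeLow, patch_patch, patch_zero, patch_eq_self hM.2.1.symm rfl hM.2.2.symm]

/-- The vectors `(0, y, 1)` of one word correspond to the vectors `(y + 1, 0, y)` of the other. -/
theorem LocalLaw.sum_up (law : LocalLaw a S S') (law' : LocalLaw a S' S) (hS : S.Finite)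
    (hS' : S'.Finite) (f : (ℕ → ℤ) → X) :
    ∑ M ∈ hS.toFinset with M a = 0 ∧ M (a + 2) = 1, f M =
      ∑ M ∈ hS'.toFinset with M a = M (a + 2) + 1, f (splitUp a M) := by
  refine Finset.sum_nbij' (mergeUp a) (splitUp a) ?_ ?_ ?_ ?_ ?_
  · intro M hM
    simp only [Finset.mem_filter, Set.Finite.mem_toFinset] at hM ⊢
    refine ⟨law.mergeUp_mem M hM.1 hM.2.1 hM.2.2, ?_⟩
    rw [mergeUp, patch_zero, patch_two]
  · intro M hM
    simp only [Finset.mem_filter, Set.Finite.mem_toFinset] at hM ⊢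
    refine ⟨law'.splitUp_mem M hM.1 hM.2, ?_⟩
    rw [splitUp, patch_zero, patch_two]
    exact ⟨rfl, rfl⟩
  · intro M hM
    simp only [Finset.mem_filter, Set.Finite.mem_toFinset] at hM
    rw [splitUp, mergeUp, patch_patch, patch_zero]
    exact patch_eq_self hM.2.1.symm (by ring) hM.2.2.symm
  · intro M hM
    simp only [Finset.mem_filter, Set.Finite.mem_toFinset] at hM
    have := law'.cases M hM.1
    rw [splitUp, mergeUp, patch_patch, patch_one]
    exact patch_eq_self (by ring) (by omega) (by omega)
  · intro M hM
    simp only [Finset.mem_filter, Set.Finite.mem_toFinset] at hM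
    rw [splitUp, mergeUp, patch_patch, patch_zero,
      patch_eq_self hM.2.1.symm (by ring) hM.2.2.symm]

/-- The vectors with equal outer entries correspond to each other. -/
theorem LocalLaw.sum_zero (law : LocalLaw a S S') (law' : LocalLaw a S' S) (hS : S.Finite)
    (hS' : S'.Finite) (f : (ℕ → ℤ) → X) :
    ∑ M ∈ hS.toFinset with M a = M (a + 2), f M =
      ∑ M ∈ hS'.toFinset with M a = M (a + 2), f (exchange a M) := by
  have inv : ∀ M : ℕ → ℤ, M a = M (a + 2) → exchange a (exchange a M) = M := by
    intro M hM
    rw [exchange, exchange, patch_patch, patch_zero, patch_one]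
    exact patch_eq_self rfl rfl hM
  refine Finset.sum_nbij' (exchange a) (exchange a) ?_ ?_ ?_ ?_ ?_
  · intro M hM
    simp only [Finset.mem_filter, Set.Finite.mem_toFinset] at hM ⊢
    refine ⟨law.exchange_mem M hM.1 hM.2, ?_⟩
    rw [exchange, patch_zero, patch_two]
  · intro M hM
    simp only [Finset.mem_filter, Set.Finite.mem_toFinset] at hM ⊢
    refine ⟨law'.exchange_mem M hM.1 hM.2, ?_⟩
    rw [exchange, patch_zero, patch_two]
  · intro M hM
    simp only [Finset.mem_filter, Set.Finite.mem_toFinset] at hM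
    exact inv M hM.2
  · intro M hM
    simp only [Finset.mem_filter, Set.Finite.mem_toFinset] at hM
    exact inv M hM.2
  · intro M hM
    simp only [Finset.mem_filter, Set.Finite.mem_toFinset] at hM
    rw [inv M hM.2]

/-- A sum over the exponent vectors splits into the four cases of the local law. -/
theorem LocalLaw.sum_eq (law : LocalLaw a S S') (hS : S.Finite) (f : (ℕ → ℤ) → X) :
    ∑ M ∈ hS.toFinset, f M =
      ∑ M ∈ hS.toFinset with M a = M (a + 2), f M +
      ∑ M ∈ hS.toFinset with M a = -1 ∧ M (a + 2) = 0, f M +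
      ∑ M ∈ hS.toFinset with M a = 0 ∧ M (a + 2) = 1, f M +
      ∑ M ∈ hS.toFinset with M a = M (a + 2) + 1, f M := by
  simp only [Finset.sum_filter, ← Finset.sum_add_distrib]
  refine Finset.sum_congr rfl fun M hM => ?_
  rcases law.cases M ((Set.Finite.mem_toFinset _).1 hM) with c | c | c | c
  · rw [if_pos c, if_neg (by omega), if_neg (by omega), if_neg (by omega)]
    ring
  · rw [if_neg (by omega), if_pos (by omega), if_neg (by omega), if_neg (by omega)]
    ring
  · rw [if_neg (by omega), if_neg (by omega), if_pos (by omega), if_neg (by omega)]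
    ring
  · rw [if_neg (by omega), if_neg (by omega), if_neg (by omega), if_pos (by omega)]
    ring

/-- The linear map on exponent vectors that belongs to a braid move at `a`: the monomial `T^M` of the
new torus is substituted by the product of `T^(tropical a M)` and a power of the binomial. -/
def tropical (a : ℕ) : (ℕ → ℤ) →+ (ℕ → ℤ) where
  toFun M := patch a M (M (a + 1)) (M (a + 2)) (M a + M (a + 1) - M (a + 2))
  map_zero' := patch_eq_self rfl rfl (by simp)
  map_add' M M' := by
    funext r
    simp only [patch, Pi.add_apply]
    split_ifs <;> ring

/-- The exponent of the binomial in the image of the monomial `T^M` under a braid move at `a`. -/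
def degree (a : ℕ) : (ℕ → ℤ) →+ ℤ where
  toFun M := M a - M (a + 2)
  map_zero' := by simp
  map_add' M M' := by simp only [Pi.add_apply]; ring

theorem tropical_apply (a : ℕ) (M : ℕ → ℤ) :
    tropical a M = patch a M (M (a + 1)) (M (a + 2)) (M a + M (a + 1) - M (a + 2)) := rfl

theorem degree_apply (a : ℕ) (M : ℕ → ℤ) : degree a M = M a - M (a + 2) := rfl

/-- The direction `(1, -1, 1)` at the crossings `a`, `a + 1` and `a + 2`. -/
def direction (a : ℕ) : ℕ → ℤ := patch a 0 1 (-1) 1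

theorem degree_direction (a : ℕ) : degree a (direction a) = 0 := by
  rw [degree_apply, direction, patch_zero, patch_two, sub_self]

theorem patch_add_direction (a : ℕ) (M : ℕ → ℤ) (x y z : ℤ) :
    patch a M x y z + direction a = patch a M (x + 1) (y - 1) (z + 1) := by
  funext r
  simp only [direction, patch, Pi.add_apply, Pi.zero_apply]
  split_ifs <;> ring

theorem tropical_direction (a : ℕ) : tropical a (direction a) = - direction a := by
  funext r
  rw [tropical_apply, direction, patch_patch, patch_zero, patch_one, patch_two]
  simp only [patch, Pi.neg_apply, Pi.zero_apply]
  split_ifs <;> rfl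

theorem degree_tropical (a : ℕ) (M : ℕ → ℤ) : degree a (tropical a M) = - degree a M := by
  rw [degree_apply, degree_apply, tropical_apply, patch_zero, patch_two]
  ring

theorem tropical_tropical (a : ℕ) (M : ℕ → ℤ) :
    tropical a (tropical a M) + degree a M • direction a = M := by
  funext r
  rw [tropical_apply, tropical_apply, patch_patch, patch_zero, patch_one, patch_two, degree_apply,
    direction]
  simp only [patch, Pi.add_apply, Pi.smul_apply, Pi.zero_apply, smul_eq_mul]
  split_ifs with h1 h2 h3
  · rw [h1]; ring
  · rw [h2]; ring
  · rw [h3]; ring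
  · ring

/-- The coordinates on a torus after a braid move at `a`, where `h` is the binomial of the move. -/
def mutateTorus (a : ℕ) (x : Multiplicative (ℕ → ℤ) →* Xˣ) (h : Xˣ) :
    Multiplicative (ℕ → ℤ) →* Xˣ where
  toFun M := h ^ degree a M.toAdd * x (.ofAdd (tropical a M.toAdd))
  map_one' := by
    rw [toAdd_one, map_zero, map_zero, zpow_zero, one_mul, ofAdd_zero, map_one]
  map_mul' M M' := by
    rw [toAdd_mul, map_add, map_add, zpow_add, ofAdd_add, map_mul]
    exact mul_mul_mul_comm _ _ _ _

theorem mutateTorus_apply (x : Multiplicative (ℕ → ℤ) →* Xˣ) (h : Xˣ) (M : ℕ → ℤ) :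
    mutateTorus a x h (.ofAdd M) = h ^ degree a M * x (.ofAdd (tropical a M)) := rfl

section Words

variable {n : ℕ}

theorem pathVectors_finite (w : List (Fin n)) : (pathVectors w).Finite := by
  refine ((stringExponents_finite w).image extendZero).subset ?_
  intro M hM
  exact ⟨_, restrict_mem w hM, extendZero_restrict fun r hr => pathVectors_eq_zero hM hr⟩

/-- The value of `∑ a_d T^{M_d}` at coefficients `s`, `l` and a point `x` of the torus. -/
noncomputable def inequalitySum (w : List (Fin n)) (s : (ℕ → ℤ) → X) (l : ℕ → X)
    (x : Multiplicative (ℕ → ℤ) →* Xˣ) : X :=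
  ∑ t ∈ Finset.range w.length, l t * x (.ofAdd (lambdaVector w t)) +
    ∑ M ∈ (pathVectors_finite w).toFinset, s M * x (.ofAdd M)

variable {A B : List (Fin n)} {i j : Fin n} {α β : Xˣ} {s : (ℕ → ℤ) → X} {l : ℕ → X}

/-- The binomial substitution of a braid move transforms the sums over all inequalities of the two
words into each other. -/
theorem inequalitySum_mutate (h : Adjacent i j)
    (law : LocalLaw A.length (pathVectors (braidWord A B i j)) (pathVectors (braidWord A B j i)))
    (law' : LocalLaw A.length (pathVectors (braidWord A B j i)) (pathVectors (braidWord A B i j)))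
    (hs : SolvesBoxes (braidWord A B i j) s l) (hl : IsUnit (l A.length))
    (hαβ : α * l (A.length + 2) = β * l A.length)
    (x : Multiplicative (ℕ → ℤ) →* Xˣ) (H : Xˣ)
    (hH : (H : X) = α + β * x (.ofAdd (- direction A.length))) :
    inequalitySum (braidWord A B j i) (mutateString A.length α β s) (mutateLambda A.length α β l)
      (mutateTorus A.length x H) = inequalitySum (braidWord A B i j) s l x := by
  have hsub : ∀ M : ℕ → ℤ, (x (.ofAdd (M - direction A.length)) : X) =
      x (.ofAdd (- direction A.length)) * x (.ofAdd M) := by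
    intro M
    rw [sub_eq_neg_add, ofAdd_add, map_mul, Units.val_mul]
  have hHinv : (↑H⁻¹ : X) * (α + β * x (.ofAdd (- direction A.length))) = 1 := by
    rw [← hH, Units.inv_mul]
  unfold inequalitySum
  congr 1
  · -- the `λ`-inequalities
    have hlen : (braidWord A B i j).length = A.length + (3 + B.length) := by
      rw [length_braidWord]; ring
    have hlen' : (braidWord A B j i).length = A.length + (3 + B.length) := by
      rw [length_braidWord]; ring
    have lz := lambdaVector_zero (A := A) (B := B) h
    have lo := lambdaVector_one (A := A) (B := B) h
    have lt := lambdaVector_two (A := A) (B := B) (i := i) (j := j)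
    have lz' := lambdaVector_zero (A := A) (B := B) h.symm
    have lo' := lambdaVector_one (A := A) (B := B) h.symm
    have lt' := lambdaVector_two (A := A) (B := B) (i := j) (j := i)
    have cz := columnAt_zero (A := A) (B := B) (i := i) (j := j)
    have co := columnAt_one (A := A) (B := B) (i := i) (j := j)
    have ct := columnAt_two (A := A) (B := B) (i := i) (j := j)
    have cz' := columnAt_zero (A := A) (B := B) (i := j) (j := i)
    have co' := columnAt_one (A := A) (B := B) (i := j) (j := i)
    have ct' := columnAt_two (A := A) (B := B) (i := j) (j := i)
    -- the image of an exponent vector, determined by its entries at the middle crossings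
    have image : ∀ (M N : ℕ → ℤ) (c : ℤ), (∀ r, ¬ (A.length ≤ r ∧ r < A.length + 3) → M r = N r) →
        M (A.length + 1) = N A.length - c → M (A.length + 2) = N (A.length + 1) + c →
        M A.length + M (A.length + 1) - M (A.length + 2) = N (A.length + 2) - c →
        tropical A.length M = N - c • direction A.length := by
      intro M N c h0 h1 h2 h3
      funext r
      rw [tropical_apply]
      by_cases hr : A.length ≤ r ∧ r < A.length + 3
      · rcases (show r = A.length ∨ r = A.length + 1 ∨ r = A.length + 2 by omega) with
          rfl | rfl | rfl
        · simp [direction, patch_zero, h1]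
        · simp [direction, patch_one, h2]
        · simp [direction, patch_two, h3]
      · simp [direction, patch_other hr, h0 r hr]
    have outer : ∀ t, t < A.length + (3 + B.length) → ¬ (A.length ≤ t ∧ t < A.length + 3) →
        mutateLambda A.length α β l t *
          (mutateTorus A.length x H (.ofAdd (lambdaVector (braidWord A B j i) t)) : X) =
        l t * x (.ofAdd (lambdaVector (braidWord A B i j) t)) := by
      intro t htl ht
      have e : (lambdaVector (braidWord A B j i) t A.length =
            lambdaVector (braidWord A B i j) t (A.length + 1) ∧
          lambdaVector (braidWord A B j i) t (A.length + 1) =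
            lambdaVector (braidWord A B i j) t A.length ∧
          lambdaVector (braidWord A B j i) t (A.length + 2) =
            lambdaVector (braidWord A B i j) t (A.length + 1) ∧
          lambdaVector (braidWord A B i j) t A.length =
            lambdaVector (braidWord A B i j) t (A.length + 2)) := by
        rcases lt_or_ge t A.length with ht1 | ht1
        · obtain ⟨a1, a2, a3⟩ := lambdaVector_before (B := B) (i := i) (j := j) ht1 rfl
          obtain ⟨b1, b2, b3⟩ := lambdaVector_before (B := B) (i := j) (j := i) ht1 rfl
          rw [columnAt_other ht] at b1 b2 b3
          rw [a1, a2, a3, b1, b2, b3]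
          exact ⟨rfl, rfl, rfl, rfl⟩
        · obtain ⟨a1, a2, a3⟩ :=
            lambdaVector_after (A := A) (B := B) (i := i) (j := j) (t := t) (by omega)
          obtain ⟨b1, b2, b3⟩ :=
            lambdaVector_after (A := A) (B := B) (i := j) (j := i) (t := t) (by omega)
          rw [a1, a2, a3, b1, b2, b3]
          exact ⟨rfl, rfl, rfl, rfl⟩
      rw [mutateLambda_other ht, mutateTorus_apply, degree_apply,
        image _ (lambdaVector (braidWord A B i j) t) 0
          (fun r hr => lambdaVector_other ht hr) (by omega) (by omega) (by omega), zero_smul, sub_zero,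
        e.1, e.2.2.1, sub_self, zpow_zero, one_mul]
    -- The first and the last `λ`-term of the new word have the same monomial up to `T^{-v}`, and
    -- so have those of the old word (`i3`). The binomial splits the second term of the new word
    -- into the latter two and merges the former two into the second term of the old word.
    have i0 := image (lambdaVector (braidWord A B j i) A.length)
      (lambdaVector (braidWord A B i j) (A.length + 1)) 1
      (fun r hr => lambdaVector_middle (by omega) (by omega) (by rw [co, cz']) hr) (by omega)
      (by omega) (by omega)
    have i1 := image (lambdaVector (braidWord A B j i) (A.length + 1))
      (lambdaVector (braidWord A B i j) A.length) 0
      (fun r hr => lambdaVector_middle (by omega) (by omega) (by rw [cz, co']) hr) (by omega)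
      (by omega) (by omega)
    have i2 := image (lambdaVector (braidWord A B j i) (A.length + 2))
      (lambdaVector (braidWord A B i j) (A.length + 1)) 0
      (fun r hr => lambdaVector_middle (by omega) (by omega) (by rw [co, ct']) hr) (by omega)
      (by omega) (by omega)
    have i3 : lambdaVector (braidWord A B i j) (A.length + 2) =
        lambdaVector (braidWord A B i j) A.length - direction A.length := by
      funext r
      by_cases hr : A.length ≤ r ∧ r < A.length + 3
      · rcases (show r = A.length ∨ r = A.length + 1 ∨ r = A.length + 2 by omega) with
          rfl | rfl | rfl
        · simp only [direction, patch_zero, Pi.sub_apply]; omega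
        · simp only [direction, patch_one, Pi.sub_apply]; omega
        · simp only [direction, patch_two, Pi.sub_apply]; omega
      · rw [Pi.sub_apply, direction, patch_other hr, Pi.zero_apply, sub_zero]
        unfold lambdaVector
        rw [cz, ct, if_neg (show ¬ r = A.length by omega),
          if_neg (show ¬ r = A.length + 2 by omega)]
        exact if_congr (by omega) rfl rfl
    rw [hlen, hlen', Finset.sum_range_add, Finset.sum_range_add, Finset.sum_range_add,
      Finset.sum_range_add]
    congr 1
    · refine Finset.sum_congr rfl fun t ht => ?_
      have := Finset.mem_range.1 ht
      exact outer t (by omega) (by omega)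
    congr 1
    · simp only [Finset.sum_range_succ, Finset.sum_range_zero, zero_add, add_zero]
      rw [mutateLambda_zero, mutateLambda_one, mutateLambda_two, mutateTorus_apply,
        mutateTorus_apply, mutateTorus_apply, i0, i1, i2, i3, degree_apply, degree_apply,
        degree_apply, lz'.1, lz'.2.2, lo'.1, lo'.2.2, lt'.1, lt'.2.2, one_smul, zero_smul, sub_zero,
        sub_zero, show (1 : ℤ) - 2 = -1 by norm_num, show (0 : ℤ) - (-1) = 1 by norm_num,
        show (0 : ℤ) - 1 = -1 by norm_num, zpow_neg, zpow_one, Units.val_mul, Units.val_mul,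
        Units.val_mul, hsub, hsub, hH]
      set y : X := ((x (.ofAdd (- direction A.length)) : Xˣ) : X)
      set y₀ : X := ((x (.ofAdd (lambdaVector (braidWord A B i j) A.length)) : Xˣ) : X)
      set y₁ : X := ((x (.ofAdd (lambdaVector (braidWord A B i j) (A.length + 1))) : Xˣ) : X)
      linear_combination (l (A.length + 1) * y₁) * hHinv + (l A.length * y₀) * α.inv_mul -
        (↑α⁻¹ * y * y₀) * hαβ + (l (A.length + 2) * y * y₀) * α.inv_mul
    · refine Finset.sum_congr rfl fun t ht => ?_
      have := Finset.mem_range.1 ht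
      exact outer _ (by omega) (by omega)
  · -- the string inequalities
    rw [law.sum_eq (pathVectors_finite _), law'.sum_eq (pathVectors_finite _),
      law.sum_low law' _ (pathVectors_finite _), law.sum_up law' _ (pathVectors_finite _),
      law'.sum_low law _ (pathVectors_finite _), law'.sum_up law _ (pathVectors_finite _),
      law.sum_zero law' _ (pathVectors_finite _)]
    -- Terms of degree `0` correspond to each other (`e0`), a term of degree `1` expands into two
    -- terms by the binomial (`e1`), and two terms of degree `-1` merge into one (`e2`).
    have e0 : ∀ M ∈ (pathVectors_finite (braidWord A B j i)).toFinset.filter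
        (fun M => M A.length = M (A.length + 2)),
        mutateString A.length α β s M * (mutateTorus A.length x H (.ofAdd M) : X) =
          s (exchange A.length M) * x (.ofAdd (exchange A.length M)) := by
      intro M hM
      have hM := (Finset.mem_filter.1 hM).2
      rw [mutateString_zero hM, mutateTorus_apply, degree_apply, hM, sub_self, zpow_zero, one_mul,
        tropical_apply]
      rw [exchange, hM, show M (A.length + 2) + M (A.length + 1) - M (A.length + 2) =
        M (A.length + 1) by ring]
    have e1 : ∀ M ∈ (pathVectors_finite (braidWord A B j i)).toFinset.filter
        (fun M => M A.length = M (A.length + 2) + 1),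
        mutateString A.length α β s M * (mutateTorus A.length x H (.ofAdd M) : X) =
          s (splitLow A.length M) * x (.ofAdd (splitLow A.length M)) +
          s (splitUp A.length M) * x (.ofAdd (splitUp A.length M)) := by
      intro M hM
      have hmem := (Set.Finite.mem_toFinset _).1 (Finset.mem_filter.1 hM).1
      have hM := (Finset.mem_filter.1 hM).2
      have hc := law'.cases M hmem
      have f1 := mutateString_sing (α := α) (β := β) (s := s) hM
      have f2 := mutateString_sing' h hs hl hαβ hM (law'.splitLow_mem M hmem hM)
        (law'.splitUp_mem M hmem hM)
      have f3 : tropical A.length M = splitUp A.length M := by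
        rw [tropical_apply, splitUp]
        congr 1 <;> omega
      have f4 : splitLow A.length M = splitUp A.length M - direction A.length := by
        rw [eq_sub_iff_add_eq, splitLow, splitUp, patch_add_direction]
        norm_num
      rw [mutateTorus_apply, degree_apply, f3, show M A.length - M (A.length + 2) = 1 by omega,
        zpow_one, Units.val_mul, hH]
      rw [f4, hsub, ← f4]
      set y : X := ((x (.ofAdd (- direction A.length)) : Xˣ) : X)
      set y₀ : X := ((x (.ofAdd (splitUp A.length M)) : Xˣ) : X)
      linear_combination (α * y₀) * f1 + (β * y * y₀) * f2 +
        (s (splitUp A.length M) * y₀) * α.inv_mul + (s (splitLow A.length M) * y * y₀) * β.inv_mul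
    have e2 : ∀ M ∈ (pathVectors_finite (braidWord A B i j)).toFinset.filter
        (fun M => M A.length = M (A.length + 2) + 1),
        s M * x (.ofAdd M) =
          mutateString A.length α β s (splitLow A.length M) *
            (mutateTorus A.length x H (.ofAdd (splitLow A.length M)) : X) +
          mutateString A.length α β s (splitUp A.length M) *
            (mutateTorus A.length x H (.ofAdd (splitUp A.length M)) : X) := by
      intro M hM
      have hmem := (Set.Finite.mem_toFinset _).1 (Finset.mem_filter.1 hM).1
      have hM := (Finset.mem_filter.1 hM).2
      have hc := law.cases M hmem
      have k1 : mergeLow A.length (splitLow A.length M) = M := by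
        rw [splitLow, mergeLow, patch_patch, patch_one]
        exact patch_eq_self rfl (by omega) (by omega)
      have k2 : mergeUp A.length (splitUp A.length M) = M := by
        rw [splitUp, mergeUp, patch_patch, patch_one]
        exact patch_eq_self (by omega) (by omega) (by omega)
      have k3 : tropical A.length (splitLow A.length M) = M := by
        rw [tropical_apply, splitLow, patch_patch, patch_zero, patch_one, patch_two]
        exact patch_eq_self rfl (by omega) (by omega)
      have k4 : tropical A.length (splitUp A.length M) = M - direction A.length := by
        rw [eq_sub_iff_add_eq, tropical_apply, splitUp, patch_patch, patch_zero, patch_one,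
          patch_two, patch_add_direction]
        exact patch_eq_self (by omega) (by omega) (by omega)
      rw [mutateString_low (by rw [splitLow, patch_zero]) (by rw [splitLow, patch_two]),
        mutateString_up (by rw [splitUp, patch_zero]) (by rw [splitUp, patch_two]), k1, k2,
        mutateTorus_apply, mutateTorus_apply, k3, k4, degree_apply, degree_apply, splitLow,
        splitUp, patch_zero, patch_two, patch_zero, patch_two, sub_zero,
        show (0 : ℤ) - 1 = -1 by norm_num, zpow_neg, zpow_one, Units.val_mul, Units.val_mul, hsub]
      linear_combination (- s M * x (.ofAdd M)) * hHinv
    rw [Finset.sum_congr rfl e0, Finset.sum_congr rfl e1, Finset.sum_congr rfl e2,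
      Finset.sum_add_distrib, Finset.sum_add_distrib]
    ring

end Words

end MutationSum

/-! ### The families over the parameter rings -/

section Families

variable {n : ℕ} {X : Type} [CommRing X]

theorem sum_inequalityIndex (w : List (Fin n)) (f : InequalityIndex w → X) (F : ℕ → X)
    (G : (ℕ → ℤ) → X) (hF : ∀ t : Fin w.length, f (Sum.inl t) = F t)
    (hG : ∀ p : stringExponents w, f (Sum.inr p) = G (extendZero p.1)) :
    ∑ d, f d = ∑ t ∈ Finset.range w.length, F t +
      ∑ M ∈ (pathVectors_finite w).toFinset, G M := by
  classical
  letI : Fintype (stringExponents w) := (stringExponents_finite w).fintype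
  have h1 : ∑ d, f d = @Finset.sum _ _ _ (@Finset.univ _ (instFintypeSum _ _)) f := by
    congr!
  rw [h1, Fintype.sum_sum_type, Finset.sum_range]
  congr 1
  · exact Finset.sum_congr rfl fun t _ => hF t
  · have h2 : (pathVectors_finite w).toFinset =
        Finset.univ.image fun p : stringExponents w => extendZero p.1 := by
      ext M
      simp only [Set.Finite.mem_toFinset, Finset.mem_image, Finset.mem_univ, true_and]
      constructor
      · intro hM
        exact ⟨⟨_, restrict_mem w hM⟩,
          extendZero_restrict fun r hr => pathVectors_eq_zero hM hr⟩
      · rintro ⟨p, rfl⟩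
        exact extendZero_mem_pathVectors.2 p.2
    rw [h2, Finset.sum_image fun p _ q _ h => Subtype.ext (extendZero_injective h)]
    exact Finset.sum_congr rfl fun p _ => hG p

/-- Evaluation of the universal polynomial. -/
theorem map_universalPolynomial (w : List (Fin n))
    (g : LaurentRing (ParamRing w) (Fin w.length) →+* X) (θ : ParamRing w →+* X)
    (x : Multiplicative (ℕ → ℤ) →* Xˣ)
    (hg : ∀ m c, g (AddMonoidAlgebra.single m c) = θ c * x (.ofAdd (extendZero m))) :
    g (universalPolynomial w) = 1 - inequalitySum w (fun M => θ (stringCoeff w M))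
      (fun t => θ (lambdaCoeff w t)) x := by
  rw [universalPolynomial, map_sub, map_one, map_sum, inequalitySum]
  congr 1
  refine sum_inequalityIndex w _ _ _ (fun t => ?_) fun p => ?_
  · rw [hg, lambdaCoeff_val, exponent, extendZero_lambdaExponent]
  · rw [hg, stringCoeff_extendZero, exponent]

/-- The coordinates of the torus as functions on the family. -/
noncomputable def coordinate (w : List (Fin n)) :
    Multiplicative (ℕ → ℤ) →* (FamilyRing w)ˣ :=
  MonoidHom.toHomUnits
    { toFun := fun M => Ideal.Quotient.mk (Ideal.span {universalPolynomial w})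
        (AddMonoidAlgebra.single (fun r : Fin w.length => M.toAdd r) 1)
      map_one' := map_one (Ideal.Quotient.mk (Ideal.span {universalPolynomial w}))
      map_mul' := fun M M' => by
        rw [← map_mul, AddMonoidAlgebra.single_mul_single, one_mul]
        rfl }

theorem coordinate_val (w : List (Fin n)) (M : ℕ → ℤ) :
    (coordinate w (.ofAdd M) : FamilyRing w) =
      Ideal.Quotient.mk (Ideal.span {universalPolynomial w})
        (AddMonoidAlgebra.single (fun r : Fin w.length => M r) 1) := rfl

theorem restrict_extendZero {N : ℕ} (m : Fin N → ℤ) : (fun r : Fin N => extendZero m r) = m :=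
  funext fun r => extendZero_val m r

theorem mk_single (w : List (Fin n)) (m : Fin w.length → ℤ) (c : ParamRing w) :
    Ideal.Quotient.mk (Ideal.span {universalPolynomial w}) (AddMonoidAlgebra.single m c) =
      algebraMap (ParamRing w) (FamilyRing w) c * coordinate w (.ofAdd (extendZero m)) := by
  rw [coordinate_val, restrict_extendZero]
  change _ = Ideal.Quotient.mk _ (algebraMap (ParamRing w) _ c) * _
  rw [← map_mul, AddMonoidAlgebra.coe_algebraMap]
  simp [AddMonoidAlgebra.single_mul_single]

/-- The defining equation of the family. -/
theorem inequalitySum_coordinate (w : List (Fin n)) :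
    inequalitySum w (fun M => algebraMap (ParamRing w) (FamilyRing w) (stringCoeff w M))
      (fun t => algebraMap (ParamRing w) (FamilyRing w) (lambdaCoeff w t)) (coordinate w) = 1 := by
  have h := map_universalPolynomial w (Ideal.Quotient.mk (Ideal.span {universalPolynomial w}))
    (algebraMap (ParamRing w) (FamilyRing w)) (coordinate w) (mk_single w)
  rw [Ideal.Quotient.eq_zero_iff_mem.2 (Ideal.mem_span_singleton_self _)] at h
  exact (sub_eq_zero.1 h.symm).symm

theorem map_inequalitySum {Y : Type} [CommRing Y] (f : X →+* Y) (w : List (Fin n))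
    (s : (ℕ → ℤ) → X) (l : ℕ → X) (x : Multiplicative (ℕ → ℤ) →* Xˣ) :
    f (inequalitySum w s l x) = inequalitySum w (fun M => f (s M)) (fun t => f (l t))
      ((Units.map f.toMonoidHom).comp x) := by
  simp only [inequalitySum, map_add, map_sum, map_mul]
  rfl

/-- Extension by zero as a homomorphism. -/
def extendZeroHom (N : ℕ) : (Fin N → ℤ) →+ (ℕ → ℤ) where
  toFun := extendZero
  map_zero' := by funext r; simp [extendZero]
  map_add' m m' := by
    funext r
    simp only [extendZero, Pi.add_apply]
    split_ifs <;> simp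

/-- The homomorphism from the coordinate ring of the family that is given by a homomorphism of the
parameter ring and a point of the torus. -/
noncomputable def familyHom {w : List (Fin n)} (θ : ParamRing w →+* X)
    (x : Multiplicative (ℕ → ℤ) →* Xˣ)
    (h : inequalitySum w (fun M => θ (stringCoeff w M)) (fun t => θ (lambdaCoeff w t)) x = 1) :
    FamilyRing w →+* X :=
  Ideal.Quotient.lift (Ideal.span {universalPolynomial w})
    (AddMonoidAlgebra.liftNCRingHom θ
      ((Units.coeHom X).comp (x.comp (extendZeroHom w.length).toMultiplicative))
      fun _ _ => Commute.all _ _) <| by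
    intro p hp
    obtain ⟨q, rfl⟩ := Ideal.mem_span_singleton'.1 hp
    rw [map_mul, map_universalPolynomial w _ θ x, h, sub_self, mul_zero]
    intro m c
    exact AddMonoidAlgebra.liftNCRingHom_single _ _ _ _ _

section

variable {w : List (Fin n)} (θ : ParamRing w →+* X) (x : Multiplicative (ℕ → ℤ) →* Xˣ)
    (h : inequalitySum w (fun M => θ (stringCoeff w M)) (fun t => θ (lambdaCoeff w t)) x = 1)

theorem familyHom_algebraMap (c : ParamRing w) :
    familyHom θ x h (algebraMap (ParamRing w) (FamilyRing w) c) = θ c := by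
  have := AddMonoidAlgebra.liftNCRingHom_single θ
      ((Units.coeHom X).comp (x.comp (extendZeroHom w.length).toMultiplicative))
      (fun _ _ => Commute.all _ _) 0 c
  refine Eq.trans ?_ (this.trans ?_)
  · rfl
  · rw [ofAdd_zero, map_one, mul_one]

theorem familyHom_coordinate (m : Fin w.length → ℤ) :
    familyHom θ x h (coordinate w (.ofAdd (extendZero m))) = x (.ofAdd (extendZero m)) := by
  have := AddMonoidAlgebra.liftNCRingHom_single θ
      ((Units.coeHom X).comp (x.comp (extendZeroHom w.length).toMultiplicative))
      (fun _ _ => Commute.all _ _) m 1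
  rw [map_one, one_mul] at this
  rw [coordinate_val, restrict_extendZero]
  exact this

end

theorem familyHom_ext {w : List (Fin n)} {f g : FamilyRing w →+* X}
    (h₁ : ∀ c, f (algebraMap (ParamRing w) (FamilyRing w) c) =
      g (algebraMap (ParamRing w) (FamilyRing w) c))
    (h₂ : ∀ m : Fin w.length → ℤ, f (coordinate w (.ofAdd (extendZero m))) =
      g (coordinate w (.ofAdd (extendZero m)))) : f = g := by
  refine Ideal.Quotient.ringHom_ext (AddMonoidAlgebra.ringHom_ext ?_ ?_)
  · exact h₁
  · intro m
    have := h₂ m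
    rwa [coordinate_val, restrict_extendZero] at this

end Families

/-! ### The birational transformation of a braid move -/

section Transition

variable {n : ℕ} {X Y : Type} [CommRing X] [CommRing Y]

theorem map_mutateString (f : X →+* Y) (a : ℕ) (α β : Xˣ) (s : (ℕ → ℤ) → X) (M : ℕ → ℤ) :
    f (mutateString a α β s M) = mutateString a (Units.map f.toMonoidHom α)
      (Units.map f.toMonoidHom β) (fun M => f (s M)) M := by
  unfold mutateString
  split_ifs
  · rfl
  · exact map_mul f _ _
  · exact map_mul f _ _
  · exact map_mul f _ _

theorem map_mutateLambda (f : X →+* Y) (a : ℕ) (α β : Xˣ) (l : ℕ → X) (t : ℕ) :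
    f (mutateLambda a α β l t) = mutateLambda a (Units.map f.toMonoidHom α)
      (Units.map f.toMonoidHom β) (fun t => f (l t)) t := by
  unfold mutateLambda
  split_ifs
  · exact map_mul f _ _
  · exact map_mul f _ _
  · exact map_mul f _ _
  · rfl

theorem SolvesBoxes.map {w : List (Fin n)} {s : (ℕ → ℤ) → X} {l : ℕ → X} (h : SolvesBoxes w s l)
    (f : X →+* Y) : SolvesBoxes w (fun M => f (s M)) fun t => f (l t) := by
  intro t b M₁ h₁ M₂ h₂ hp
  rw [← map_mul, ← map_mul, h t b M₁ h₁ M₂ h₂ hp]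

theorem inequalitySum_congr {w : List (Fin n)} {s s' : (ℕ → ℤ) → X} {l l' : ℕ → X}
    (x : Multiplicative (ℕ → ℤ) →* Xˣ) (hs : ∀ M ∈ pathVectors w, s M = s' M)
    (hl : ∀ t < w.length, l t = l' t) : inequalitySum w s l x = inequalitySum w s' l' x := by
  unfold inequalitySum
  congr 1
  · exact Finset.sum_congr rfl fun t ht => by rw [hl t (Finset.mem_range.1 ht)]
  · exact Finset.sum_congr rfl fun M hM => by rw [hs M ((Set.Finite.mem_toFinset _).1 hM)]

/-- The binomial `α + β T^{-v}`, where `v` is the direction `(1, -1, 1)` at the crossings `a`,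
`a + 1` and `a + 2`, as a function on the family. -/
noncomputable def binomial (w : List (Fin n)) (a : ℕ) (α β : (ParamRing w)ˣ) : FamilyRing w :=
  algebraMap (ParamRing w) (FamilyRing w) α +
    algebraMap (ParamRing w) (FamilyRing w) β * coordinate w (.ofAdd (- direction a))

/-- The data of the transformation of the families under a braid move: a homomorphism of the
parameter rings which is given by mutation, and the coefficients of the binomials for both
directions of the move. -/
structure IsTransition (A B : List (Fin n)) (i j : Fin n) (α β : (ParamRing (braidWord A B i j))ˣ)
    (α' β' : (ParamRing (braidWord A B j i))ˣ)
    (θ : ParamRing (braidWord A B j i) →+* ParamRing (braidWord A B i j)) : Prop where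
  adjacent : Adjacent i j
  law : LocalLaw A.length (pathVectors (braidWord A B i j)) (pathVectors (braidWord A B j i))
  law' : LocalLaw A.length (pathVectors (braidWord A B j i)) (pathVectors (braidWord A B i j))
  relation : α * lambdaCoeff (braidWord A B i j) (A.length + 2) =
    β * lambdaCoeff (braidWord A B i j) A.length
  map_string : ∀ M ∈ pathVectors (braidWord A B j i), θ (stringCoeff (braidWord A B j i) M) =
    mutateString A.length α β (stringCoeff (braidWord A B i j)) M
  map_lambda : ∀ t < (braidWord A B j i).length, θ (lambdaCoeff (braidWord A B j i) t) =
    mutateLambda A.length α β (lambdaCoeff (braidWord A B i j)) t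
  map_fst : θ α' = β
  map_snd : θ β' = α

/-- The torus coordinates in a ring over the coordinate ring of the family. -/
noncomputable def coordinateIn (w : List (Fin n)) (L : Type) [CommRing L] [Algebra (FamilyRing w) L] :
    Multiplicative (ℕ → ℤ) →* Lˣ :=
  (Units.map (algebraMap (FamilyRing w) L).toMonoidHom).comp (coordinate w)

/-- The structure morphism of the parameter ring into a ring over the coordinate ring of the
family. -/
noncomputable def paramIn (w : List (Fin n)) (L : Type) [CommRing L] [Algebra (FamilyRing w) L] :
    ParamRing w →+* L :=
  (algebraMap (FamilyRing w) L).comp (algebraMap (ParamRing w) (FamilyRing w))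

/-- The binomial as a unit in the localization. -/
noncomputable def binomialUnit (w : List (Fin n)) (a : ℕ) (α β : (ParamRing w)ˣ) (L : Type)
    [CommRing L] [Algebra (FamilyRing w) L] [IsLocalization.Away (binomial w a α β) L] : Lˣ :=
  (IsLocalization.Away.algebraMap_isUnit (S := L) (binomial w a α β)).unit

section

variable (w : List (Fin n)) (L : Type) [CommRing L] [Algebra (FamilyRing w) L]

theorem binomialUnit_val (a : ℕ) (α β : (ParamRing w)ˣ)
    [IsLocalization.Away (binomial w a α β) L] : (binomialUnit w a α β L : L) =
      paramIn w L α + paramIn w L β * coordinateIn w L (.ofAdd (- direction a)) := by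
  change algebraMap (FamilyRing w) L (binomial w a α β) = _
  rw [binomial, map_add, map_mul]
  rfl

theorem inequalitySum_coordinateIn :
    inequalitySum w (fun M => paramIn w L (stringCoeff w M))
      (fun t => paramIn w L (lambdaCoeff w t)) (coordinateIn w L) = 1 := by
  have := congrArg (algebraMap (FamilyRing w) L) (inequalitySum_coordinate w)
  rw [map_inequalitySum, map_one] at this
  exact this

end

variable {A B : List (Fin n)} {i j : Fin n} {α β : (ParamRing (braidWord A B i j))ˣ}
    {α' β' : (ParamRing (braidWord A B j i))ˣ}
    {θ : ParamRing (braidWord A B j i) →+* ParamRing (braidWord A B i j)}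
    {θ' : ParamRing (braidWord A B i j) →+* ParamRing (braidWord A B j i)}
    (L L' : Type) [CommRing L] [CommRing L'] [Algebra (FamilyRing (braidWord A B i j)) L]
    [Algebra (FamilyRing (braidWord A B j i)) L']
    [IsLocalization.Away (binomial (braidWord A B i j) A.length α β) L]
    [IsLocalization.Away (binomial (braidWord A B j i) A.length α' β') L']

/-- The transformed coefficients and torus coordinates satisfy the defining equation of the family of
the new word. -/
theorem inequalitySum_transition (T : IsTransition A B i j α β α' β' θ) :
    inequalitySum (braidWord A B j i)
      (fun M => (paramIn (braidWord A B i j) L).comp θ (stringCoeff (braidWord A B j i) M))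
      (fun t => (paramIn (braidWord A B i j) L).comp θ (lambdaCoeff (braidWord A B j i) t))
      (mutateTorus A.length (coordinateIn (braidWord A B i j) L)
        (binomialUnit (braidWord A B i j) A.length α β L)) = 1 := by
  rw [← inequalitySum_coordinateIn (braidWord A B i j) L,
    ← inequalitySum_mutate T.adjacent T.law T.law'
      ((solvesBoxes_coeff _).map (paramIn (braidWord A B i j) L))
      ((lambdaCoeff_isUnit _ _).map _)
      (α := Units.map (paramIn (braidWord A B i j) L).toMonoidHom α)
      (β := Units.map (paramIn (braidWord A B i j) L).toMonoidHom β) _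
      (coordinateIn (braidWord A B i j) L) (binomialUnit (braidWord A B i j) A.length α β L)
      (binomialUnit_val _ _ _ _ _)]
  · refine inequalitySum_congr _ (fun M hM => ?_) fun t ht => ?_
    · rw [RingHom.comp_apply, T.map_string M hM, map_mutateString]
    · rw [RingHom.comp_apply, T.map_lambda t ht, map_mutateLambda]
  · have := congrArg (paramIn (braidWord A B i j) L) T.relation
    rwa [map_mul, map_mul] at this

theorem eq_extendZero {N : ℕ} {M : ℕ → ℤ} (h : ∀ r, N ≤ r → M r = 0) :
    ∃ m : Fin N → ℤ, M = extendZero m := ⟨_, (extendZero_restrict h).symm⟩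

theorem direction_eq_zero {a r : ℕ} (h : a + 3 ≤ r) : direction a r = 0 :=
  patch_other (by omega) _ _ _ _

theorem tropical_eq_zero {a r N : ℕ} {M : ℕ → ℤ} (hM : ∀ r, N ≤ r → M r = 0) (ha : a + 3 ≤ N)
    (hr : N ≤ r) : tropical a M r = 0 := by
  rw [tropical_apply, patch_other (by omega)]
  exact hM r hr

/-- The substitution of a braid move, as a homomorphism of the localized coordinate rings. -/
theorem IsTransition.exists_hom (T : IsTransition A B i j α β α' β' θ) :
    ∃ Φ : L' →+* L,
      (∀ c, Φ (paramIn (braidWord A B j i) L' c) = paramIn (braidWord A B i j) L (θ c)) ∧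
      (∀ M : ℕ → ℤ, (∀ r, (braidWord A B j i).length ≤ r → M r = 0) →
        Units.map Φ.toMonoidHom (coordinateIn (braidWord A B j i) L' (.ofAdd M)) =
          mutateTorus A.length (coordinateIn (braidWord A B i j) L)
            (binomialUnit (braidWord A B i j) A.length α β L) (.ofAdd M)) ∧
      Units.map Φ.toMonoidHom (binomialUnit (braidWord A B j i) A.length α' β' L') =
        binomialUnit (braidWord A B i j) A.length α β L *
          coordinateIn (braidWord A B i j) L (.ofAdd (direction A.length)) := by
  have hlen' := length_braidWord (A := A) (B := B) (i := j) (j := i)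
  set φ := familyHom _ _ (inequalitySum_transition L T) with hφ
  have hc : ∀ c, φ (algebraMap _ _ c) = paramIn (braidWord A B i j) L (θ c) :=
    familyHom_algebraMap _ _ _
  have hM : ∀ M : ℕ → ℤ, (∀ r, (braidWord A B j i).length ≤ r → M r = 0) →
      φ (coordinate (braidWord A B j i) (.ofAdd M)) =
      mutateTorus A.length (coordinateIn (braidWord A B i j) L)
            (binomialUnit (braidWord A B i j) A.length α β L) (.ofAdd M) := by
    intro M hM
    obtain ⟨m, rfl⟩ := eq_extendZero hM
    exact familyHom_coordinate _ _ _ m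
  have hb : φ (binomial (braidWord A B j i) A.length α' β') =
      ((binomialUnit (braidWord A B i j) A.length α β L *
          coordinateIn (braidWord A B i j) L (.ofAdd (direction A.length)) : Lˣ) : L) := by
    rw [binomial, map_add, map_mul, hc, hc, hM, T.map_fst, T.map_snd, mutateTorus_apply, map_neg,
      map_neg, degree_direction, neg_zero, zpow_zero, one_mul, tropical_direction, neg_neg,
      Units.val_mul, binomialUnit_val, add_mul, mul_assoc, ← Units.val_mul, ← map_mul, ← ofAdd_add,
      neg_add_cancel, ofAdd_zero, map_one, Units.val_one, mul_one, add_comm]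
    intro r hr
    rw [Pi.neg_apply, direction_eq_zero (by omega), neg_zero]
  refine ⟨IsLocalization.Away.lift (binomial (braidWord A B j i) A.length α' β') (g := φ)
    (by rw [hb]; exact Units.isUnit _), fun c => ?_, fun M h => ?_, ?_⟩
  · exact (IsLocalization.Away.lift_eq _ _ _).trans (hc c)
  · exact Units.ext ((IsLocalization.Away.lift_eq _ _ _).trans (hM M h))
  · exact Units.ext ((IsLocalization.Away.lift_eq _ _ _).trans hb)

theorem localization_hom_ext {w : List (Fin n)} {a : ℕ} {α β : (ParamRing w)ˣ} {L X : Type}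
    [CommRing L] [CommRing X] [Algebra (FamilyRing w) L]
    [IsLocalization.Away (binomial w a α β) L] {f g : L →+* X}
    (h₁ : ∀ c, f (paramIn w L c) = g (paramIn w L c))
    (h₂ : ∀ m : Fin w.length → ℤ, f (coordinateIn w L (.ofAdd (extendZero m))) =
      g (coordinateIn w L (.ofAdd (extendZero m)))) : f = g :=
  IsLocalization.ringHom_ext (Submonoid.powers (binomial w a α β)) (familyHom_ext h₁ h₂)

/-- The substitutions for a braid move and for its inverse cancel. -/
theorem IsTransition.comp_eq_id {Φ : L' →+* L} {Φ' : L →+* L'} (hθ : ∀ c, θ (θ' c) = c)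
    (h₁ : ∀ c, Φ (paramIn (braidWord A B j i) L' c) = paramIn (braidWord A B i j) L (θ c))
    (h₂ : ∀ M : ℕ → ℤ, (∀ r, (braidWord A B j i).length ≤ r → M r = 0) →
        Units.map Φ.toMonoidHom (coordinateIn (braidWord A B j i) L' (.ofAdd M)) =
          mutateTorus A.length (coordinateIn (braidWord A B i j) L)
            (binomialUnit (braidWord A B i j) A.length α β L) (.ofAdd M))
    (h₃ : Units.map Φ.toMonoidHom (binomialUnit (braidWord A B j i) A.length α' β' L') =
        binomialUnit (braidWord A B i j) A.length α β L *
          coordinateIn (braidWord A B i j) L (.ofAdd (direction A.length)))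
    (h₁' : ∀ c, Φ' (paramIn (braidWord A B i j) L c) = paramIn (braidWord A B j i) L' (θ' c))
    (h₂' : ∀ M : ℕ → ℤ, (∀ r, (braidWord A B i j).length ≤ r → M r = 0) →
        Units.map Φ'.toMonoidHom (coordinateIn (braidWord A B i j) L (.ofAdd M)) =
          mutateTorus A.length (coordinateIn (braidWord A B j i) L')
            (binomialUnit (braidWord A B j i) A.length α' β' L') (.ofAdd M)) :
    Φ.comp Φ' = RingHom.id L := by
  have hlen := length_braidWord (A := A) (B := B) (i := i) (j := j)
  have hlen' := length_braidWord (A := A) (B := B) (i := j) (j := i)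
  refine localization_hom_ext (w := braidWord A B i j) (a := A.length) (α := α) (β := β)
    (fun c => ?_) fun m => ?_
  · rw [RingHom.comp_apply, h₁', h₁, hθ]
    rfl
  · have hm : ∀ r, (braidWord A B i j).length ≤ r → extendZero m r = 0 := by
      intro r hr
      rw [extendZero, dif_neg (by omega)]
    have key : Units.map Φ.toMonoidHom (Units.map Φ'.toMonoidHom
        (coordinateIn (braidWord A B i j) L (.ofAdd (extendZero m)))) =
        coordinateIn (braidWord A B i j) L (.ofAdd (extendZero m)) := by
      rw [h₂' _ hm, mutateTorus_apply, map_mul, map_zpow, h₃,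
        h₂ _ (fun r hr => tropical_eq_zero hm (by omega) (by omega)), mutateTorus_apply,
        degree_tropical, mul_zpow, zpow_neg, mul_mul_mul_comm, mul_inv_cancel, one_mul, ← map_zpow,
        ← ofAdd_zsmul, ← map_mul, ← ofAdd_add, add_comm, tropical_tropical]
    exact congrArg Units.val key

/-- The localized coordinate rings of two families that are related by a braid move are
isomorphic. -/
theorem IsTransition.exists_equiv (T : IsTransition A B i j α β α' β' θ)
    (T' : IsTransition A B j i α' β' α β θ') (hθ : ∀ c, θ (θ' c) = c) (hθ' : ∀ c, θ' (θ c) = c) :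
    ∃ Φ : L' ≃+* L,
      ∀ c, Φ (paramIn (braidWord A B j i) L' c) = paramIn (braidWord A B i j) L (θ c) := by
  obtain ⟨Φ, h₁, h₂, h₃⟩ := T.exists_hom L L'
  obtain ⟨Φ', h₁', h₂', h₃'⟩ := T'.exists_hom L' L
  exact ⟨RingEquiv.ofRingHom Φ Φ'
    (IsTransition.comp_eq_id L L' hθ h₁ h₂ h₃ h₁' h₂')
    (IsTransition.comp_eq_id L' L hθ' h₁' h₂' h₃' h₁ h₂), h₁⟩

end Transition

/-! ### Existence of the transformation of a braid move -/

section Existence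

variable {n : ℕ} {R : Type} [CommRing R]

theorem mutateString_congr {a : ℕ} {α β : Rˣ} {S S' : Set (ℕ → ℤ)} (law : LocalLaw a S S')
    {s s' : (ℕ → ℤ) → R} (h : ∀ M ∈ S', s M = s' M) {M : ℕ → ℤ} (hM : M ∈ S) :
    mutateString a α β s M = mutateString a α β s' M := by
  rcases law.cases M hM with c | c | c | c
  · rw [mutateString_zero c, mutateString_zero c, h _ (law.exchange_mem M hM c)]
  · rw [mutateString_low c.1 c.2.1, mutateString_low c.1 c.2.1,
      h _ (law.mergeLow_mem M hM c.1 c.2.1)]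
  · rw [mutateString_up c.1 c.2.1, mutateString_up c.1 c.2.1,
      h _ (law.mergeUp_mem M hM c.1 c.2.1)]
  · rw [mutateString_sing c.1, mutateString_sing c.1, h _ (law.splitUp_mem M hM c.1)]

theorem mutateLambda_congr {a N : ℕ} {α β : Rˣ} {l l' : ℕ → R} (ha : a + 3 ≤ N)
    (h : ∀ t < N, l t = l' t) {t : ℕ} (ht : t < N) :
    mutateLambda a α β l t = mutateLambda a α β l' t := by
  unfold mutateLambda
  rw [h a (by omega), h (a + 1) (by omega), h t ht]

theorem isUnit_mutateString {a : ℕ} {α β : Rˣ} {s : (ℕ → ℤ) → R} (hs : ∀ M, IsUnit (s M))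
    (M : ℕ → ℤ) : IsUnit (mutateString a α β s M) := by
  unfold mutateString
  split_ifs
  · exact hs _
  · exact α.isUnit.mul (hs _)
  · exact β.isUnit.mul (hs _)
  · exact α⁻¹.isUnit.mul (hs _)

theorem isUnit_mutateLambda {a : ℕ} {α β : Rˣ} {l : ℕ → R} (hl : ∀ t, IsUnit (l t)) (t : ℕ) :
    IsUnit (mutateLambda a α β l t) := by
  unfold mutateLambda
  split_ifs
  · exact β.isUnit.mul (hl _)
  · exact α⁻¹.isUnit.mul (hl _)
  · exact α.isUnit.mul (hl _)
  · exact hl _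

variable {A B : List (Fin n)} {i j : Fin n} {α β : (ParamRing (braidWord A B i j))ˣ}
    {α' β' : (ParamRing (braidWord A B j i))ˣ}

/-- Mutation of the coefficients, as a homomorphism of the parameter rings. -/
theorem exists_mutationHom (h : Adjacent i j) (hw : IsAscending (braidWord A B i j))
    (hw' : IsAscending (braidWord A B j i))
    (hαβ : α * lambdaCoeff (braidWord A B i j) (A.length + 2) =
      β * lambdaCoeff (braidWord A B i j) A.length) :
    ∃ θ : ParamRing (braidWord A B j i) →ₐ[ℂ] ParamRing (braidWord A B i j),
      (∀ M ∈ pathVectors (braidWord A B j i), θ (stringCoeff (braidWord A B j i) M) =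
        mutateString A.length α β (stringCoeff (braidWord A B i j)) M) ∧
      ∀ t < (braidWord A B j i).length, θ (lambdaCoeff (braidWord A B j i) t) =
        mutateLambda A.length α β (lambdaCoeff (braidWord A B i j)) t := by
  have key := SolvesBoxes.mutate h hw' (localLaw h.symm hw' hw) (solvesBoxes_coeff _)
    (lambdaCoeff_isUnit _ _) hαβ
  refine ⟨paramHom
    (fun M => (isUnit_mutateString (a := A.length) (α := α) (β := β)
      (stringCoeff_isUnit (braidWord A B i j)) M).unit)
    (fun t => (isUnit_mutateLambda (a := A.length) (α := α) (β := β)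
      (lambdaCoeff_isUnit (braidWord A B i j)) t).unit) key,
    fun M hM => paramHom_stringCoeff _ _ key hM, fun t ht => paramHom_lambdaCoeff _ _ key ht⟩

/-- The mutations of the parameters for a braid move and for its inverse cancel. -/
theorem IsTransition.comp_eq {θ : ParamRing (braidWord A B j i) →ₐ[ℂ] ParamRing (braidWord A B i j)}
    {θ' : ParamRing (braidWord A B i j) →ₐ[ℂ] ParamRing (braidWord A B j i)}
    (T : IsTransition A B i j α β α' β' θ.toRingHom)
    (T' : IsTransition A B j i α' β' α β θ'.toRingHom) (c : ParamRing (braidWord A B i j)) :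
    θ (θ' c) = c := by
  have hlen := length_braidWord (A := A) (B := B) (i := i) (j := j)
  have hlen' := length_braidWord (A := A) (B := B) (i := j) (j := i)
  have e1 : Units.map θ.toRingHom.toMonoidHom α' = β := Units.ext T.map_fst
  have e2 : Units.map θ.toRingHom.toMonoidHom β' = α := Units.ext T.map_snd
  refine DFunLike.congr_fun (paramHom_ext (f := θ.comp θ') (g := AlgHom.id ℂ _)
    (fun M hM => ?_) fun t ht => ?_) c
  · refine (congrArg θ (T'.map_string M hM)).trans ?_
    refine (map_mutateString θ.toRingHom _ _ _ _ _).trans ?_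
    rw [e1, e2, mutateString_congr T.law T.map_string hM,
      mutateString_mutateString T.adjacent T.law T.law' (solvesBoxes_coeff _)
        (lambdaCoeff_isUnit _ _) T.relation hM]
    rfl
  · refine (congrArg θ (T'.map_lambda t ht)).trans ?_
    refine (map_mutateLambda θ.toRingHom _ _ _ _ _).trans ?_
    rw [e1, e2, mutateLambda_congr (N := (braidWord A B j i).length) (by omega) T.map_lambda
      (by omega), mutateLambda_mutateLambda T.relation]
    rfl

/-- For a braid move between words in which no two strings cross twice there is a transformation
of the families together with its inverse. -/
theorem exists_transition (h : Adjacent i j) (hw : IsAscending (braidWord A B i j))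
    (hw' : IsAscending (braidWord A B j i)) :
    ∃ (α β : (ParamRing (braidWord A B i j))ˣ) (α' β' : (ParamRing (braidWord A B j i))ˣ)
      (e : ParamRing (braidWord A B j i) ≃ₐ[ℂ] ParamRing (braidWord A B i j)),
      IsTransition A B i j α β α' β' e.toAlgHom.toRingHom ∧
        IsTransition A B j i α' β' α β e.symm.toAlgHom.toRingHom := by
  have hlen := length_braidWord (A := A) (B := B) (i := i) (j := j)
  have hlen' := length_braidWord (A := A) (B := B) (i := j) (j := i)
  obtain ⟨l, hl⟩ : ∃ l : ℕ → (ParamRing (braidWord A B i j))ˣ,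
      ∀ t, l t = lambdaCoeff (braidWord A B i j) t :=
    ⟨fun t => (lambdaCoeff_isUnit _ t).unit, fun t => rfl⟩
  obtain ⟨l', hl'⟩ : ∃ l : ℕ → (ParamRing (braidWord A B j i))ˣ,
      ∀ t, l t = lambdaCoeff (braidWord A B j i) t :=
    ⟨fun t => (lambdaCoeff_isUnit _ t).unit, fun t => rfl⟩
  set a := A.length with ha
  -- `α` and `β` are determined up to a common unit; this normalization makes the mutation map
  -- `α'` to `β` and `β'` to `α`, and its inverse map `α` to `β'` and `β` to `α'`
  set α : (ParamRing (braidWord A B i j))ˣ := 1 with hα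
  set β := l (a + 2) * (l a)⁻¹ with hβ
  set α' := l' a * (l' (a + 2))⁻¹ with hα'
  set β' : (ParamRing (braidWord A B j i))ˣ := 1 with hβ'
  have r : (α : ParamRing (braidWord A B i j)) * lambdaCoeff (braidWord A B i j) (a + 2) =
      β * lambdaCoeff (braidWord A B i j) a := by
    rw [← hl, ← hl, ← Units.val_mul, ← Units.val_mul, hβ, inv_mul_cancel_right, hα, one_mul]
  have r' : (α' : ParamRing (braidWord A B j i)) * lambdaCoeff (braidWord A B j i) (a + 2) =
      β' * lambdaCoeff (braidWord A B j i) a := by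
    rw [← hl', ← hl', ← Units.val_mul, ← Units.val_mul, hα', inv_mul_cancel_right, hβ', one_mul]
  obtain ⟨θ, hs, ht⟩ := exists_mutationHom h hw hw' r
  obtain ⟨θ', hs', ht'⟩ := exists_mutationHom h.symm hw' hw r'
  have u₁ : Units.map θ.toRingHom.toMonoidHom (l' a) = β * l (a + 1) := Units.ext <| by
    refine (congrArg θ (hl' a)).trans ((ht _ (by omega)).trans ?_)
    rw [mutateLambda_zero]
    exact congrArg (β.1 * ·) (hl _).symm
  have u₂ : Units.map θ.toRingHom.toMonoidHom (l' (a + 2)) = α * l (a + 1) := Units.ext <| by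
    refine (congrArg θ (hl' _)).trans ((ht _ (by omega)).trans ?_)
    rw [mutateLambda_two]
    exact congrArg (α.1 * ·) (hl _).symm
  have u₁' : Units.map θ'.toRingHom.toMonoidHom (l a) = β' * l' (a + 1) := Units.ext <| by
    refine (congrArg θ' (hl a)).trans ((ht' _ (by omega)).trans ?_)
    rw [mutateLambda_zero]
    exact congrArg (β'.1 * ·) (hl' _).symm
  have u₂' : Units.map θ'.toRingHom.toMonoidHom (l (a + 2)) = α' * l' (a + 1) := Units.ext <| by
    refine (congrArg θ' (hl _)).trans ((ht' _ (by omega)).trans ?_)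
    rw [mutateLambda_two]
    exact congrArg (α'.1 * ·) (hl' _).symm
  have law := localLaw h hw hw'
  have law' := localLaw h.symm hw' hw
  have T : IsTransition A B i j α β α' β' θ.toRingHom :=
    { adjacent := h
      law := law
      law' := law'
      relation := r
      map_string := hs
      map_lambda := ht
      map_fst := by
        refine congrArg Units.val (?_ : Units.map θ.toRingHom.toMonoidHom α' = β)
        rw [hα', map_mul, map_inv, u₁, u₂, hα, one_mul, mul_inv_cancel_right]
      map_snd := map_one θ }
  have T' : IsTransition A B j i α' β' α β θ'.toRingHom :=
    { adjacent := h.symm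
      law := law'
      law' := law
      relation := r'
      map_string := hs'
      map_lambda := ht'
      map_fst := map_one θ'
      map_snd := by
        refine congrArg Units.val (?_ : Units.map θ'.toRingHom.toMonoidHom β = α')
        rw [hβ, map_mul, map_inv, u₁', u₂', hβ', one_mul, mul_inv_cancel_right] }
  exact ⟨α, β, α', β', AlgEquiv.ofAlgHom θ θ' (AlgHom.ext fun c => T.comp_eq T' c)
    (AlgHom.ext fun c => T'.comp_eq T c), T, T'⟩

end Existence

/-! ### The binomial is a non-zero-divisor on the fibres -/

section Density

/-- The binomial `α + β T^{-v}` is a non-zero-divisor modulo `P`, since the restriction of `P` to its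
zero locus has the constant term `1`: no exponent is a multiple of `v`. -/
theorem dvd_of_dvd_binomial_mul {N : ℕ} {K : Type} [Field K] {v : Fin N → ℤ} {r : Fin N}
    (hv : v r = 1) {α β : K} (hα : α ≠ 0) (hβ : β ≠ 0) {D : Type} [Fintype D]
    {e : D → Fin N → ℤ} (he : ∀ d, e d ≠ e d r • v) (c : D → K) {P x : LaurentRing K (Fin N)}
    (hP : P = 1 - ∑ d, AddMonoidAlgebra.single (e d) (c d))
    (h : P ∣ (AddMonoidAlgebra.single 0 α + AddMonoidAlgebra.single (-v) β) * x) : P ∣ x := by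
  classical
  set H : LaurentRing K (Fin N) := AddMonoidAlgebra.single 0 α + AddMonoidAlgebra.single (-v) β
    with hH
  set z := -(β / α) with hz
  have hz0 : z ≠ 0 := neg_ne_zero.2 (div_ne_zero hβ hα)
  -- On the hypersurface `H = 0` the monomial `T^v` is the constant `z`; so `φ` below describes
  -- the restriction to this hypersurface.
  let φ : LaurentRing K (Fin N) →ₐ[K] LaurentRing K (Fin N) :=
    AddMonoidAlgebra.lift K (LaurentRing K (Fin N)) (Fin N → ℤ)
      { toFun := fun m => AddMonoidAlgebra.single (m.toAdd - m.toAdd r • v) (z ^ m.toAdd r)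
        map_one' := by
          rw [toAdd_one, Pi.zero_apply, zero_smul, sub_zero, zpow_zero, AddMonoidAlgebra.one_def]
        map_mul' := fun m m' => by
          rw [AddMonoidAlgebra.single_mul_single, toAdd_mul, Pi.add_apply, zpow_add₀ hz0, add_smul,
            add_sub_add_comm] }
  have hφ : ∀ m k, φ (AddMonoidAlgebra.single m k) =
      AddMonoidAlgebra.single (m - m r • v) (k * z ^ m r) := by
    intro m k
    refine (AddMonoidAlgebra.lift_single _ _ _).trans ?_
    rw [MonoidHom.coe_mk, OneHom.coe_mk, AddMonoidAlgebra.smul_single, smul_eq_mul, toAdd_ofAdd]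
  have hH0 : φ H = 0 := by
    rw [hH, map_add, hφ, hφ, Pi.zero_apply, zero_smul, Pi.neg_apply, hv, neg_smul, one_smul,
      sub_self, sub_self, ← AddMonoidAlgebra.single_add, zpow_zero, zpow_neg_one, hz]
    rw [show α * 1 + β * (-(β / α))⁻¹ = 0 by field_simp; ring, AddMonoidAlgebra.single_zero]
  have hmk : ∀ f, Ideal.Quotient.mk (Ideal.span {H}) (φ f) = Ideal.Quotient.mk (Ideal.span {H}) f := by
    let f₁ : Multiplicative ℤ →* LaurentRing K (Fin N) ⧸ Ideal.span {H} :=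
      { toFun := fun k => Ideal.Quotient.mk _ (AddMonoidAlgebra.single (k.toAdd • v) 1)
        map_one' := by rw [toAdd_one, zero_smul, ← AddMonoidAlgebra.one_def, map_one]
        map_mul' := fun k k' => by
          rw [← map_mul, AddMonoidAlgebra.single_mul_single, toAdd_mul, add_smul, one_mul] }
    let f₂ : Multiplicative ℤ →* LaurentRing K (Fin N) ⧸ Ideal.span {H} :=
      { toFun := fun k => Ideal.Quotient.mk _ (AddMonoidAlgebra.single 0 (z ^ k.toAdd))
        map_one' := by rw [toAdd_one, zpow_zero, ← AddMonoidAlgebra.one_def, map_one]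
        map_mul' := fun k k' => by
          rw [← map_mul, AddMonoidAlgebra.single_mul_single, toAdd_mul, zpow_add₀ hz0, add_zero] }
    have h12 : f₁ = f₂ := by
      refine MonoidHom.ext_mint (Ideal.Quotient.eq.2 (Ideal.mem_span_singleton'.2
        ⟨AddMonoidAlgebra.single v α⁻¹, ?_⟩))
      rw [hH, mul_add, AddMonoidAlgebra.single_mul_single, AddMonoidAlgebra.single_mul_single,
        toAdd_ofAdd, one_smul, zpow_one, add_zero, add_neg_cancel, inv_mul_cancel₀ hα, hz,
        AddMonoidAlgebra.single_neg, sub_neg_eq_add, div_eq_inv_mul]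
    intro f
    refine RingHom.congr_fun (f := (Ideal.Quotient.mk (Ideal.span {H})).comp φ.toRingHom)
      (g := Ideal.Quotient.mk (Ideal.span {H})) (AddMonoidAlgebra.ringHom_ext (fun k => ?_) fun m => ?_) f
    · refine congrArg _ ((hφ 0 k).trans ?_)
      rw [Pi.zero_apply, zero_smul, sub_zero, zpow_zero, mul_one]
    · refine (congrArg _ (hφ m 1)).trans ?_
      have := DFunLike.congr_fun h12 (.ofAdd (m r))
      have h2 : (AddMonoidAlgebra.single m 1 : LaurentRing K (Fin N)) =
          AddMonoidAlgebra.single (m - m r • v) 1 * AddMonoidAlgebra.single (m r • v) 1 := by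
        rw [AddMonoidAlgebra.single_mul_single, sub_add_cancel, one_mul]
      rw [h2, map_mul]
      refine Eq.trans ?_ (congrArg _ this.symm)
      change _ = Ideal.Quotient.mk (Ideal.span {H}) _ * Ideal.Quotient.mk (Ideal.span {H}) _
      rw [← map_mul, AddMonoidAlgebra.single_mul_single, add_zero]
      rfl
  have hP0 : φ P ≠ 0 := by
    intro h0
    have h1 := congrArg (fun f : LaurentRing K (Fin N) => f.coeff 0) h0
    rw [hP, map_sub, map_one, map_sum] at h1
    simp only [hφ, AddMonoidAlgebra.one_def, AddMonoidAlgebra.coeff_sub,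
      AddMonoidAlgebra.coeff_sum, AddMonoidAlgebra.coeff_single, Finsupp.sub_apply,
      Finsupp.finsetSum_apply, AddMonoidAlgebra.coeff_zero, Finsupp.zero_apply,
      Finsupp.single_eq_same] at h1
    rw [Finset.sum_eq_zero, sub_zero] at h1
    · exact one_ne_zero h1
    · exact fun d _ => Finsupp.single_eq_of_ne fun h => he d (sub_eq_zero.1 h.symm)
  obtain ⟨y, hy⟩ := h
  have h1 : φ P * φ y = 0 := by rw [← map_mul, ← hy, map_mul, hH0, zero_mul]
  have h2 : y ∈ Ideal.span {H} := by
    rw [← Ideal.Quotient.eq_zero_iff_mem, ← hmk, (mul_eq_zero.1 h1).resolve_left hP0, map_zero]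
  obtain ⟨y', rfl⟩ := Ideal.mem_span_singleton'.1 h2
  have hHne : H ≠ 0 := by
    intro h0
    have h1 := congrArg (fun f : LaurentRing K (Fin N) => f.coeff 0) h0
    simp only [hH, AddMonoidAlgebra.coeff_add, AddMonoidAlgebra.coeff_single, Finsupp.add_apply,
      AddMonoidAlgebra.coeff_zero, Finsupp.zero_apply, Finsupp.single_eq_same] at h1
    rw [Finsupp.single_eq_of_ne, add_zero] at h1
    · exact hα h1
    · intro h2
      have := congrFun h2 r
      rw [Pi.neg_apply, hv, Pi.zero_apply] at this
      omega
  exact ⟨y', mul_left_cancel₀ hHne (by rw [hy]; ring)⟩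

/-- In a neighbourhood of every point of a hypersurface `1 = ∑ c_d T^{e_d}` over `R` there is a point
of the same fibre at which the binomial `α + β T^{-v}` does not vanish. -/
theorem exists_prime_notMem_binomial {N : ℕ} {R : Type} [CommRing R] {v : Fin N → ℤ} {r : Fin N}
    (hv : v r = 1) (α β : Rˣ) {D : Type} [Fintype D]
    {e : D → Fin N → ℤ} (he : ∀ d, e d ≠ e d r • v) (c : D → R) {P : LaurentRing R (Fin N)}
    (hP : P = 1 - ∑ d, AddMonoidAlgebra.single (e d) (c d))
    (q : PrimeSpectrum (LaurentRing R (Fin N) ⧸ Ideal.span {P}))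
    {g : LaurentRing R (Fin N) ⧸ Ideal.span {P}} (hg : g ∉ q.asIdeal) :
    ∃ q' : PrimeSpectrum (LaurentRing R (Fin N) ⧸ Ideal.span {P}), g ∉ q'.asIdeal ∧
      Ideal.Quotient.mk (Ideal.span {P}) (AddMonoidAlgebra.single 0 (α : R) +
        AddMonoidAlgebra.single (-v) (β : R)) ∉ q'.asIdeal ∧
      q'.comap (algebraMap R _) = q.comap (algebraMap R _) := by
  set p := (q.comap (algebraMap R (LaurentRing R (Fin N) ⧸ Ideal.span {P}))).asIdeal with hp
  let K := p.ResidueField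
  let ρ : R →+* K := algebraMap R K
  let F : LaurentRing R (Fin N) →+* LaurentRing K (Fin N) := AddMonoidAlgebra.mapRingHom _ ρ
  have hF : ∀ m k, F (AddMonoidAlgebra.single m k) = AddMonoidAlgebra.single m (ρ k) :=
    fun m k => AddMonoidAlgebra.mapRingHom_single _ _ _
  have hFP : F P = 1 - ∑ d, AddMonoidAlgebra.single (e d) (ρ (c d)) := by
    refine (congrArg F hP).trans ?_
    rw [map_sub, map_one, map_sum]
    simp only [hF]
  -- `G` restricts functions to the fibre, and `E'` evaluates functions on the fibre at the given
  -- point. A function `g` that does not vanish at this point is not nilpotent on the fibre, and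
  -- neither is its product with the binomial.
  let G : LaurentRing R (Fin N) ⧸ Ideal.span {P} →+* LaurentRing K (Fin N) ⧸ Ideal.span {F P} :=
    Ideal.quotientMap _ F (by
      rw [Ideal.span_le, Set.singleton_subset_iff]
      exact Ideal.mem_span_singleton_self _)
  let σ : K →+* q.asIdeal.ResidueField := Ideal.ResidueField.map p q.asIdeal (algebraMap R _) rfl
  let M : Multiplicative (Fin N → ℤ) →* q.asIdeal.ResidueField :=
    { toFun := fun m => algebraMap _ _ (Ideal.Quotient.mk (Ideal.span {P})
        (AddMonoidAlgebra.single m.toAdd 1))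
      map_one' := by rw [toAdd_one, ← AddMonoidAlgebra.one_def, map_one, map_one]
      map_mul' := fun m m' => by
        rw [← map_mul, ← map_mul, AddMonoidAlgebra.single_mul_single, one_mul, toAdd_mul] }
  let E : LaurentRing K (Fin N) →+* q.asIdeal.ResidueField :=
    AddMonoidAlgebra.liftNCRingHom σ M fun _ _ => Commute.all _ _
  have hE : ∀ x, E (F x) = algebraMap _ _ (Ideal.Quotient.mk (Ideal.span {P}) x) := by
    refine RingHom.congr_fun (f := E.comp F) (g := (algebraMap _ _).comp
      (Ideal.Quotient.mk (Ideal.span {P}))) (AddMonoidAlgebra.ringHom_ext (fun k => ?_) fun m => ?_)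
    · rw [RingHom.comp_apply, hF]
      refine (AddMonoidAlgebra.liftNCRingHom_single _ _ _ _ _).trans ?_
      rw [ofAdd_zero, map_one, mul_one]
      exact Ideal.ResidueField.map_algebraMap _ _ _ _ _
    · rw [RingHom.comp_apply, hF, map_one]
      refine (AddMonoidAlgebra.liftNCRingHom_single _ _ _ _ _).trans ?_
      rw [map_one, one_mul]
      rfl
  let E' : LaurentRing K (Fin N) ⧸ Ideal.span {F P} →+* q.asIdeal.ResidueField :=
    Ideal.Quotient.lift _ E (by
      intro x hx
      obtain ⟨y, rfl⟩ := Ideal.mem_span_singleton'.1 hx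
      rw [map_mul, hE, Ideal.Quotient.eq_zero_iff_mem.2 (Ideal.mem_span_singleton_self _), map_zero,
        mul_zero])
  set h : LaurentRing R (Fin N) := AddMonoidAlgebra.single 0 (α : R) +
    AddMonoidAlgebra.single (-v) (β : R) with hh
  have hg' : ¬ IsNilpotent (G g) := by
    rintro ⟨k, hk⟩
    apply hg
    obtain ⟨x, rfl⟩ := Ideal.Quotient.mk_surjective g
    have h1 : E' (G (Ideal.Quotient.mk _ x)) = algebraMap _ _ (Ideal.Quotient.mk (Ideal.span {P}) x) :=
      hE x
    have h2 := congrArg E' hk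
    rw [map_pow, map_zero, h1] at h2
    exact Ideal.algebraMap_residueField_eq_zero.1 (eq_zero_of_pow_eq_zero h2)
  have hgh : ¬ IsNilpotent (G (g * Ideal.Quotient.mk _ h)) := by
    rintro ⟨k, hk⟩
    refine hg' ⟨k, ?_⟩
    obtain ⟨y, hy⟩ := Ideal.Quotient.mk_surjective (G g)
    have key : ∀ (k : ℕ) (y : LaurentRing K (Fin N)), F P ∣ F h ^ k * y → F P ∣ y := by
      intro k
      induction k with
      | zero => intro y hy; rwa [pow_zero, one_mul] at hy
      | succ k ih =>
        intro y hy
        rw [pow_succ, mul_assoc] at hy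
        have := ih _ hy
        rw [hh, map_add, hF, hF] at this
        exact dvd_of_dvd_binomial_mul hv (α.map ρ.toMonoidHom).ne_zero
          (β.map ρ.toMonoidHom).ne_zero he _ hFP this
    rw [map_mul, mul_pow, ← hy] at hk
    rw [← hy, ← map_pow, Ideal.Quotient.eq_zero_iff_dvd]
    refine key k _ ?_
    rw [← Ideal.Quotient.eq_zero_iff_dvd, mul_comm, map_mul, map_pow, map_pow]
    exact hk
  rw [nilpotent_iff_mem_prime] at hgh
  push Not at hgh
  obtain ⟨J, hJ, hJm⟩ := hgh
  rw [map_mul] at hJm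
  refine ⟨⟨J.comap G, hJ.comap G⟩, fun hm => hJm (J.mul_mem_right _ hm),
    fun hm => hJm (J.mul_mem_left _ hm), ?_⟩
  ext x
  change G (algebraMap R _ x) ∈ J ↔ x ∈ p
  have h1 : G (algebraMap R _ x) = algebraMap K (LaurentRing K (Fin N) ⧸ Ideal.span {F P}) (ρ x) :=
    congrArg (Ideal.Quotient.mk (Ideal.span {F P})) (hF 0 x)
  rw [h1, ← Ideal.algebraMap_residueField_eq_zero (I := p)]
  constructor
  · intro h2
    by_contra h3
    exact hJ.ne_top (J.eq_top_of_isUnit_mem h2 ((isUnit_iff_ne_zero.2 h3).map _))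
  · intro h2
    change ρ x = 0 at h2
    rw [h2, map_zero]
    exact J.zero_mem

end Density

/-! ### Birational families of schemes -/

section Roofs

open Limits

/-- The subset `U` of the total space of the family `π` is dense in every fibre: every
neighbourhood of a point contains a point of `U` in the same fibre. -/
def FiberwiseDense {X S : Scheme.{0}} (π : X ⟶ S) (U : Set X) : Prop :=
  ∀ (V : X.Opens) (x : X), x ∈ V → ∃ y ∈ V, y ∈ U ∧ π y = π x

variable {X X' X'' S S' S'' : Scheme.{0}}

theorem FiberwiseDense.dense {π : X ⟶ S} {U : Set X} (h : FiberwiseDense π U) : Dense U := by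
  refine dense_iff_inter_open.2 fun V hV hne => ?_
  obtain ⟨x, hx⟩ := hne
  obtain ⟨y, hy, hyU, -⟩ := h ⟨V, hV⟩ x hx
  exact ⟨y, hy, hyU⟩

theorem FiberwiseDense.dense_fiber {π : X ⟶ S} {U : X.Opens} (h : FiberwiseDense π (U : Set X))
    (s : S) : Dense ((π.fiberι s ⁻¹ᵁ U : (π.fiber s).Opens) : Set (π.fiber s)) := by
  refine dense_iff_inter_open.2 fun V hV hne => ?_
  obtain ⟨x, hx⟩ := hne
  obtain ⟨V', hV', rfl⟩ := (π.fiberι s).isEmbedding.isOpen_iff.1 hV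
  obtain ⟨y, hy, hyU, hyx⟩ := h ⟨V', hV'⟩ (π.fiberι s x) hx
  have hs : π (π.fiberι s x) = s := by
    have : π.fiberι s x ∈ Set.range (π.fiberι s) := ⟨x, rfl⟩
    rw [π.range_fiberι] at this
    exact this
  obtain ⟨z, rfl⟩ : y ∈ Set.range (π.fiberι s) := by
    rw [π.range_fiberι]
    exact hyx.trans hs
  exact ⟨z, hy, hyU⟩

/-- The families `π` and `π'` restrict to isomorphic families over `g` on fibrewise dense open
subschemes; the common open subscheme is given by a pair of open immersions. -/
def HasRoof (π : X ⟶ S) (π' : X' ⟶ S') (g : S ⟶ S') : Prop :=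
  ∃ (Z : Scheme.{0}) (j : Z ⟶ X) (j' : Z ⟶ X'), IsOpenImmersion j ∧ IsOpenImmersion j' ∧
    j ≫ π ≫ g = j' ≫ π' ∧ FiberwiseDense π (Set.range j) ∧ FiberwiseDense π' (Set.range j')

theorem HasRoof.birationalFamilies {B : Scheme.{0}} {b : S ⟶ B} {b' : S' ⟶ B} {π : X ⟶ S}
    {π' : X' ⟶ S'} (g : S ≅ S') (hg : g.hom ≫ b' = b) (h : HasRoof π π' g.hom) :
    BirationalFamilies b b' π π' := by
  obtain ⟨Z, j, j', hj, hj', hc, hd, hd'⟩ := h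
  refine ⟨g, ⟨j.opensRange, hd.dense, j'.opensRange, hd'.dense,
    j.isoOpensRange.symm ≪≫ j'.isoOpensRange⟩, hg, ?_,
    fun s => FiberwiseDense.dense_fiber (U := j.opensRange) hd s,
    fun s => FiberwiseDense.dense_fiber (U := j'.opensRange) hd' s⟩
  change (j.isoOpensRange.inv ≫ j'.isoOpensRange.hom) ≫ j'.opensRange.ι ≫ π' =
    j.opensRange.ι ≫ π ≫ g.hom
  rw [Category.assoc, Scheme.Hom.isoOpensRange_hom_ι_assoc, ← hc,
    Scheme.Hom.isoOpensRange_inv_comp_assoc]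

/-- The open subschemes of the middle family intersect in a fibrewise dense open subscheme, so roofs
compose by pullback. -/
theorem HasRoof.trans {π : X ⟶ S} {π' : X' ⟶ S'} {π'' : X'' ⟶ S''} {g : S ⟶ S'} {g' : S' ⟶ S''}
    [IsIso g] [IsIso g']
    (h : HasRoof π π' g) (h' : HasRoof π' π'' g') : HasRoof π π'' (g ≫ g') := by
  obtain ⟨Z, j, j', hj, hj', hc, hd, hd'⟩ := h
  obtain ⟨Z', k, k', hk, hk', hc', he, he'⟩ := h'
  refine ⟨pullback j' k, pullback.fst j' k ≫ j, pullback.snd j' k ≫ k', inferInstance,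
    inferInstance, ?_, ?_, ?_⟩
  · rw [Category.assoc, Category.assoc, ← hc', ← pullback.condition_assoc, ← reassoc_of% hc]
  · intro V x hx
    obtain ⟨_, hyV, ⟨z, rfl⟩, hyx⟩ := hd V x hx
    obtain ⟨y, hyW, ⟨z', rfl⟩, hy⟩ := he (j' ''ᵁ (j ⁻¹ᵁ V)) (j' z) ⟨z, hyV, rfl⟩
    obtain ⟨z₁, hz₁, hzz⟩ := hyW
    replace hzz : j' z₁ = k z' := hzz
    obtain ⟨t, ht, ht'⟩ := Scheme.Pullback.exists_preimage_pullback z₁ z' hzz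
    refine ⟨j z₁, hz₁, ⟨t, ?_⟩, ?_⟩
    · rw [Scheme.Hom.comp_apply, ht]
    · rw [← hzz] at hy
      refine (?_ : π (j z₁) = π (j z)).trans hyx
      have e : ∀ z, π' (j' z) = g (π (j z)) := fun z => by
        rw [← Scheme.Hom.comp_apply, ← hc, Scheme.Hom.comp_apply, Scheme.Hom.comp_apply]
      rw [e, e] at hy
      exact g.homeomorph.injective hy
  · intro V x hx
    obtain ⟨_, hyV, ⟨z', rfl⟩, hyx⟩ := he' V x hx
    obtain ⟨_, hyW, ⟨z, rfl⟩, hy⟩ := hd' (k ''ᵁ (k' ⁻¹ᵁ V)) (k z') ⟨z', hyV, rfl⟩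
    obtain ⟨z₁, hz₁, hzz⟩ := hyW
    replace hzz : k z₁ = j' z := hzz
    obtain ⟨t, ht, ht'⟩ := Scheme.Pullback.exists_preimage_pullback z z₁ hzz.symm
    refine ⟨k' z₁, hz₁, ⟨t, ?_⟩, ?_⟩
    · rw [Scheme.Hom.comp_apply, ht']
    · rw [← hzz] at hy
      refine (?_ : π'' (k' z₁) = π'' (k' z')).trans hyx
      have e : ∀ z, π'' (k' z) = g' (π' (k z)) := fun z => by
        rw [← Scheme.Hom.comp_apply, ← hc', Scheme.Hom.comp_apply, Scheme.Hom.comp_apply]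
      rw [e, e, hy]

theorem fiberwiseDense_range_of_isIso (π : X ⟶ S) (j : X' ⟶ X) [IsIso j] :
    FiberwiseDense π (Set.range j) :=
  fun _ x hx => ⟨x, hx, j.homeomorph.surjective x, rfl⟩

theorem FiberwiseDense.of_isIso_comp {π : X ⟶ S} {j : X' ⟶ X} (h : FiberwiseDense π (Set.range j))
    (f : X'' ⟶ X') [IsIso f] : FiberwiseDense π (Set.range (f ≫ j)) := by
  have hf : Set.range f = Set.univ := f.homeomorph.surjective.range_eq
  rwa [Scheme.Hom.comp_base, TopCat.coe_comp, Set.range_comp, hf, Set.image_univ]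

/-- Isomorphic families. -/
theorem HasRoof.of_iso {π : X ⟶ S} {π' : X' ⟶ S'} {g : S ⟶ S'} (f : X ⟶ X') [IsIso f]
    (h : π ≫ g = f ≫ π') : HasRoof π π' g :=
  ⟨X, 𝟙 X, f, inferInstance, inferInstance, by rw [Category.id_comp, h],
    fiberwiseDense_range_of_isIso π (𝟙 X), fiberwiseDense_range_of_isIso π' f⟩

end Roofs

section Braid

variable {n : ℕ}

/-- The parameter spaces are isomorphic over `Spec ℂ`, and over this isomorphism the families
restrict to isomorphic families on fibrewise dense open subschemes. -/
def Related (w w' : List (Fin n)) : Prop :=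
  ∃ g : paramSpace w ≅ paramSpace w', g.hom ≫ paramSpaceToSpec w' = paramSpaceToSpec w ∧
    HasRoof (family w) (family w') g.hom

theorem Related.refl (w : List (Fin n)) : Related w w :=
  ⟨Iso.refl _, Category.id_comp _, HasRoof.of_iso (𝟙 _) (by simp)⟩

theorem Related.trans {w w' w'' : List (Fin n)} (h : Related w w') (h' : Related w' w'') :
    Related w w'' := by
  obtain ⟨g, hg, hr⟩ := h
  obtain ⟨g', hg', hr'⟩ := h'
  exact ⟨g ≪≫ g', by rw [Iso.trans_hom, Category.assoc, hg', hg], hr.trans hr'⟩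

theorem specMap_comp {R R' R'' : Type} [CommRing R] [CommRing R'] [CommRing R''] (f : R →+* R')
    (f' : R' →+* R'') : Spec.map (CommRingCat.ofHom f') ≫ Spec.map (CommRingCat.ofHom f) =
      Spec.map (CommRingCat.ofHom (f'.comp f)) :=
  (Spec.map_comp _ _).symm

/-- The isomorphism of parameter spaces that is given by an isomorphism of parameter rings. -/
noncomputable def paramSpaceIso {w w' : List (Fin n)} (e : ParamRing w' ≃ₐ[ℂ] ParamRing w) :
    paramSpace w ≅ paramSpace w' :=
  Scheme.Spec.mapIso (e.toRingEquiv.toCommRingCatIso).op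

theorem paramSpaceIso_hom_comp {w w' : List (Fin n)} (e : ParamRing w' ≃ₐ[ℂ] ParamRing w) :
    (paramSpaceIso e).hom ≫ paramSpaceToSpec w' = paramSpaceToSpec w := by
  have : e.toAlgHom.toRingHom.comp (algebraMap ℂ (ParamRing w')) = algebraMap ℂ (ParamRing w) :=
    RingHom.ext fun c => e.commutes c
  exact (specMap_comp _ _).trans (congrArg (fun f => Spec.map (CommRingCat.ofHom f)) this)

variable {A B : List (Fin n)} {i j : Fin n}

/-- No exponent vector of a defining inequality is a multiple of the direction of the binomial. -/
theorem exponent_ne_smul_direction (h : Adjacent i j) (hw : IsAscending (braidWord A B i j))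
    (ha : A.length < (braidWord A B i j).length) (d : InequalityIndex (braidWord A B i j)) :
    exponent _ d ≠ exponent _ d ⟨A.length, ha⟩ •
      fun r : Fin (braidWord A B i j).length => direction A.length r := by
  have hlen := length_braidWord (A := A) (B := B) (i := i) (j := j)
  intro he
  obtain ⟨l, hl⟩ : ∃ l, l = exponent _ d ⟨A.length, ha⟩ := ⟨_, rfl⟩
  rw [← hl] at he
  rcases d with t | M
  · have key : ∀ r < (braidWord A B i j).length,
        lambdaVector (braidWord A B i j) t r = l * direction A.length r := fun r hr => by
      rw [← extendZero_lambdaExponent]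
      exact (extendZero_val _ ⟨r, hr⟩).trans (congrFun he ⟨r, hr⟩)
    have k0 := key A.length (by omega)
    have k1 := key (A.length + 1) (by omega)
    have k2 := key (A.length + 2) (by omega)
    rw [direction, patch_zero] at k0
    rw [direction, patch_one] at k1
    rw [direction, patch_two] at k2
    by_cases ht : A.length ≤ (t : ℕ) ∧ (t : ℕ) < A.length + 3
    · rcases (show (t : ℕ) = A.length ∨ (t : ℕ) = A.length + 1 ∨ (t : ℕ) = A.length + 2 by omega)
        with h1 | h1 | h1 <;> rw [h1] at k0 k1 k2
      · have e := lambdaVector_zero (A := A) (B := B) h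
        omega
      · have e := lambdaVector_one (A := A) (B := B) h
        omega
      · have e := lambdaVector_two (A := A) (B := B) (i := i) (j := j)
        omega
    · have k := key t t.2
      rw [lambdaVector_self, direction, patch_other ht, Pi.zero_apply, mul_zero] at k
      omega
  · refine not_mem_pathVectors_of_triple h hw (l := l) ?_
    convert extendZero_mem_pathVectors.2 M.2 using 1
    funext r
    by_cases hr : r < (braidWord A B i j).length
    · refine Eq.trans ?_ ((congrFun he ⟨r, hr⟩).symm.trans (extendZero_val M.1 ⟨r, hr⟩).symm)
      change _ = l * direction A.length r
      unfold direction patch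
      split_ifs <;> simp
    · rw [patch_other (by omega), extendZero, dif_neg hr, Pi.zero_apply]

theorem binomial_eq_mk (w : List (Fin n)) (a : ℕ) (α β : (ParamRing w)ˣ) :
    binomial w a α β = Ideal.Quotient.mk (Ideal.span {universalPolynomial w})
      (AddMonoidAlgebra.single 0 (α : ParamRing w) +
        AddMonoidAlgebra.single (- fun r : Fin w.length => direction a r) (β : ParamRing w)) := by
  have h : (AddMonoidAlgebra.single (- fun r : Fin w.length => direction a r) (β : ParamRing w) :
      LaurentRing (ParamRing w) (Fin w.length)) = algebraMap (ParamRing w) _ β *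
        AddMonoidAlgebra.single (fun r : Fin w.length => (- direction a) r) 1 := by
    rw [AddMonoidAlgebra.coe_algebraMap]
    simp only [Function.comp_apply, AddMonoidAlgebra.single_mul_single, mul_one, zero_add]
    rfl
  rw [h, map_add, map_mul]
  rfl

/-- The open subscheme of the family on which the binomial does not vanish. -/
noncomputable def binomialChart (w : List (Fin n)) (a : ℕ) (α β : (ParamRing w)ˣ) :
    Spec (CommRingCat.of (Localization.Away (binomial w a α β))) ⟶ familySpace w :=
  Spec.map (CommRingCat.ofHom
    (algebraMap (FamilyRing w) (Localization.Away (binomial w a α β))))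

instance (w : List (Fin n)) (a : ℕ) (α β : (ParamRing w)ˣ) :
    IsOpenImmersion (binomialChart w a α β) :=
  inferInstanceAs (IsOpenImmersion (Spec.map (CommRingCat.ofHom
    (algebraMap (FamilyRing w) (Localization.Away (binomial w a α β))))))

theorem fiberwiseDense_binomial (h : Adjacent i j) (hw : IsAscending (braidWord A B i j))
    (α β : (ParamRing (braidWord A B i j))ˣ) :
    FiberwiseDense (family (braidWord A B i j))
      (Set.range (binomialChart (braidWord A B i j) A.length α β)) := by
  have hlen := length_braidWord (A := A) (B := B) (i := i) (j := j)
  intro V x hx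
  obtain ⟨_, ⟨g, rfl⟩, hg, hgV⟩ :=
    PrimeSpectrum.isTopologicalBasis_basic_opens.exists_subset_of_mem_open hx V.2
  obtain ⟨q, hq, hqb, hqx⟩ := exists_prime_notMem_binomial
    (v := fun r : Fin (braidWord A B i j).length => direction A.length r)
    (r := ⟨A.length, by omega⟩) (patch_zero _ _ _ _ _) α β
    (exponent_ne_smul_direction h hw (by omega)) (coefficient _) rfl x hg
  replace hqb : binomial (braidWord A B i j) A.length α β ∉ q.asIdeal := by
    rw [binomial_eq_mk]
    exact hqb
  refine ⟨q, hgV hq, ?_, hqx⟩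
  exact (PrimeSpectrum.localization_away_comap_range
    (Localization.Away (binomial (braidWord A B i j) A.length α β)) _).ge hqb

/-- The families of two words that differ by a braid move. -/
theorem related_braidWord (h : Adjacent i j) (hw : IsAscending (braidWord A B i j))
    (hw' : IsAscending (braidWord A B j i)) :
    Related (braidWord A B i j) (braidWord A B j i) := by
  obtain ⟨α, β, α', β', e, T, T'⟩ := exists_transition h hw hw'
  obtain ⟨Φ, hΦ⟩ := T.exists_equiv
    (Localization.Away (binomial (braidWord A B i j) A.length α β))
    (Localization.Away (binomial (braidWord A B j i) A.length α' β')) T'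
    (fun c => e.apply_symm_apply c) (fun c => e.symm_apply_apply c)
  refine ⟨paramSpaceIso e, paramSpaceIso_hom_comp e, _, binomialChart _ _ α β,
    Spec.map Φ.toCommRingCatIso.hom ≫ binomialChart _ _ α' β', inferInstance, inferInstance, ?_,
    fiberwiseDense_binomial h hw α β, (fiberwiseDense_binomial h.symm hw' α' β').of_isIso_comp _⟩
  have key : (paramIn (braidWord A B i j)
      (Localization.Away (binomial (braidWord A B i j) A.length α β))).comp e.toAlgHom.toRingHom =
      Φ.toRingHom.comp (paramIn (braidWord A B j i)
        (Localization.Away (binomial (braidWord A B j i) A.length α' β'))) :=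
    RingHom.ext fun c => (hΦ c).symm
  have h₁ : family (braidWord A B i j) ≫ (paramSpaceIso e).hom =
      Spec.map (CommRingCat.ofHom ((algebraMap (ParamRing (braidWord A B i j))
        (FamilyRing (braidWord A B i j))).comp e.toAlgHom.toRingHom)) := specMap_comp _ _
  have h₂ : binomialChart _ A.length α' β' ≫ family (braidWord A B j i) =
      Spec.map (CommRingCat.ofHom (paramIn (braidWord A B j i)
        (Localization.Away (binomial (braidWord A B j i) A.length α' β')))) := specMap_comp _ _
  rw [h₁, Category.assoc, h₂]
  exact (specMap_comp _ _).trans ((congrArg (fun f => Spec.map (CommRingCat.ofHom f)) key).trans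
    (specMap_comp _ _).symm)

end Braid

/-! ### Commuting crossings -/

section Commutation

variable {n : ℕ} {A B : List (Fin n)} {i j : Fin n}

theorem length_pairWord : (pairWord A B i j).length = A.length + B.length + 2 := by
  simp only [pairWord, List.length_append, List.length_cons, List.length_nil]
  omega

theorem swap_cases (a r : ℕ) : (r = a ∧ Equiv.swap a (a + 1) r = a + 1) ∨
    (r = a + 1 ∧ Equiv.swap a (a + 1) r = a) ∨
    ((r < a ∨ a + 1 < r) ∧ Equiv.swap a (a + 1) r = r) := by
  by_cases h0 : r = a
  · exact Or.inl ⟨h0, by rw [h0, Equiv.swap_apply_left]⟩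
  · by_cases h1 : r = a + 1
    · exact Or.inr (Or.inl ⟨h1, by rw [h1, Equiv.swap_apply_right]⟩)
    · exact Or.inr (Or.inr ⟨by omega, Equiv.swap_apply_of_ne_of_ne h0 h1⟩)

theorem columnAt_pair_zero : columnAt (pairWord A B i j) A.length = i :=
  columnAt_middle [i, j] (r := 0) (by simp)

theorem columnAt_pair_one : columnAt (pairWord A B i j) (A.length + 1) = j :=
  columnAt_middle [i, j] (r := 1) (by simp)

theorem columnAt_swap (r : ℕ) : columnAt (pairWord A B i j) (Equiv.swap A.length (A.length + 1) r) =
    columnAt (pairWord A B j i) r := by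
  rcases swap_cases A.length r with ⟨h, e⟩ | ⟨h, e⟩ | ⟨h, e⟩ <;> rw [e]
  · rw [h, columnAt_pair_one, columnAt_pair_zero]
  · rw [h, columnAt_pair_one, columnAt_pair_zero]
  · exact columnAt_agree (μ := [j, i]) (μ' := [i, j]) rfl (by simp; omega)

theorem columnPairing_distant (h : Distant i j) : columnPairing i j = 0 := by
  unfold Distant at h
  rw [columnPairing, if_neg (by omega), if_neg (by omega)]

theorem lambdaVector_swap (h : Distant i j) (t r : ℕ) :
    lambdaVector (pairWord A B i j) (Equiv.swap A.length (A.length + 1) t)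
      (Equiv.swap A.length (A.length + 1) r) = lambdaVector (pairWord A B j i) t r := by
  unfold lambdaVector
  rw [columnAt_swap, columnAt_swap, length_pairWord, length_pairWord]
  by_cases hrt : r = t
  · rw [if_pos hrt, if_pos (by rw [hrt])]
  · rw [if_neg hrt, if_neg (fun e => hrt ((Equiv.swap _ _).injective e))]
    rcases swap_cases A.length t with ⟨h₁, e₁⟩ | ⟨h₁, e₁⟩ | ⟨h₁, e₁⟩ <;>
      rcases swap_cases A.length r with ⟨h₂, e₂⟩ | ⟨h₂, e₂⟩ | ⟨h₂, e₂⟩ <;> rw [e₁, e₂]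
    · omega
    · rw [h₁, h₂, columnAt_pair_zero, columnAt_pair_one, columnPairing_distant h.symm, ite_self,
        ite_self]
    · exact if_congr (by omega) rfl rfl
    · rw [h₁, h₂, columnAt_pair_zero, columnAt_pair_one, columnPairing_distant h, ite_self,
        ite_self]
    · omega
    · exact if_congr (by omega) rfl rfl
    · exact if_congr (by omega) rfl rfl
    · exact if_congr (by omega) rfl rfl

theorem IsBoxAt.swap (h : Distant i j) {t b : ℕ} (hb : IsBoxAt (pairWord A B j i) t b) :
    IsBoxAt (pairWord A B i j) (Equiv.swap A.length (A.length + 1) t)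
      (Equiv.swap A.length (A.length + 1) b) := by
  have hne : ∀ t r, t < r → columnAt (pairWord A B j i) r = columnAt (pairWord A B j i) t →
      Equiv.swap A.length (A.length + 1) t < Equiv.swap A.length (A.length + 1) r := by
    intro t r htr hc
    unfold Distant at h
    rcases swap_cases A.length t with ⟨h₁, e₁⟩ | ⟨h₁, e₁⟩ | ⟨h₁, e₁⟩ <;>
      rcases swap_cases A.length r with ⟨h₂, e₂⟩ | ⟨h₂, e₂⟩ | ⟨h₂, e₂⟩ <;> rw [e₁, e₂] <;>
      try omega
    rw [h₁, h₂, columnAt_pair_zero, columnAt_pair_one] at hc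
    omega
  have hlen := length_pairWord (A := A) (B := B) (i := i) (j := j)
  have hlen' := length_pairWord (A := A) (B := B) (i := j) (j := i)
  have hbl := hb.lt_length
  refine ⟨hne t b hb.lt hb.column_eq.symm, ?_, ?_, fun r hr hr' hc => ?_⟩
  · rcases swap_cases A.length b with ⟨h₁, e₁⟩ | ⟨h₁, e₁⟩ | ⟨h₁, e₁⟩ <;> omega
  · rw [columnAt_swap, columnAt_swap, hb.column_eq]
  · obtain ⟨r, rfl⟩ := (Equiv.swap A.length (A.length + 1)).surjective r
    rw [columnAt_swap, columnAt_swap] at hc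
    rcases lt_trichotomy r t with h1 | h1 | h1
    · exact (hne _ _ h1 hc.symm).not_gt hr
    · exact (h1 ▸ hr).false
    · rcases lt_trichotomy r b with h2 | h2 | h2
      · exact hb.column_ne r h1 h2 hc
      · exact (h2 ▸ hr').false
      · exact (hne _ _ h2 (hc.trans hb.column_eq)).not_gt hr'

theorem BoxPair.swap (h : Distant i j) {t b : ℕ} {M₁ M₂ : ℕ → ℤ}
    (hp : BoxPair (pairWord A B j i) t b M₁ M₂) :
    BoxPair (pairWord A B i j) (Equiv.swap A.length (A.length + 1) t)
      (Equiv.swap A.length (A.length + 1) b) (M₁ ∘ Equiv.swap A.length (A.length + 1))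
      (M₂ ∘ Equiv.swap A.length (A.length + 1)) where
  isBox := hp.isBox.swap h
  add_eq r := by
    obtain ⟨r, rfl⟩ := (Equiv.swap A.length (A.length + 1)).surjective r
    rw [lambdaVector_swap h, lambdaVector_swap h, Function.comp_apply, Function.comp_apply,
      Equiv.swap_apply_self, hp.add_eq]
  top_eq := by rw [Function.comp_apply, Equiv.swap_apply_self, hp.top_eq]
  bot_eq := by rw [Function.comp_apply, Equiv.swap_apply_self, hp.bot_eq]

theorem swap_lt {N a r : ℕ} (ha : a + 2 ≤ N) (hr : r < N) : Equiv.swap a (a + 1) r < N := by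
  rcases swap_cases a r with ⟨h₁, e₁⟩ | ⟨h₁, e₁⟩ | ⟨h₁, e₁⟩ <;> omega

theorem comp_swap_comp_swap (M : ℕ → ℤ) (a b : ℕ) : (M ∘ Equiv.swap a b) ∘ Equiv.swap a b = M := by
  funext r
  simp

/-- Renumbering of the coefficients, as a homomorphism of the parameter rings. -/
theorem exists_swapHom (h : Distant i j) (hw : IsAscending (pairWord A B i j))
    (hw' : IsAscending (pairWord A B j i)) :
    ∃ θ : ParamRing (pairWord A B j i) →ₐ[ℂ] ParamRing (pairWord A B i j),
      (∀ M ∈ pathVectors (pairWord A B j i), θ (stringCoeff (pairWord A B j i) M) =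
        stringCoeff (pairWord A B i j) (M ∘ Equiv.swap A.length (A.length + 1))) ∧
      ∀ t < (pairWord A B j i).length, θ (lambdaCoeff (pairWord A B j i) t) =
        lambdaCoeff (pairWord A B i j) (Equiv.swap A.length (A.length + 1) t) := by
  have key : SolvesBoxes (pairWord A B j i)
      (fun M => stringCoeff (pairWord A B i j) (M ∘ Equiv.swap A.length (A.length + 1)))
      (fun t => lambdaCoeff (pairWord A B i j) (Equiv.swap A.length (A.length + 1) t)) :=
    fun t b M₁ h₁ M₂ h₂ hp => solvesBoxes_coeff _ _ _ _
      (commute_transfer h.symm hw' hw h₁) _ (commute_transfer h.symm hw' hw h₂) (hp.swap h)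
  refine ⟨paramHom
    (fun M => (stringCoeff_isUnit (pairWord A B i j)
      (M ∘ Equiv.swap A.length (A.length + 1))).unit)
    (fun t => (lambdaCoeff_isUnit (pairWord A B i j)
      (Equiv.swap A.length (A.length + 1) t)).unit) key,
    fun M hM => paramHom_stringCoeff _ _ key hM, fun t ht => paramHom_lambdaCoeff _ _ key ht⟩

theorem swapHom_comp_eq
    {θ : ParamRing (pairWord A B j i) →ₐ[ℂ] ParamRing (pairWord A B i j)}
    {θ' : ParamRing (pairWord A B i j) →ₐ[ℂ] ParamRing (pairWord A B j i)}
    (h : Distant i j) (hw : IsAscending (pairWord A B i j))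
    (hw' : IsAscending (pairWord A B j i))
    (hs : ∀ M ∈ pathVectors (pairWord A B j i), θ (stringCoeff (pairWord A B j i) M) =
        stringCoeff (pairWord A B i j) (M ∘ Equiv.swap A.length (A.length + 1)))
    (hl : ∀ t < (pairWord A B j i).length, θ (lambdaCoeff (pairWord A B j i) t) =
        lambdaCoeff (pairWord A B i j) (Equiv.swap A.length (A.length + 1) t))
    (hs' : ∀ M ∈ pathVectors (pairWord A B i j), θ' (stringCoeff (pairWord A B i j) M) =
        stringCoeff (pairWord A B j i) (M ∘ Equiv.swap A.length (A.length + 1)))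
    (hl' : ∀ t < (pairWord A B i j).length, θ' (lambdaCoeff (pairWord A B i j) t) =
        lambdaCoeff (pairWord A B j i) (Equiv.swap A.length (A.length + 1) t)) :
    θ.comp θ' = AlgHom.id ℂ _ := by
  have hlen := length_pairWord (A := A) (B := B) (i := i) (j := j)
  have hlen' := length_pairWord (A := A) (B := B) (i := j) (j := i)
  refine paramHom_ext (fun M hM => ?_) fun t ht => ?_
  · rw [AlgHom.comp_apply, hs' M hM, hs _ (commute_transfer h hw hw' hM), comp_swap_comp_swap]
    rfl
  · rw [AlgHom.comp_apply, hl' t ht, hl _ (swap_lt (by omega) (by omega)), Equiv.swap_apply_self]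
    rfl

/-- Renumbering of the coordinates of the torus. -/
noncomputable def swapTorus (w : List (Fin n)) (a : ℕ) :
    Multiplicative (ℕ → ℤ) →* (FamilyRing w)ˣ where
  toFun M := coordinate w (.ofAdd (M.toAdd ∘ Equiv.swap a (a + 1)))
  map_one' := map_one (coordinate w)
  map_mul' M M' := map_mul (coordinate w) (.ofAdd (M.toAdd ∘ Equiv.swap a (a + 1)))
    (.ofAdd (M'.toAdd ∘ Equiv.swap a (a + 1)))

theorem exists_swapFamilyHom (h : Distant i j) (hw : IsAscending (pairWord A B i j))
    (hw' : IsAscending (pairWord A B j i))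
    {θ : ParamRing (pairWord A B j i) →ₐ[ℂ] ParamRing (pairWord A B i j)}
    (hs : ∀ M ∈ pathVectors (pairWord A B j i), θ (stringCoeff (pairWord A B j i) M) =
        stringCoeff (pairWord A B i j) (M ∘ Equiv.swap A.length (A.length + 1)))
    (hl : ∀ t < (pairWord A B j i).length, θ (lambdaCoeff (pairWord A B j i) t) =
        lambdaCoeff (pairWord A B i j) (Equiv.swap A.length (A.length + 1) t)) :
    ∃ Φ : FamilyRing (pairWord A B j i) →+* FamilyRing (pairWord A B i j),
      (∀ c, Φ (algebraMap _ _ c) = algebraMap _ _ (θ c)) ∧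
      ∀ m : Fin (pairWord A B j i).length → ℤ, 
        Φ (coordinate (pairWord A B j i) (.ofAdd (extendZero m))) =
          coordinate (pairWord A B i j)
            (.ofAdd (extendZero m ∘ Equiv.swap A.length (A.length + 1))) := by
  have hlen := length_pairWord (A := A) (B := B) (i := i) (j := j)
  have hlen' := length_pairWord (A := A) (B := B) (i := j) (j := i)
  have key : inequalitySum (pairWord A B j i)
      (fun M => (algebraMap (ParamRing (pairWord A B i j)) (FamilyRing (pairWord A B i j))).comp
        θ.toRingHom (stringCoeff (pairWord A B j i) M))
      (fun t => (algebraMap (ParamRing (pairWord A B i j)) (FamilyRing (pairWord A B i j))).comp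
        θ.toRingHom (lambdaCoeff (pairWord A B j i) t))
      (swapTorus (pairWord A B i j) A.length) = 1 := by
    rw [← inequalitySum_coordinate (pairWord A B i j)]
    unfold inequalitySum
    congr 1
    · refine Finset.sum_equiv (Equiv.swap A.length (A.length + 1)) (fun t => ?_) fun t ht => ?_
      · rw [Finset.mem_range, Finset.mem_range]
        refine ⟨fun ht => swap_lt (by omega) (by omega), fun ht => ?_⟩
        have := swap_lt (N := (pairWord A B j i).length) (a := A.length) (by omega) (hlen'.trans hlen.symm ▸ ht)
        rwa [Equiv.swap_apply_self] at this
      · refine congrArg₂ (· * ·) (congrArg (algebraMap (ParamRing (pairWord A B i j)) (FamilyRing (pairWord A B i j)))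
          (hl t (Finset.mem_range.1 ht))) ?_
        refine congrArg (fun M => (coordinate (pairWord A B i j) (.ofAdd M)).val) (funext fun r => ?_)
        obtain ⟨r, rfl⟩ := (Equiv.swap A.length (A.length + 1)).surjective r
        rw [lambdaVector_swap h, Function.comp_apply, Equiv.swap_apply_self]
        rfl
    · refine Finset.sum_nbij' (fun M => M ∘ Equiv.swap A.length (A.length + 1))
        (fun M => M ∘ Equiv.swap A.length (A.length + 1)) (fun M hM => ?_) (fun M hM => ?_)
        (fun M _ => comp_swap_comp_swap _ _ _) (fun M _ => comp_swap_comp_swap _ _ _)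
        fun M hM => ?_
      · rw [Set.Finite.mem_toFinset] at hM ⊢
        exact commute_transfer h.symm hw' hw hM
      · rw [Set.Finite.mem_toFinset] at hM ⊢
        exact commute_transfer h hw hw' hM
      · exact congrArg₂ (· * ·) (congrArg (algebraMap (ParamRing (pairWord A B i j)) (FamilyRing (pairWord A B i j)))
          (hs M ((Set.Finite.mem_toFinset _).1 hM))) rfl
  exact ⟨familyHom _ _ key, familyHom_algebraMap _ _ key, familyHom_coordinate _ _ key⟩

theorem swapFamilyHom_comp_eq
    {θ : ParamRing (pairWord A B j i) →ₐ[ℂ] ParamRing (pairWord A B i j)}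
    {θ' : ParamRing (pairWord A B i j) →ₐ[ℂ] ParamRing (pairWord A B j i)}
    (hθ : θ.comp θ' = AlgHom.id ℂ _)
    {Φ : FamilyRing (pairWord A B j i) →+* FamilyRing (pairWord A B i j)}
    {Φ' : FamilyRing (pairWord A B i j) →+* FamilyRing (pairWord A B j i)}
    (h₁ : ∀ c, Φ (algebraMap _ _ c) = algebraMap _ _ (θ c))
    (h₂ : ∀ m : Fin (pairWord A B j i).length → ℤ,
        Φ (coordinate (pairWord A B j i) (.ofAdd (extendZero m))) =
          coordinate (pairWord A B i j)
            (.ofAdd (extendZero m ∘ Equiv.swap A.length (A.length + 1))))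
    (h₁' : ∀ c, Φ' (algebraMap _ _ c) = algebraMap _ _ (θ' c))
    (h₂' : ∀ m : Fin (pairWord A B i j).length → ℤ,
        Φ' (coordinate (pairWord A B i j) (.ofAdd (extendZero m))) =
          coordinate (pairWord A B j i)
            (.ofAdd (extendZero m ∘ Equiv.swap A.length (A.length + 1)))) :
    Φ.comp Φ' = RingHom.id _ := by
  have hlen := length_pairWord (A := A) (B := B) (i := i) (j := j)
  have hlen' := length_pairWord (A := A) (B := B) (i := j) (j := i)
  refine familyHom_ext (fun c => ?_) fun m => ?_
  · rw [RingHom.comp_apply, h₁', h₁]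
    exact congrArg _ (DFunLike.congr_fun hθ c)
  · obtain ⟨m', hm'⟩ := eq_extendZero (N := (pairWord A B j i).length)
      (M := extendZero m ∘ Equiv.swap A.length (A.length + 1)) (fun r hr => by
        rw [Function.comp_apply, Equiv.swap_apply_of_ne_of_ne (by omega) (by omega), extendZero,
          dif_neg (by omega)])
    rw [RingHom.comp_apply, h₂', hm', h₂, ← hm', comp_swap_comp_swap]
    rfl

/-- The families of two words that differ by a commutation of distant letters. -/
theorem related_pairWord (h : Distant i j) (hw : IsAscending (pairWord A B i j))
    (hw' : IsAscending (pairWord A B j i)) :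
    Related (pairWord A B i j) (pairWord A B j i) := by
  obtain ⟨θ, hs, hl⟩ := exists_swapHom h hw hw'
  obtain ⟨θ', hs', hl'⟩ := exists_swapHom h.symm hw' hw
  have e := swapHom_comp_eq h hw hw' hs hl hs' hl'
  have e' := swapHom_comp_eq h.symm hw' hw hs' hl' hs hl
  obtain ⟨Φ, h₁, h₂⟩ := exists_swapFamilyHom h hw hw' hs hl
  obtain ⟨Φ', h₁', h₂'⟩ := exists_swapFamilyHom h.symm hw' hw hs' hl'
  let Ψ : FamilyRing (pairWord A B j i) ≃+* FamilyRing (pairWord A B i j) :=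
    RingEquiv.ofRingHom Φ Φ' (swapFamilyHom_comp_eq e h₁ h₂ h₁' h₂')
      (swapFamilyHom_comp_eq e' h₁' h₂' h₁ h₂)
  let f : familySpace (pairWord A B i j) ⟶ familySpace (pairWord A B j i) :=
    Spec.map Ψ.toCommRingCatIso.hom
  have : IsIso f := inferInstanceAs (IsIso (Spec.map Ψ.toCommRingCatIso.hom))
  refine ⟨paramSpaceIso (AlgEquiv.ofAlgHom θ θ' e e'), paramSpaceIso_hom_comp _,
    HasRoof.of_iso f ?_⟩
  have key : (algebraMap (ParamRing (pairWord A B i j)) (FamilyRing (pairWord A B i j))).comp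
      θ.toRingHom = Φ.comp (algebraMap (ParamRing (pairWord A B j i)) _) :=
    RingHom.ext fun c => (h₁ c).symm
  exact (specMap_comp _ _).trans ((congrArg (fun f => Spec.map (CommRingCat.ofHom f)) key).trans
    (specMap_comp _ _).symm)

end Commutation

/-! ### Reduced decompositions -/

section Reduced

variable {n : ℕ}

theorem WordMove.related {v w : List (Fin n)} (h : WordMove v w) (hv : IsAscending v)
    (hw : IsAscending w) : Related v w := by
  cases h with
  | commute A B i j h => exact related_pairWord h hv hw
  | braid A B i j h => exact related_braidWord h hv hw

/-- Moves preserve the length and the permutation; so every word on the way is reduced and no two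
strings cross twice in its diagram. -/
theorem related_of_moves {v w : List (Fin n)} (h : Relation.ReflTransGen WordMove v w)
    (hv : v.length = inversionCount (wordProd v)) : Related v w := by
  have key : w.length = inversionCount (wordProd w) ∧ Related v w := by
    induction h with
    | refl => exact ⟨hv, Related.refl v⟩
    | tail _ h ih =>
      have hw := ih.1
      rw [h.length_eq, h.wordProd_eq] at hw
      exact ⟨hw, ih.2.trans (h.related (leftString_lt_rightString ih.1)
        (leftString_lt_rightString hw))⟩
  exact key.2

end Reduced

theorem corollary4p12 (n : ℕ) (w w' : List (Fin n))
    (hw : IsReducedDecomposition w (longestElement n))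
    (hw' : IsReducedDecomposition w' (longestElement n)) :
    BirationalFamilies (paramSpaceToSpec w) (paramSpaceToSpec w') (family w) (family w') := by
  have h := connected_by_moves _ w w' (hw.1.trans hw'.1.symm) hw.length_eq hw'.length_eq
    (congrArg inversionCount hw'.1)
  obtain ⟨g, hg, hr⟩ := related_of_moves h (by rw [hw.1, hw.length_eq])
  exact hr.birationalFamilies g hg
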